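/- **Setting.** For each $n\ge 1$ let $m=m(n)$ and $p=p(n)$ be integers such that, as $n\to\infty$, $n/m\to\varphi_m\in(0,\infty)$ and $n/p\to\varphi_p\in(0,\infty)$; put $N=n+m+2p$. Let $h:\mathbb R\to\mathbb R$ be an odd polynomial, and let $\Upsilon_x=(\gamma_{ij})\in\mathbb R^{n\times p}$ be deterministic matrices such that, for a constant $\gamma>0$ independent of $n$, $\Upsilon_x=U_x^\top V_x$ where the columns of $U_x\in\mathbb R^{r\times n}$ and $V_x\in\mathbb R^{r\times p}$ have Euclidean norm at most $\sqrt\gamma$ ($r$ may depend on $n$). Let $\mathcal W\in\mathbb R^{m\times p}$, $X^G\in\mathbb R^{n\times p}$, $Z^G\in\mathbb R^{m\times n}$ be, for each $n$, independent random matrices with iid $\mathcal N(0,1)$ entries, all defined on one probability space (nothing is assumed on their joint law for different $n$), and let $\mathcal X=\Upsilon_x\circ X^G$ (entrywise product). With $\xi\sim\mathcal N(0,1)$ let $$D_2=\operatorname{diag}_i\Big(\big(\tfrac1p\textstyle\sum_j\gamma_{ij}^2\big)^{1/2}\Big),\qquad D_{lin}=\mathbb E[h'(\xi D_2)],\qquad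 D_{chaos}=\sum_{\ell\ge2}\tfrac1{\ell!}\mathbb E[h^{(\ell)}(\xi D_2)]$$ (diagonal $n\times n$ matrices, functions being applied to the diagonal entries). In blocks of sizes $n,m,p,p$ define $$L=\begin{pmatrix}0&\frac{D_{chaos}Z^{G\top}}{\sqrt n}&-\frac{D_{lin}\mathcal X}{\sqrt n}&0\\ \frac{Z^GD_{chaos}}{\sqrt n}&-I_m&0&-\frac{\mathcal W}{\sqrt p}\\ -\frac{\mathcal X^\top D_{lin}}{\sqrt n}&0&0&-I_p\\ 0&-\frac{\mathcal W^\top}{\sqrt p}&-I_p&0\end{pmatrix},\qquad C_N=\begin{pmatrix}0&0&0&0\\0&-I_m&0&0\\0&0&0&-I_p\\0&0&-I_p&0\end{pmatrix},$$ $$(\gamma^{(L)}_{ij})=\begin{pmatrix}0&c_nD_{chaos}\mathbf 1_{n\times m}&c_nD_{lin}\Upsilon_x&0\\ c_n\mathbf 1_{m\times n}D_{chaos}&0&0&c_p\mathbf 1_{m\times p}\\ c_n\Upsilon_x^\top D_{lin}&0&0&0\\0&c_p\mathbf 1_{p\times m}&0&0\end{pmatrix},\qquad c_n=\sqrt{N/n},\quad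 c_p=\sqrt{N/p},$$ and $\gamma_{\max}=\max_{i,j}|\gamma_{ij}^{(L)}|$. For a diagonal matrix $\Lambda\in\mathbb C^{N\times N}$ with $L-\Lambda$ invertible put $\mathfrak Q(\Lambda)=(L-\Lambda)^{-1}$. The map $id_4\otimes\Delta$ keeps the diagonals of the blocks $11,22,33,44,34,43$ of an $N\times N$ matrix and replaces all its other entries by $0$. Let $\mathcal R_N(M)=\operatorname{diag}_i\big(\sum_{j}\frac{(\gamma_{ij}^{(L)})^2}{N}M(j,j)\big)$, $\operatorname{Im}M=\frac1{2i}(M-M^*)$, and let $D_N(\mathbb C)^+$ be the set of diagonal matrices $\Lambda\in\mathbb C^{N\times N}$ with $\operatorname{Im}\Lambda>0$. Write $\|\cdot\|$ for the operator norm and $\|A\|_{F,n}=(\frac1n\operatorname{Tr}AA^*)^{1/2}$. Fix $\lambda>0$, $0<\delta<1$ and $\kappa>0$, and put $\Lambda_\lambda=-\lambda I_n\otimes E_{11}=\operatorname{diag}(-\lambda I_n,0,0,0)$ and $$\eta_N=\left(\frac{\gamma_{\max}^2}{(1-\delta)n}\big(2\sqrt2\,\gamma_{\max}^3+\kappa\big)\right)^{1/5}.$$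 **Statement.** For every $n$ there is a unique function $\mathfrak Q^\square$ on $D_N(\mathbb C)^+$, with values in the matrices $M\in\mathbb C^{N\times N}$ such that $\operatorname{Im}M>0$, analytic in each variable, satisfying $$\mathfrak Q^\square(\Lambda)=id_4\otimes\Delta\Big[\big(C_N-\Lambda-\mathcal R_N(\mathfrak Q^\square(\Lambda))\big)^{-1}\Big]\qquad\text{for all }\Lambda\in D_N(\mathbb C)^+ .$$ Moreover, almost surely, $$\lim_{n\to\infty}\big\|id_4\otimes\Delta[\mathfrak Q(\Lambda_\lambda+i\eta_NI_N)]-\mathfrak Q^\square(\Lambda_\lambda+i\eta_NI_N)\big\|=0,$$ and, almost surely, $$\lim_{n\to\infty}\big\|\mathfrak Q^\square(\Lambda_\lambda+i\eta_NI_N)-id_4\otimes\Delta[\mathfrak Q(\Lambda_\lambda)]\big\|_{F,n}=0 .$$ -/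

import Mathlib

open MeasureTheory ProbabilityTheory Filter Topology
open scoped Matrix Polynomial ComplexOrder

noncomputable section

namespace RFSquare

/-- Index set of the `N × N` matrices, `N = n + m + 2p`, split into four blocks of sizes
`n, m, p, p`. -/
abbrev BIdx (n m p : ℕ) : Type := Fin n ⊕ Fin m ⊕ Fin p ⊕ Fin p

section Deterministic

variable {n m p : ℕ}

/-- Diagonal entries of `D₂ = deg(p⁻¹ Υₓ^{∘2})^{1/2}`. -/
def dTwo (U : Matrix (Fin n) (Fin p) ℝ) (i : Fin n) : ℝ :=
  √((∑ j, U i j ^ 2) / p)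

/-- Diagonal entries of `D_lin(h) = 𝔼[h'(ξ D₂)]`, `ξ ∼ 𝒩(0,1)`. -/
def dLin (h : ℝ[X]) (U : Matrix (Fin n) (Fin p) ℝ) (i : Fin n) : ℝ :=
  ∫ x, (Polynomial.derivative h).eval (x * dTwo U i) ∂(gaussianReal 0 1)

/-- Diagonal entries of `D_chaos(h) = ∑_{ℓ ≥ 2} (1/ℓ!) 𝔼[h^{(ℓ)}(ξ D₂)]`, `ξ ∼ 𝒩(0,1)`.
The terms with `ℓ > deg h` vanish. -/
def dChaos (h : ℝ[X]) (U : Matrix (Fin n) (Fin p) ℝ) (i : Fin n) : ℝ :=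
  ∑ l ∈ Finset.Icc 2 h.natDegree, (1 / (l.factorial : ℝ)) *
    ∫ x, ((Polynomial.derivative^[l]) h).eval (x * dTwo U i) ∂(gaussianReal 0 1)

/-- The linearization `L`, with blocks (`𝒳 = Υₓ ∘ X`, `𝒲 = W`)
```
[      0           D_chaos Zᵀ/√n   -D_lin 𝒳/√n      0    ]
[  Z D_chaos/√n        -I               0         -W/√p  ]
[ -𝒳ᵀ D_lin/√n          0               0          -I    ]
[      0             -Wᵀ/√p            -I           0    ]
```
-/
def linMat (h : ℝ[X]) (U : Matrix (Fin n) (Fin p) ℝ) (W : Matrix (Fin m) (Fin p) ℝ)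
    (X : Matrix (Fin n) (Fin p) ℝ) (Z : Matrix (Fin m) (Fin n) ℝ) :
    Matrix (BIdx n m p) (BIdx n m p) ℝ
  | .inl i, .inr (.inl j) => dChaos h U i * Z j i / √(n : ℝ)
  | .inl i, .inr (.inr (.inl j)) => -(dLin h U i * (U i j * X i j)) / √(n : ℝ)
  | .inr (.inl i), .inl j => Z i j * dChaos h U j / √(n : ℝ)
  | .inr (.inl i), .inr (.inl j) => -(1 : Matrix (Fin m) (Fin m) ℝ) i j
  | .inr (.inl i), .inr (.inr (.inr j)) => -W i j / √(p : ℝ)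
  | .inr (.inr (.inl i)), .inl j => -((U j i * X j i) * dLin h U j) / √(n : ℝ)
  | .inr (.inr (.inl i)), .inr (.inr (.inr j)) => -(1 : Matrix (Fin p) (Fin p) ℝ) i j
  | .inr (.inr (.inr i)), .inr (.inl j) => -W j i / √(p : ℝ)
  | .inr (.inr (.inr i)), .inr (.inr (.inl j)) => -(1 : Matrix (Fin p) (Fin p) ℝ) i j
  | _, _ => 0

/-- The deterministic part `C_N = -I_m ⊗ E₂₂ - I_p ⊗ (E₃₄ + E₄₃)` of `L`. -/
def cMat (n m p : ℕ) : Matrix (BIdx n m p) (BIdx n m p) ℂ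
  | .inr (.inl i), .inr (.inl j) => -(1 : Matrix (Fin m) (Fin m) ℂ) i j
  | .inr (.inr (.inl i)), .inr (.inr (.inr j)) => -(1 : Matrix (Fin p) (Fin p) ℂ) i j
  | .inr (.inr (.inr i)), .inr (.inr (.inl j)) => -(1 : Matrix (Fin p) (Fin p) ℂ) i j
  | _, _ => 0

/-- `N = n + m + 2p` as a real number. -/
def bigN (n m p : ℕ) : ℝ := (n : ℝ) + m + 2 * p

/-- The profile `Υ_L = (γᵢⱼ^{(L)})` of `L`, with `c_n = √(N/n)` and `c_p = √(N/p)`: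
```
[       0           c_n D_chaos 1   c_n D_lin Υₓ     0    ]
[  c_n 1 D_chaos          0              0          c_p 1 ]
[  c_n Υₓᵀ D_lin          0              0           0    ]
[       0               c_p 1            0           0    ]
```
-/
def profileL (m : ℕ) (h : ℝ[X]) (U : Matrix (Fin n) (Fin p) ℝ) :
    Matrix (BIdx n m p) (BIdx n m p) ℝ
  | .inl i, .inr (.inl _) => √(bigN n m p / n) * dChaos h U i
  | .inl i, .inr (.inr (.inl j)) => √(bigN n m p / n) * (dLin h U i * U i j)
  | .inr (.inl _), .inl j => √(bigN n m p / n) * dChaos h U j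
  | .inr (.inl _), .inr (.inr (.inr _)) => √(bigN n m p / p)
  | .inr (.inr (.inl i)), .inl j => √(bigN n m p / n) * (U j i * dLin h U j)
  | .inr (.inr (.inr _)), .inr (.inl _) => √(bigN n m p / p)
  | _, _ => 0

/-- `γ_max^{(L)} ≥ 0`, whose square is `max_{i,j} (γᵢⱼ^{(L)})²`. -/
def gammaMax (m : ℕ) (h : ℝ[X]) (U : Matrix (Fin n) (Fin p) ℝ) : ℝ :=
  √(⨆ e : BIdx n m p × BIdx n m p, profileL m h U e.1 e.2 ^ 2)

/-- `η_N = (γ_max² (2√2 γ_max³ + κ) / ((1 - δ) n))^{1/5}`. -/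
def etaN (m : ℕ) (h : ℝ[X]) (U : Matrix (Fin n) (Fin p) ℝ) (δ κ : ℝ) : ℝ :=
  (gammaMax m h U ^ 2 / ((1 - δ) * n) * (2 * √2 * gammaMax m h U ^ 3 + κ)) ^ (1 / 5 : ℝ)

/-- The map `id₄ ⊗ Δ`: it keeps the diagonals of the blocks `11, 22, 33, 44, 34, 43` and
replaces every other entry by `0`. -/
def idDelta (M : Matrix (BIdx n m p) (BIdx n m p) ℂ) : Matrix (BIdx n m p) (BIdx n m p) ℂ
  | .inr (.inr (.inl i)), .inr (.inr (.inr j)) =>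
      if i = j then M (.inr (.inr (.inl i))) (.inr (.inr (.inr j))) else 0
  | .inr (.inr (.inr i)), .inr (.inr (.inl j)) =>
      if i = j then M (.inr (.inr (.inr i))) (.inr (.inr (.inl j))) else 0
  | a, b => if a = b then M a b else 0

/-- The operator-valued resolvent `𝔔(Λ) = (L - Λ)⁻¹`; a diagonal matrix `Λ` is given by its
diagonal. -/
def resolvent (L : Matrix (BIdx n m p) (BIdx n m p) ℝ) (Λ : BIdx n m p → ℂ) :
    Matrix (BIdx n m p) (BIdx n m p) ℂ :=
  (L.map (fun x : ℝ => (x : ℂ)) - Matrix.diagonal Λ)⁻¹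

/-- The diagonal of `Λ_λ + iη I_N`, where `Λ_λ = -λ I_n ⊗ E₁₁`. -/
def specPoint (n m p : ℕ) (lam η : ℝ) : BIdx n m p → ℂ
  | .inl _ => -(lam : ℂ) + (η : ℂ) * Complex.I
  | .inr _ => (η : ℂ) * Complex.I

/-- `R_N(M) = diagᵢ(∑ⱼ (γᵢⱼ^{(L)})²/N · M(j,j))`. -/
def covMap (h : ℝ[X]) (U : Matrix (Fin n) (Fin p) ℝ)
    (M : Matrix (BIdx n m p) (BIdx n m p) ℂ) : Matrix (BIdx n m p) (BIdx n m p) ℂ :=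
  Matrix.diagonal fun i => ∑ j, ((profileL m h U i j ^ 2 / bigN n m p : ℝ) : ℂ) * M j j

/-- `Im M = (M - M*) / (2i)`. -/
def imMat {I : Type*} (M : Matrix I I ℂ) : Matrix I I ℂ :=
  (1 / (2 * Complex.I)) • (M - Mᴴ)

/-- Diagonals of the matrices in `D_N(ℂ)⁺`, that is of the diagonal matrices with positive
definite imaginary part. -/
def DPlus (I : Type*) : Set (I → ℂ) := {Λ | ∀ i, 0 < (Λ i).im}

/-- `G` solves the fixed point equation
`G(Λ) = id₄ ⊗ Δ[(C_N - Λ - R_N(G(Λ)))⁻¹]` on `D_N(ℂ)⁺`, has positive definite imaginary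
part there, and is analytic in each variable. Values of `G` outside `D_N(ℂ)⁺` play no role. -/
structure IsSquareEquivalent (h : ℝ[X]) (U : Matrix (Fin n) (Fin p) ℝ)
    (G : (BIdx n m p → ℂ) → Matrix (BIdx n m p) (BIdx n m p) ℂ) : Prop where
  fixed_point : ∀ Λ ∈ DPlus (BIdx n m p),
    G Λ = idDelta ((cMat n m p - Matrix.diagonal Λ - covMap h U (G Λ))⁻¹)
  im_posDef : ∀ Λ ∈ DPlus (BIdx n m p), (imMat (G Λ)).PosDef
  analytic : ∀ Λ ∈ DPlus (BIdx n m p), ∀ k i j,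
    AnalyticAt ℂ (fun z : ℂ => G (Function.update Λ k z) i j) (Λ k)

/-- Operator (spectral) norm, for the Euclidean norm on `ℂ^I`. -/
def opNorm {I : Type*} [Fintype I] [DecidableEq I] (A : Matrix I I ℂ) : ℝ :=
  ‖Matrix.toEuclideanCLM (n := I) (𝕜 := ℂ) A‖

/-- Normalized Frobenius norm `‖A‖_{F,n} = (n⁻¹ Tr[A A*])^{1/2}`. -/
def frobNorm {I : Type*} [Fintype I] (n : ℕ) (A : Matrix I I ℂ) : ℝ :=
  √((A * Aᴴ).trace.re / n)

/-- `Υ = Aᵀ B` where the columns of `A` and `B` have Euclidean norm at most `√γ`. -/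
def HasBoundedFactorization (γ : ℝ) (U : Matrix (Fin n) (Fin p) ℝ) : Prop :=
  ∃ (r : ℕ) (A : Matrix (Fin r) (Fin n) ℝ) (B : Matrix (Fin r) (Fin p) ℝ),
    U = Aᵀ * B ∧ (∀ i, √(∑ k, A k i ^ 2) ≤ √γ) ∧ (∀ j, √(∑ k, B k j ^ 2) ≤ √γ)

end Deterministic

section Random

variable {Ω : Type*} {n m p : ℕ}

/-- All the entries of three random matrices, as a single family of random variables. -/
def entries (W : Ω → Matrix (Fin m) (Fin p) ℝ) (X : Ω → Matrix (Fin n) (Fin p) ℝ)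
    (Z : Ω → Matrix (Fin m) (Fin n) ℝ) :
    (Fin m × Fin p) ⊕ (Fin n × Fin p) ⊕ (Fin m × Fin n) → Ω → ℝ
  | .inl e => fun ω => W ω e.1 e.2
  | .inr (.inl e) => fun ω => X ω e.1 e.2
  | .inr (.inr e) => fun ω => Z ω e.1 e.2

/-- `W`, `X`, `Z` are independent matrices with iid standard real Gaussian entries. -/
structure AreIndepGaussian [MeasurableSpace Ω] (P : Measure Ω)
    (W : Ω → Matrix (Fin m) (Fin p) ℝ) (X : Ω → Matrix (Fin n) (Fin p) ℝ)
    (Z : Ω → Matrix (Fin m) (Fin n) ℝ) : Prop where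
  law : ∀ e, HasLaw (entries W X Z e) (gaussianReal 0 1) P
  indep : iIndepFun (entries W X Z) P

end Random

end RFSquare

end

/-! Write `L = C_N + H`, where `H` is a symmetric Gaussian matrix whose entries have variances
exactly `(γ_ij^{(L)})²/N`, and let `Q(η)` be its resolvent at `Λ_λ + iη`. The matrix `C_N - Λ -
R_N(M)` lies in the algebra of matrices fixed by `id₄ ⊗ Δ`, and so does its inverse. The fixed point
equation is therefore the Dyson equation `G = (C_N - Λ - R_N(G))⁻¹`, closed in the diagonal of `G`.

Existence, uniqueness and stability all come from one weighted Cauchy–Schwarz inequality,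
`weighted_cauchy_schwarz`. For a solution, `Im G_ii` is a weighted sum of the squares of row or
column `i`, with weights `Im Λ + R_N(Im G)`. Differences measured in units of `√(Im u · Im v)` are
thus contracted by the iteration. A matrix solving the equation up to a perturbation `D` differs
from `G` by at most `(2‖D‖/η) √(Im M_ii · Im G_jj)` in each entry (`dyson_stability`).

On the probabilistic side, Gaussian integration by parts shows that `𝔼 Q` solves the Dyson equation
with entrywise error `O(N⁻¹ η⁻³)` (`norm_meanRes_dyson_le`). The Maurey–Pisier inequality shows that
each entry of `Q` fluctuates on the scale `N^{-1/2} η⁻²` (`measure_entry_sub_mean_ge_le`).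

The last ingredient is a bound up to the real axis. When `‖H‖ ≤ τ`, an indefinite choice of block
signs makes the real part of the quadratic form of `L - Λ_λ` definite on the first two blocks, and
the other two are then recovered from the equations. So `‖Q(η)‖ ≤ 2K` and `‖Q(η) - Q(0)‖ ≤ 2K²η`
with `K` independent of `N` (`gaussRes_specPoint_bounds`). In particular `Im 𝔼 Q_ii` is of order one
rather than `η⁻¹`.

The choice of `η_N` makes `n η⁵` of order one, hence `N⁻¹ η⁻³` of order `η²`. Stability then leaves
an error `η²/η · √(1/η) = √η → 0`; the trivial bound `Im 𝔼 Q_ii ≤ η⁻¹` would only leave `O(1)`.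
Deviations of size `η^{1/4}` have probability at most `exp(-const · η^{-1/2})` per entry, which is
summable after a union bound, and Borel–Cantelli needs no joint law in `n`. -/

noncomputable section

namespace RFSquare

/-! ### The standard Gaussian measure: rotation invariance and Laplace transform. -/

section GaussianMeasure

variable {E : Type*} [Fintype E]

/-- The standard Gaussian measure on `E → ℝ`. -/
def stdG (E : Type*) [Fintype E] : Measure (E → ℝ) := Measure.pi fun _ => gaussianReal 0 1

instance : IsProbabilityMeasure (stdG E) := by unfold stdG; infer_instance

instance : IsGaussian (stdG E) := by
  have h : stdG E = (stdGaussian (EuclideanSpace ℝ E)).map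
      (EuclideanSpace.equiv E ℝ) := by
    rw [← map_pi_eq_stdGaussian, Measure.map_map (by fun_prop) (by fun_prop)]
    exact Measure.map_id.symm
  rw [h]
  exact isGaussian_map_equiv _

/-- This invariance gives every point of the interpolation path between two independent copies the
law of its starting point. -/
lemma stdG_rotation (θ : ℝ) :
    ((stdG E).prod (stdG E)).map (ContinuousLinearMap.rotation θ) = (stdG E).prod (stdG E) := by
  apply IsGaussian.map_rotation_eq_self
  have hi : Integrable (id : (E → ℝ) → E → ℝ) (stdG E) := IsGaussian.integrable_id
  ext e
  rw [eval_integral (fun e => hi.eval e)]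
  have h : ∫ x : E → ℝ, x e ∂(stdG E) = ∫ t, t ∂(gaussianReal 0 1) :=
    integral_comp_eval (μ := fun _ : E => gaussianReal 0 1) (i := e) (f := fun t : ℝ => t)
      (by fun_prop)
  simpa using h

lemma lintegral_exp_linear_stdG (c : E → ℝ) :
    ∫⁻ y, ENNReal.ofReal (Real.exp (∑ e, c e * y e)) ∂(stdG E)
      = ENNReal.ofReal (Real.exp ((∑ e, c e ^ 2) / 2)) := by
  have hi : ∀ e, Integrable (fun t : ℝ => Real.exp (c e * t)) (gaussianReal 0 1) :=
    fun e => integrable_exp_mul_gaussianReal _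
  have hI : Integrable (fun y : E → ℝ => ∏ e, Real.exp (c e * y e)) (stdG E) :=
    Integrable.fintype_prod (f := fun e t => Real.exp (c e * t)) hi
  have hm : ∀ e, ∫ t, Real.exp (c e * t) ∂(gaussianReal 0 1) = Real.exp (c e ^ 2 / 2) := by
    intro e
    have := mgf_gaussianReal (p := gaussianReal 0 1) (X := id) (μ := 0) (v := 1) (by simp) (c e)
    simpa [mgf] using this
  simp_rw [Real.exp_sum]
  rw [← ofReal_integral_eq_lintegral_ofReal hI
    (ae_of_all _ fun y => Finset.prod_nonneg fun e _ => (Real.exp_pos _).le)]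
  congr 1
  have := integral_fintype_prod_eq_prod (μ := fun _ : E => gaussianReal 0 1)
    (fun e (t : ℝ) => Real.exp (c e * t))
  rw [stdG, this]
  simp_rw [hm]
  rw [← Real.exp_sum, Finset.sum_div]

end GaussianMeasure

/-! ### Gaussian concentration by the Maurey–Pisier interpolation. -/

section Concentration

variable {E : Type*} [Fintype E]

/-- The velocity is `π/2` times the second component of the same rotation of `(x, y)`. For
independent Gaussians, position and velocity are therefore independent at each time. -/
lemma hasDerivAt_rotation_path (x y : E → ℝ) (t : ℝ) :
    HasDerivAt (fun t : ℝ => Real.cos (t * (Real.pi / 2)) • x + Real.sin (t * (Real.pi / 2)) • y)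
      ((Real.pi / 2) • (-Real.sin (t * (Real.pi / 2)) • x + Real.cos (t * (Real.pi / 2)) • y)) t := by
  have h1 : HasDerivAt (fun t : ℝ => t * (Real.pi / 2)) (Real.pi / 2) t := by
    simpa using (hasDerivAt_id t).mul_const (Real.pi / 2)
  have h2 := (h1.cos.smul_const x).add (h1.sin.smul_const y)
  refine h2.congr_deriv ?_
  rw [smul_add, smul_smul, smul_smul, mul_comm (Real.pi / 2), mul_comm (Real.pi / 2)]

lemma hasDerivAt_comp_path (f : (E → ℝ) → ℝ) (D : (E → ℝ) → E → ℝ)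
    (hf : ∀ x, HasFDerivAt f (∑ e, D x e • ContinuousLinearMap.proj (R := ℝ) (φ := fun _ : E => ℝ) e) x)
    (c : ℝ → E → ℝ) (c' : E → ℝ) (t : ℝ) (hc : HasDerivAt c c' t) :
    HasDerivAt (fun t => f (c t)) (∑ e, D (c t) e * c' e) t := by
  have h := HasFDerivAt.comp_hasDerivAt (f := c) (l := f) t (hf (c t)) hc
  refine h.congr_deriv ?_
  rw [sum_apply]
  rfl

/-- The interpolation inequality behind the Maurey–Pisier concentration bound. -/
lemma lintegral_exp_sub_le (f : (E → ℝ) → ℝ) (D : (E → ℝ) → E → ℝ)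
    (hf : ∀ x, HasFDerivAt f (∑ e, D x e • ContinuousLinearMap.proj (R := ℝ) (φ := fun _ : E => ℝ) e) x)
    (hD : Continuous D) {G : ℝ} (hG : ∀ x, ∑ e, D x e ^ 2 ≤ G) (lam : ℝ) :
    ∫⁻ z, ENNReal.ofReal (Real.exp (lam * (f z.2 - f z.1))) ∂((stdG E).prod (stdG E))
      ≤ ENNReal.ofReal (Real.exp (lam ^ 2 * (Real.pi ^ 2 / 4) * G / 2)) := by
  -- `k` evaluated at the rotated pair is the derivative of `lam * f` along the path. Jensen in `t`
  -- moves the exponential inside the time integral, and rotation invariance reduces every `t` to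
  -- the law of `k` itself. There `z.2` is independent of `z.1`, so the inner integral is a Gaussian
  -- Laplace transform.
  set k : (E → ℝ) × (E → ℝ) → ℝ := fun z => ∑ e, (lam * (Real.pi / 2) * D z.1 e) * z.2 e with hk
  have hkc : Continuous k := by
    simp only [hk]
    refine continuous_finsetSum _ fun e _ => ?_
    have : Continuous fun z : (E → ℝ) × (E → ℝ) => D z.1 e :=
      (continuous_apply e).comp (hD.comp continuous_fst)
    fun_prop
  let R : ℝ → (E → ℝ) × (E → ℝ) →L[ℝ] (E → ℝ) × (E → ℝ) :=
    fun t => ContinuousLinearMap.rotation (t * (Real.pi / 2))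
  have hRc : Continuous fun q : ((E → ℝ) × (E → ℝ)) × ℝ => R q.2 q.1 := by
    simp only [R, ContinuousLinearMap.rotation_apply]
    fun_prop
  -- pointwise bound
  have hpt : ∀ z : (E → ℝ) × (E → ℝ), ENNReal.ofReal (Real.exp (lam * (f z.2 - f z.1)))
      ≤ ∫⁻ t in Set.Ioc (0 : ℝ) 1, ENNReal.ofReal (Real.exp (k (R t z))) := by
    intro z
    have hRz : Continuous fun t : ℝ => R t z := by
      simp only [R, ContinuousLinearMap.rotation_apply]
      fun_prop
    have hkz : Continuous fun t : ℝ => k (R t z) := hkc.comp hRz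
    have hderiv : ∀ t : ℝ, HasDerivAt (fun t => lam * f (R t z).1) (k (R t z)) t := by
      intro t
      have h4 := (hasDerivAt_comp_path f D hf _ _ t
        (hasDerivAt_rotation_path z.1 z.2 t)).const_mul lam
      refine h4.congr_deriv ?_
      simp only [hk, R, ContinuousLinearMap.rotation_apply, Pi.smul_apply, Pi.add_apply,
        smul_eq_mul, Finset.mul_sum]
      exact Finset.sum_congr rfl fun e _ => by ring
    have hint := intervalIntegral.integral_eq_sub_of_hasDerivAt (a := 0) (b := 1)
      (fun t _ => hderiv t) (hkz.intervalIntegrable _ _)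
    have h0 : (R 0 z).1 = z.1 := by simp [R, ContinuousLinearMap.rotation_apply]
    have h1 : (R 1 z).1 = z.2 := by simp [R, ContinuousLinearMap.rotation_apply]
    rw [h0, h1, ← mul_sub, intervalIntegral.integral_of_le zero_le_one] at hint
    rw [← hint]
    have : IsProbabilityMeasure (volume.restrict (Set.Ioc (0 : ℝ) 1)) := ⟨by simp⟩
    have hexp : Integrable (fun t => Real.exp (k (R t z))) (volume.restrict (Set.Ioc (0 : ℝ) 1)) :=
      ((Real.continuous_exp.comp hkz).integrableOn_Icc (a := 0) (b := 1)).mono_set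
        Set.Ioc_subset_Icc_self
    rw [← ofReal_integral_eq_lintegral_ofReal hexp (ae_of_all _ fun _ => (Real.exp_pos _).le)]
    apply ENNReal.ofReal_le_ofReal
    exact convexOn_exp.map_integral_le Real.continuous_exp.continuousOn isClosed_univ
      (by simp) ((hkz.integrableOn_Icc (a := 0) (b := 1)).mono_set Set.Ioc_subset_Icc_self) hexp
  have hmeas : Measurable fun z => ENNReal.ofReal (Real.exp (k z)) := by
    have := hkc.measurable; fun_prop
  have hbound : ∫⁻ z, ENNReal.ofReal (Real.exp (k z)) ∂((stdG E).prod (stdG E))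
      ≤ ENNReal.ofReal (Real.exp (lam ^ 2 * (Real.pi ^ 2 / 4) * G / 2)) := by
    rw [lintegral_prod _ hmeas.aemeasurable]
    simp only [hk]
    simp_rw [lintegral_exp_linear_stdG]
    calc _ ≤ ∫⁻ _ : E → ℝ, ENNReal.ofReal (Real.exp (lam ^ 2 * (Real.pi ^ 2 / 4) * G / 2))
          ∂(stdG E) := by
          refine lintegral_mono fun x => ENNReal.ofReal_le_ofReal (Real.exp_le_exp.2 ?_)
          have : ∑ e, (lam * (Real.pi / 2) * D x e) ^ 2
              = lam ^ 2 * (Real.pi ^ 2 / 4) * ∑ e, D x e ^ 2 := by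
            rw [Finset.mul_sum]; exact Finset.sum_congr rfl fun e _ => by ring
          rw [this]
          have := hG x
          gcongr
      _ = _ := by simp
  calc _ ≤ ∫⁻ z, ∫⁻ t in Set.Ioc (0 : ℝ) 1, ENNReal.ofReal (Real.exp (k (R t z)))
        ∂volume ∂((stdG E).prod (stdG E)) := lintegral_mono hpt
    _ = ∫⁻ t in Set.Ioc (0 : ℝ) 1, ∫⁻ z, ENNReal.ofReal (Real.exp (k (R t z)))
        ∂((stdG E).prod (stdG E)) ∂volume := by
        apply lintegral_lintegral_swap
        exact (hmeas.comp hRc.measurable).aemeasurable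
    _ = ∫⁻ t in Set.Ioc (0 : ℝ) 1, ∫⁻ z, ENNReal.ofReal (Real.exp (k z))
        ∂((stdG E).prod (stdG E)) ∂volume := by
        refine lintegral_congr fun t => ?_
        conv_rhs => rw [← stdG_rotation (t * (Real.pi / 2))]
        rw [lintegral_map hmeas (by fun_prop)]
    _ ≤ ∫⁻ t in Set.Ioc (0 : ℝ) 1, ENNReal.ofReal (Real.exp (lam ^ 2 * (Real.pi ^ 2 / 4) * G / 2)) :=
        lintegral_mono fun _ => hbound
    _ = _ := by simp

/-- **Gaussian concentration**: a bounded `C¹` function whose gradient has squared length at most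
`G` is sub-Gaussian. -/
theorem hasSubgaussianMGF_of_gradient_le (f : (E → ℝ) → ℝ) (D : (E → ℝ) → E → ℝ)
    (hf : ∀ x, HasFDerivAt f (∑ e, D x e • ContinuousLinearMap.proj (R := ℝ) (φ := fun _ : E => ℝ) e) x)
    (hD : Continuous D) {G : NNReal} (hG : ∀ x, ∑ e, D x e ^ 2 ≤ G) {B : ℝ} (hB : ∀ x, |f x| ≤ B) :
    HasSubgaussianMGF (fun x => f x - ∫ x', f x' ∂(stdG E)) ((Real.pi ^ 2 / 4).toNNReal * G)
      (stdG E) := by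
  have hfc : Continuous f := continuous_iff_continuousAt.2 fun x => (hf x).continuousAt
  have hfi : Integrable f (stdG E) :=
    .of_bound hfc.aestronglyMeasurable B (ae_of_all _ fun x => by simpa using hB x)
  have hbd : ∀ (lam : ℝ) (x : E → ℝ) (r : ℝ), |r| ≤ B →
      ‖Real.exp (lam * (f x - r))‖ ≤ Real.exp (|lam| * (B + B)) := by
    intro lam x r hr
    rw [Real.norm_of_nonneg (Real.exp_pos _).le]
    apply Real.exp_le_exp.2
    calc lam * (f x - r) ≤ |lam * (f x - r)| := le_abs_self _
      _ = |lam| * |f x - r| := abs_mul _ _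
      _ ≤ |lam| * (B + B) := by
          gcongr
          exact (abs_sub _ _).trans (add_le_add (hB x) hr)
  have hmean : |∫ x', f x' ∂(stdG E)| ≤ B := by
    have := norm_integral_le_of_norm_le_const (μ := stdG E) (ae_of_all _ fun x => (Real.norm_eq_abs (f x)).le.trans (hB x))
    simpa using this
  refine ⟨fun lam => .of_bound (by fun_prop) _ (ae_of_all _ fun x => hbd lam x _ hmean),
    fun lam => ?_⟩
  have hint : Integrable (fun x => Real.exp (lam * (f x - ∫ x', f x' ∂(stdG E)))) (stdG E) :=
    .of_bound (by fun_prop) _ (ae_of_all _ fun x => hbd lam x _ hmean)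
  -- Jensen replaces the mean by an independent copy, which puts the exponential in the form treated
  -- by `lintegral_exp_sub_le`.
  have hjensen : ∀ y, ENNReal.ofReal (Real.exp (lam * (f y - ∫ x', f x' ∂(stdG E))))
      ≤ ∫⁻ x, ENNReal.ofReal (Real.exp (lam * (f y - f x))) ∂(stdG E) := by
    intro y
    have hi : Integrable (fun x => Real.exp (lam * (f y - f x))) (stdG E) :=
      .of_bound (by fun_prop) _ (ae_of_all _ fun x => hbd lam y _ (hB x))
    rw [← ofReal_integral_eq_lintegral_ofReal hi (ae_of_all _ fun _ => (Real.exp_pos _).le)]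
    apply ENNReal.ofReal_le_ofReal
    have h1 : lam * (f y - ∫ x', f x' ∂(stdG E)) = ∫ x, lam * (f y - f x) ∂(stdG E) := by
      rw [integral_const_mul, integral_sub (by fun_prop) hfi]
      simp
    rw [h1]
    exact convexOn_exp.map_integral_le Real.continuous_exp.continuousOn isClosed_univ
      (by simp) (((integrable_const _).sub hfi).const_mul lam) hi
  have hmeas : Measurable fun z : (E → ℝ) × (E → ℝ) =>
      ENNReal.ofReal (Real.exp (lam * (f z.2 - f z.1))) := by
    have := hfc.measurable
    fun_prop
  have hfin : ∫⁻ y, ENNReal.ofReal (Real.exp (lam * (f y - ∫ x', f x' ∂(stdG E)))) ∂(stdG E)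
      ≤ ENNReal.ofReal (Real.exp (lam ^ 2 * (Real.pi ^ 2 / 4) * G / 2)) := by
    calc _ ≤ ∫⁻ y, ∫⁻ x, ENNReal.ofReal (Real.exp (lam * (f y - f x))) ∂(stdG E) ∂(stdG E) :=
          lintegral_mono hjensen
      _ = ∫⁻ z, ENNReal.ofReal (Real.exp (lam * (f z.2 - f z.1))) ∂((stdG E).prod (stdG E)) :=
          (lintegral_prod_symm _ hmeas.aemeasurable).symm
      _ ≤ _ := lintegral_exp_sub_le f D hf hD hG lam
  rw [← ofReal_integral_eq_lintegral_ofReal hint (ae_of_all _ fun _ => (Real.exp_pos _).le)] at hfin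
  have := (ENNReal.ofReal_le_ofReal_iff (Real.exp_pos _).le).1 hfin
  refine this.trans (Real.exp_le_exp.2 (le_of_eq ?_))
  push_cast
  rw [Real.coe_toNNReal _ (by positivity)]
  ring

/-- From `t²Y² ≤ 2(e^{tY} + e^{-tY})` one gets `t² 𝔼Y² ≤ 4 e^{ct²/2}`. Taking `t² = 1/c` and
`e^{1/2} ≤ 2` gives the constant 8. For `c = 0` the bound reads `t² 𝔼Y² ≤ 4` for every `t`, which
`t² = 5/𝔼Y²` contradicts unless the second moment vanishes. -/
lemma integral_sq_le_of_hasSubgaussianMGF {Ω : Type*} [MeasurableSpace Ω] {μ : Measure Ω}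
    [IsProbabilityMeasure μ] {Y : Ω → ℝ} {c : NNReal} (h : HasSubgaussianMGF Y c μ) :
    ∫ x, Y x ^ 2 ∂μ ≤ 8 * c := by
  have hY2 : Integrable (fun x => Y x ^ 2) μ := (h.memLp 2).integrable_sq
  have key : ∀ t : ℝ, t ^ 2 * ∫ x, Y x ^ 2 ∂μ ≤ 4 * Real.exp (c * t ^ 2 / 2) := by
    intro t
    have h1 := h.mgf_le t
    have h2 := h.mgf_le (-t)
    rw [neg_sq] at h2
    have hi1 := h.integrable_exp_mul t
    have hi2 := h.integrable_exp_mul (-t)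
    have : ∫ x, t ^ 2 * Y x ^ 2 ∂μ
        ≤ ∫ x, 2 * (Real.exp (t * Y x) + Real.exp (-t * Y x)) ∂μ := by
      refine integral_mono (hY2.const_mul _) ((hi1.add hi2).const_mul 2) fun x => ?_
      have h3 := Real.quadratic_le_exp_of_nonneg (abs_nonneg (t * Y x))
      have h4 : Real.exp |t * Y x| ≤ Real.exp (t * Y x) + Real.exp (-t * Y x) := by
        rcases abs_choice (t * Y x) with h5 | h5 <;> rw [h5]
        · linarith [Real.exp_pos (-t * Y x)]
        · rw [neg_mul]; linarith [Real.exp_pos (t * Y x)]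
      have h5 : |t * Y x| ^ 2 = t ^ 2 * Y x ^ 2 := by rw [sq_abs]; ring
      simp only
      linarith [abs_nonneg (t * Y x)]
    rw [integral_const_mul, integral_const_mul, integral_add hi1 hi2] at this
    simp only [mgf] at h1 h2
    linarith
  set V := ∫ x, Y x ^ 2 ∂μ
  rcases eq_or_lt_of_le c.2 with hc | hc
  · have hc' : (c : ℝ) = 0 := hc.symm
    rw [hc', mul_zero]
    by_contra! hV
    have h1 := key (√(5 / V))
    rw [Real.sq_sqrt (by positivity), hc', div_mul_cancel₀ _ hV.ne'] at h1
    norm_num at h1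
  · have hc' : (0 : ℝ) < c := hc
    have h1 := key (√(1 / c))
    rw [Real.sq_sqrt (by positivity), mul_one_div_cancel hc'.ne'] at h1
    have h2 : Real.exp (1 / 2) ≤ 2 := by
      have := Real.exp_one_lt_d9
      have h3 : Real.exp (1 / 2) ^ 2 = Real.exp 1 := by rw [← Real.exp_nat_mul]; norm_num
      nlinarith [Real.exp_pos (1 / 2)]
    have h3 : 1 / (c : ℝ) * V ≤ 8 := by linarith
    rw [one_div, inv_mul_le_iff₀ hc'] at h3
    linarith

end Concentration

/-! ### Gaussian integration by parts. -/

section Stein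

variable {E : Type*} [Fintype E] [DecidableEq E]

/-- Resampling one coordinate preserves the product law; conditioning on the others reduces `stein`
to one dimension. -/
lemma map_update_stdG (e : E) :
    ((stdG E).prod (gaussianReal 0 1)).map (fun z => Function.update z.1 e z.2) = stdG E := by
  refine (Measure.pi_eq fun s hs => ?_).symm
  have hmeas : Measurable fun z : (E → ℝ) × ℝ => Function.update z.1 e z.2 := by
    refine measurable_pi_lambda _ fun j => ?_
    by_cases h : j = e
    · subst h; simpa using measurable_snd
    · simp only [Function.update_of_ne h]; exact (measurable_pi_apply j).comp measurable_fst
  rw [Measure.map_apply hmeas (MeasurableSet.univ_pi hs)]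
  have hpre : (fun z : (E → ℝ) × ℝ => Function.update z.1 e z.2) ⁻¹' Set.univ.pi s
      = (Set.univ.pi (Function.update s e Set.univ)) ×ˢ s e := by
    ext z
    simp only [Set.mem_preimage, Set.mem_pi, Set.mem_univ, true_imp_iff, Set.mem_prod]
    constructor
    · intro h
      refine ⟨fun j => ?_, by simpa using h e⟩
      by_cases hj : j = e
      · subst hj; simp
      · simpa [hj] using h j
    · rintro ⟨h1, h2⟩ j
      by_cases hj : j = e
      · subst hj; simpa using h2
      · simpa [hj] using h1 j
  rw [hpre, Measure.prod_prod, stdG, Measure.pi_pi, ← Finset.prod_erase_mul _ _ (Finset.mem_univ e),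
    ← Finset.prod_erase_mul (f := fun j => gaussianReal 0 1 (s j)) _ (Finset.mem_univ e)]
  simp only [Function.update_self, measure_univ, mul_one]
  congr 1
  refine Finset.prod_congr rfl fun j hj => ?_
  rw [Function.update_of_ne (Finset.ne_of_mem_erase hj)]

/-- One-dimensional Gaussian integration by parts. -/
lemma stein_one (u u' : ℝ → ℂ) (hu : ∀ t, HasDerivAt u (u' t) t) (hu'c : Continuous u')
    {B : ℝ} (hB : ∀ t, ‖u t‖ ≤ B) (hB' : ∀ t, ‖u' t‖ ≤ B) :
    ∫ t, (t : ℂ) * u t ∂(gaussianReal 0 1) = ∫ t, u' t ∂(gaussianReal 0 1) := by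
  have huc : Continuous u := continuous_iff_continuousAt.2 fun x => (hu x).continuousAt
  set φ : ℝ → ℝ := gaussianPDFReal 0 1 with hφ
  have hφ1 : ∀ t, φ t = (√(2 * Real.pi))⁻¹ * Real.exp (-t ^ 2 / 2) := by
    intro t; simp [hφ, gaussianPDFReal]
  have hφc : Continuous φ := by
    have : φ = fun t => (√(2 * Real.pi))⁻¹ * Real.exp (-t ^ 2 / 2) := funext hφ1
    rw [this]; fun_prop
  have hφd : ∀ t, HasDerivAt φ (-t * φ t) t := by
    intro t
    have : φ = fun t => (√(2 * Real.pi))⁻¹ * Real.exp (-t ^ 2 / 2) := funext hφ1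
    rw [this]
    have h1 : HasDerivAt (fun t : ℝ => -t ^ 2 / 2) (-t) t := by
      refine (((hasDerivAt_pow 2 t).neg).div_const 2).congr_deriv ?_
      push_cast; ring
    refine ((h1.exp).const_mul (√(2 * Real.pi))⁻¹).congr_deriv ?_
    ring
  have hφi : Integrable φ := integrable_gaussianPDFReal 0 1
  have hφi' : Integrable (fun t => t * φ t) := by
    have h1 := (integrable_mul_exp_neg_mul_sq (b := 1 / 2) (by norm_num)).const_mul
      (√(2 * Real.pi))⁻¹
    convert h1 using 2 with t
    rw [hφ1]
    have : -t ^ 2 / 2 = -(1 / 2) * t ^ 2 := by ring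
    rw [this]; ring
  rw [integral_gaussianReal_eq_integral_smul one_ne_zero,
    integral_gaussianReal_eq_integral_smul one_ne_zero]
  have hv : ∀ t, HasDerivAt (fun t => ((φ t : ℝ) : ℂ)) ((-t * φ t : ℝ) : ℂ) t :=
    fun t => (hφd t).ofReal_comp
  have hA : Integrable (u * fun t => ((-t * φ t : ℝ) : ℂ)) := by
    refine Integrable.mono' (g := fun t => B * ‖t * φ t‖) (hφi'.norm.const_mul B)
      (by fun_prop) (ae_of_all _ fun t => ?_)
    simp only [Pi.mul_apply, norm_mul, Complex.norm_real, neg_mul, norm_neg]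
    gcongr
    exact hB t
  have hA' : Integrable (u' * fun t => ((φ t : ℝ) : ℂ)) := by
    refine Integrable.mono' (g := fun t => B * ‖φ t‖) (hφi.norm.const_mul B)
      (by fun_prop) (ae_of_all _ fun t => ?_)
    simp only [Pi.mul_apply, norm_mul, Complex.norm_real]
    gcongr
    exact hB' t
  have hA'' : Integrable (u * fun t => ((φ t : ℝ) : ℂ)) := by
    refine Integrable.mono' (g := fun t => B * ‖φ t‖) (hφi.norm.const_mul B)
      (by fun_prop) (ae_of_all _ fun t => ?_)
    simp only [Pi.mul_apply, norm_mul, Complex.norm_real]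
    gcongr
    exact hB t
  have := integral_mul_deriv_eq_deriv_mul_of_integrable (fun t _ => hu t) (fun t _ => hv t)
    hA hA' hA''
  have h1 : ∫ t, gaussianPDFReal 0 1 t • ((t : ℂ) * u t)
      = - ∫ t, u t * ((-t * φ t : ℝ) : ℂ) := by
    rw [← integral_neg]
    congr 1; ext t
    simp only [Complex.real_smul, Complex.ofReal_mul, Complex.ofReal_neg, hφ]
    ring
  rw [h1, this, neg_neg]
  congr 1; ext t
  simp only [Complex.real_smul, hφ]; ring

/-- **Gaussian integration by parts** for bounded functions with bounded partial derivative. -/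
theorem stein (e : E) (f f' : (E → ℝ) → ℂ) (hfc : Continuous f) (hf'c : Continuous f')
    (hf : ∀ x, HasDerivAt (fun t : ℝ => f (Function.update x e t)) (f' x) (x e))
    {B : ℝ} (hB : ∀ x, ‖f x‖ ≤ B) (hB' : ∀ x, ‖f' x‖ ≤ B) :
    ∫ x, (x e : ℂ) * f x ∂(stdG E) = ∫ x, f' x ∂(stdG E) := by
  have hupd : Continuous fun z : (E → ℝ) × ℝ => Function.update z.1 e z.2 :=
    continuous_fst.update e continuous_snd
  have hi : Integrable (fun x : E → ℝ => (x e : ℂ) * f x) (stdG E) := by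
    have h1 : Integrable (fun x : E → ℝ => x e) (stdG E) :=
      (IsGaussian.integrable_id (μ := stdG E)).eval e
    refine Integrable.mono' (g := fun x => ‖x e‖ * B) (h1.norm.mul_const B)
      (by fun_prop) (ae_of_all _ fun t => ?_)
    rw [norm_mul, Complex.norm_real]
    gcongr
    exact hB t
  have hi' : Integrable f' (stdG E) :=
    .of_bound hf'c.aestronglyMeasurable B (ae_of_all _ hB')
  have hmap := map_update_stdG e
  have key : ∀ F : (E → ℝ) → ℂ, Continuous F → Integrable F (stdG E) → ∫ x, F x ∂(stdG E)
      = ∫ x, ∫ t, F (Function.update x e t) ∂(gaussianReal 0 1) ∂(stdG E) := by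
    intro F hFc hF
    have hF2 : Integrable F (((stdG E).prod (gaussianReal 0 1)).map
      (fun z => Function.update z.1 e z.2)) := by rwa [hmap]
    conv_lhs => rw [← hmap]
    rw [integral_map (by fun_prop) hFc.aestronglyMeasurable]
    exact integral_prod _ (hF2.comp_measurable hupd.measurable)
  rw [key _ (by fun_prop) hi, key _ hf'c hi']
  congr 1; ext x
  have hc : Continuous fun t : ℝ => Function.update x e t := by fun_prop
  have := stein_one (fun t => f (Function.update x e t)) (fun t => f' (Function.update x e t))
    (fun t => by
      have := hf (Function.update x e t)
      simpa using this) (hf'c.comp hc) (fun t => hB _) (fun t => hB' _)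
  simpa using this

end Stein

/-! ### Operator norm estimates, and imaginary parts of inverses. -/

section LinearAlgebra

open scoped Matrix.Norms.L2Operator

variable {ι : Type*} [Fintype ι]

/-- The Euclidean norm of a complex vector. -/
def vnorm (x : ι → ℂ) : ℝ := √(∑ i, ‖x i‖ ^ 2)

lemma vnorm_nonneg (x : ι → ℂ) : 0 ≤ vnorm x := Real.sqrt_nonneg _

lemma vnorm_sq (x : ι → ℂ) : vnorm x ^ 2 = ∑ i, ‖x i‖ ^ 2 :=
  Real.sq_sqrt (Finset.sum_nonneg fun _ _ => by positivity)

lemma vnorm_eq (x : ι → ℂ) : vnorm x = ‖(WithLp.toLp 2 x : EuclideanSpace ℂ ι)‖ := by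
  rw [EuclideanSpace.norm_eq]; rfl

lemma vnorm_add_le (x y : ι → ℂ) : vnorm (x + y) ≤ vnorm x + vnorm y := by
  simp only [vnorm_eq, WithLp.toLp_add]; exact norm_add_le _ _

lemma vnorm_star (x : ι → ℂ) : vnorm (fun i => star (x i)) = vnorm x := by simp [vnorm]

lemma vnorm_eq_zero {x : ι → ℂ} : vnorm x = 0 ↔ x = 0 := by
  rw [vnorm_eq, norm_eq_zero, WithLp.toLp_eq_zero]

lemma norm_sum_mul_le (x y : ι → ℂ) : ‖∑ i, x i * y i‖ ≤ vnorm x * vnorm y := by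
  refine (norm_sum_le _ _).trans ?_
  simp only [norm_mul]
  exact Real.sum_mul_le_sqrt_mul_sqrt _ _ _

lemma norm_le_vnorm (x : ι → ℂ) (i : ι) : ‖x i‖ ≤ vnorm x := by
  apply Real.le_sqrt_of_sq_le
  exact Finset.single_le_sum (f := fun i => ‖x i‖ ^ 2) (fun _ _ => by positivity)
    (Finset.mem_univ i)

variable [DecidableEq ι]

lemma vnorm_mulVec_le (A : Matrix ι ι ℂ) (x : ι → ℂ) : vnorm (A *ᵥ x) ≤ ‖A‖ * vnorm x := by
  simp only [vnorm_eq]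
  exact A.l2_opNorm_mulVec (WithLp.toLp 2 x)

lemma opnorm_le_of_vnorm {A : Matrix ι ι ℂ} {c : ℝ} (hc : 0 ≤ c)
    (h : ∀ x, vnorm (A *ᵥ x) ≤ c * vnorm x) : ‖A‖ ≤ c := by
  refine ContinuousLinearMap.opNorm_le_bound
    (Matrix.toEuclideanCLM (n := ι) (𝕜 := ℂ) A) hc fun x => ?_
  have := h x.ofLp
  simp only [vnorm_eq] at this
  exact this

lemma vnorm_single (j : ι) : vnorm (Pi.single j (1 : ℂ)) = 1 := by
  rw [vnorm, Finset.sum_eq_single j]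
  · simp
  · intro b _ hb; simp [hb]
  · simp

lemma vnorm_col_le (A : Matrix ι ι ℂ) (j : ι) : vnorm (fun i => A i j) ≤ ‖A‖ := by
  have := vnorm_mulVec_le A (Pi.single j 1)
  rw [vnorm_single, mul_one, Matrix.mulVec_single_one] at this
  exact this

lemma vnorm_row_le (A : Matrix ι ι ℂ) (i : ι) : vnorm (fun j => A i j) ≤ ‖A‖ := by
  have := vnorm_col_le Aᴴ i
  rw [Matrix.l2_opNorm_conjTranspose] at this
  rw [← vnorm_star]
  exact this

lemma entry_le_norm (A : Matrix ι ι ℂ) (i j : ι) : ‖A i j‖ ≤ ‖A‖ :=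
  (norm_le_vnorm (fun j => A i j) j).trans (vnorm_row_le A i)

/-- `‖x A y‖ ≤ ‖A‖ ‖x‖ ‖y‖`. -/
lemma norm_bilin_le (A : Matrix ι ι ℂ) (x y : ι → ℂ) :
    ‖∑ k, x k * ∑ l, A k l * y l‖ ≤ ‖A‖ * (vnorm x * vnorm y) := by
  calc _ ≤ vnorm x * vnorm (A *ᵥ y) := norm_sum_mul_le x (A *ᵥ y)
    _ ≤ vnorm x * (‖A‖ * vnorm y) := by
        gcongr
        · exact vnorm_nonneg _
        · exact vnorm_mulVec_le A y
    _ = _ := by ring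

lemma sum_sq_le_card_mul (A : Matrix ι ι ℂ) :
    ∑ i, ∑ j, ‖A i j‖ ^ 2 ≤ Fintype.card ι * ‖A‖ ^ 2 := by
  calc _ ≤ ∑ _ : ι, ‖A‖ ^ 2 := by
        refine Finset.sum_le_sum fun i _ => ?_
        rw [← vnorm_sq fun j => A i j]
        gcongr
        · exact vnorm_nonneg _
        · exact vnorm_row_le A i
    _ = _ := by simp

lemma sum_sq_mul_le (A B : Matrix ι ι ℂ) :
    ∑ i, ∑ j, ‖(A * B) i j‖ ^ 2 ≤ ‖A‖ ^ 2 * ∑ i, ∑ j, ‖B i j‖ ^ 2 := by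
  rw [Finset.sum_comm, Finset.sum_comm (f := fun i j => ‖B i j‖ ^ 2), Finset.mul_sum]
  refine Finset.sum_le_sum fun j _ => ?_
  have h := vnorm_mulVec_le A (fun i => B i j)
  have h2 := pow_le_pow_left₀ (vnorm_nonneg _) h 2
  rw [mul_pow, vnorm_sq, vnorm_sq] at h2
  exact h2

lemma sum_sq_mul_le' (A B : Matrix ι ι ℂ) :
    ∑ i, ∑ j, ‖(A * B) i j‖ ^ 2 ≤ ‖B‖ ^ 2 * ∑ i, ∑ j, ‖A i j‖ ^ 2 := by
  have h := sum_sq_mul_le Bᴴ Aᴴ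
  rw [Matrix.l2_opNorm_conjTranspose, ← Matrix.conjTranspose_mul] at h
  simp only [Matrix.conjTranspose_apply, norm_star] at h
  rwa [Finset.sum_comm, Finset.sum_comm (f := fun i j => ‖A j i‖ ^ 2)] at h

/-- A matrix that is bounded below is invertible, with control on its inverse. -/
lemma inv_of_lower_bound {A : Matrix ι ι ℂ} {c : ℝ} (hc : 0 < c)
    (h : ∀ x, c * vnorm x ≤ vnorm (A *ᵥ x)) : IsUnit A.det ∧ ‖A⁻¹‖ ≤ c⁻¹ := by
  have hu : IsUnit A := by
    rw [← Matrix.mulVec_injective_iff_isUnit]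
    intro x y hxy
    have h1 := h (x - y)
    rw [Matrix.mulVec_sub, sub_eq_zero.2 hxy, vnorm_eq_zero.2 rfl] at h1
    have h2 : vnorm (x - y) = 0 := le_antisymm (by nlinarith) (vnorm_nonneg _)
    exact sub_eq_zero.1 (vnorm_eq_zero.1 h2)
  have hd := (Matrix.isUnit_iff_isUnit_det A).1 hu
  refine ⟨hd, opnorm_le_of_vnorm (by positivity) fun x => ?_⟩
  have h1 := h (A⁻¹ *ᵥ x)
  rw [Matrix.mulVec_mulVec, Matrix.mul_nonsing_inv _ hd, Matrix.one_mulVec] at h1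
  rwa [le_inv_mul_iff₀ hc]

lemma im_quadForm_sub_diagonal {T : Matrix ι ι ℂ} (hT : T.IsHermitian) (w : ι → ℂ) (x : ι → ℂ) :
    (star x ⬝ᵥ ((T - Matrix.diagonal w) *ᵥ x)).im = -∑ i, (w i).im * ‖x i‖ ^ 2 := by
  have h1 : (star x ⬝ᵥ (T *ᵥ x)).im = 0 := hT.im_star_dotProduct_mulVec_self x
  rw [Matrix.sub_mulVec, dotProduct_sub, Complex.sub_im, h1, zero_sub, neg_inj, dotProduct,
    Complex.im_sum]
  refine Finset.sum_congr rfl fun i _ => ?_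
  rw [Matrix.mulVec_diagonal, Pi.star_apply]
  have : star (x i) * (w i * x i) = w i * ((‖x i‖ ^ 2 : ℝ) : ℂ) := by
    have := Complex.conj_mul' (x i)
    push_cast
    rw [← this, starRingEnd_apply]; ring
  rw [this, Complex.im_mul_ofReal]

/-- Lower bound for a Hermitian matrix shifted by a diagonal with positive imaginary part. -/
lemma lower_bound_of_im {T : Matrix ι ι ℂ} (hT : T.IsHermitian) {w : ι → ℂ} {η : ℝ}
    (hw : ∀ i, η ≤ (w i).im) (x : ι → ℂ) :
    η * vnorm x ≤ vnorm ((T - Matrix.diagonal w) *ᵥ x) := by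
  have h1 : η * vnorm x ^ 2 ≤ vnorm x * vnorm ((T - Matrix.diagonal w) *ᵥ x) := by
    calc η * vnorm x ^ 2 ≤ ∑ i, (w i).im * ‖x i‖ ^ 2 := by
          rw [vnorm_sq, Finset.mul_sum]
          exact Finset.sum_le_sum fun i _ => by gcongr; exact hw i
      _ = -(star x ⬝ᵥ ((T - Matrix.diagonal w) *ᵥ x)).im := by
          rw [im_quadForm_sub_diagonal hT, neg_neg]
      _ ≤ ‖star x ⬝ᵥ ((T - Matrix.diagonal w) *ᵥ x)‖ :=
          (neg_le_abs _).trans (Complex.abs_im_le_norm _)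
      _ ≤ vnorm (fun i => star (x i)) * vnorm ((T - Matrix.diagonal w) *ᵥ x) :=
          norm_sum_mul_le _ _
      _ = _ := by rw [vnorm_star]
  rcases eq_or_lt_of_le (vnorm_nonneg x) with h | h
  · rw [← h, mul_zero]; exact vnorm_nonneg _
  · by_contra! h2
    nlinarith

/-- Basic properties of the inverse of `T - diag w`, `T` Hermitian and `Im w ≥ η > 0`. -/
lemma inv_sub_diagonal {T : Matrix ι ι ℂ} (hT : T.IsHermitian) {w : ι → ℂ} {η : ℝ} (hη : 0 < η)
    (hw : ∀ i, η ≤ (w i).im) :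
    IsUnit (T - Matrix.diagonal w).det ∧ ‖(T - Matrix.diagonal w)⁻¹‖ ≤ η⁻¹ :=
  inv_of_lower_bound hη (lower_bound_of_im hT hw)

lemma isUnit_det_sub_diagonal {T : Matrix ι ι ℂ} (hT : T.IsHermitian) {w : ι → ℂ}
    (hw : ∀ i, 0 < (w i).im) : IsUnit (T - Matrix.diagonal w).det := by
  rcases isEmpty_or_nonempty ι with h | h
  · simp
  · obtain ⟨i, hi⟩ := Finite.exists_min fun i => (w i).im
    exact (inv_sub_diagonal hT (hw i) hi).1

/-- With `A = T - diag w - D` and `M A = 1`, one has `M - M* = M (A* - A) M*`, where the Hermitian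
part `T` cancels. This order of the factors expresses imaginary parts through rows of `M` and
tolerates a non-Hermitian `D`. -/
lemma inv_sub_conjTranspose {T D M : Matrix ι ι ℂ} (hT : T.IsHermitian) {w : ι → ℂ}
    (h1 : M * (T - Matrix.diagonal w - D) = 1) :
    M - Mᴴ = M * (Matrix.diagonal (fun i => 2 * Complex.I * (w i).im) + (D - Dᴴ)) * Mᴴ := by
  have h2 : (T - Matrix.diagonal (star w) - Dᴴ) * Mᴴ = 1 := by
    have := congrArg Matrix.conjTranspose h1
    rwa [Matrix.conjTranspose_mul, Matrix.conjTranspose_sub, Matrix.conjTranspose_sub, hT.eq,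
      Matrix.diagonal_conjTranspose, Matrix.conjTranspose_one] at this
  have h3 : Matrix.diagonal (fun i => 2 * Complex.I * ((w i).im : ℂ)) + (D - Dᴴ)
      = (T - Matrix.diagonal (star w) - Dᴴ) - (T - Matrix.diagonal w - D) := by
    have : Matrix.diagonal (fun i => 2 * Complex.I * ((w i).im : ℂ))
        = Matrix.diagonal w - Matrix.diagonal (star w) := by
      rw [Matrix.diagonal_sub]
      congr 1; ext1 i
      apply Complex.ext <;> simp; ring
    rw [this]; abel
  rw [h3, mul_sub, sub_mul, mul_assoc, h2, h1, mul_one, one_mul]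

/-- The column version. Both are needed because a difference `M - G = M (⋯) G` pairs rows of `M`
with columns of `G`. -/
lemma inv_sub_conjTranspose' {T M : Matrix ι ι ℂ} (hT : T.IsHermitian) {w : ι → ℂ}
    (h1 : (T - Matrix.diagonal w) * M = 1) :
    M - Mᴴ = Mᴴ * Matrix.diagonal (fun i => 2 * Complex.I * (w i).im) * M := by
  have h2 : Mᴴ * (T - Matrix.diagonal (star w)) = 1 := by
    have := congrArg Matrix.conjTranspose h1
    rwa [Matrix.conjTranspose_mul, Matrix.conjTranspose_sub, hT.eq,
      Matrix.diagonal_conjTranspose, Matrix.conjTranspose_one] at this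
  have h3 : Matrix.diagonal (fun i => 2 * Complex.I * ((w i).im : ℂ))
      = (T - Matrix.diagonal (star w)) - (T - Matrix.diagonal w) := by
    have : Matrix.diagonal (fun i => 2 * Complex.I * ((w i).im : ℂ))
        = Matrix.diagonal w - Matrix.diagonal (star w) := by
      rw [Matrix.diagonal_sub]
      congr 1; ext1 i
      apply Complex.ext <;> simp; ring
    rw [this]; abel
  rw [h3, mul_sub, sub_mul, h2, mul_assoc Mᴴ (T - _), h1, mul_one, one_mul]

/-- The imaginary part of a diagonal entry of the inverse, in terms of a column. -/
lemma im_inv_col {T M : Matrix ι ι ℂ} (hT : T.IsHermitian) {w : ι → ℂ}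
    (h1 : (T - Matrix.diagonal w) * M = 1) (i : ι) :
    (M i i).im = ∑ k, (w k).im * ‖M k i‖ ^ 2 := by
  have h := congrFun (congrFun (inv_sub_conjTranspose' hT h1) i) i
  rw [Matrix.sub_apply, Matrix.conjTranspose_apply, Matrix.mul_apply] at h
  simp only [Matrix.mul_diagonal, Matrix.conjTranspose_apply] at h
  have h4 : M i i - star (M i i) = 2 * Complex.I * ((M i i).im : ℂ) := by
    apply Complex.ext <;> simp; ring
  have h5 : ∑ k, star (M k i) * (2 * Complex.I * ((w k).im : ℂ)) * M k i
      = 2 * Complex.I * ((∑ k, (w k).im * ‖M k i‖ ^ 2 : ℝ) : ℂ) := by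
    rw [Complex.ofReal_sum, Finset.mul_sum]
    refine Finset.sum_congr rfl fun k _ => ?_
    have := Complex.conj_mul' (M k i)
    push_cast
    rw [← this, starRingEnd_apply]; ring
  rw [h4, h5] at h
  exact_mod_cast mul_left_cancel₀ (by simp : (2 * Complex.I : ℂ) ≠ 0) h

/-- The imaginary part of a diagonal entry of a perturbed inverse, in terms of a row. -/
lemma le_im_inv_row {T D M : Matrix ι ι ℂ} (hT : T.IsHermitian) {w : ι → ℂ}
    (h1 : M * (T - Matrix.diagonal w - D) = 1) (i : ι) :
    ∑ k, (w k).im * ‖M i k‖ ^ 2 - ‖D‖ * ∑ k, ‖M i k‖ ^ 2 ≤ (M i i).im := by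
  have h := congrFun (congrFun (inv_sub_conjTranspose hT h1) i) i
  rw [mul_add, add_mul, Matrix.add_apply, Matrix.sub_apply, Matrix.conjTranspose_apply,
    Matrix.mul_apply] at h
  simp only [Matrix.mul_diagonal, Matrix.conjTranspose_apply] at h
  have h4 : M i i - star (M i i) = 2 * Complex.I * ((M i i).im : ℂ) := by
    apply Complex.ext <;> simp; ring
  have h5 : ∑ k, M i k * (2 * Complex.I * ((w k).im : ℂ)) * star (M i k)
      = 2 * Complex.I * ((∑ k, (w k).im * ‖M i k‖ ^ 2 : ℝ) : ℂ) := by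
    rw [Complex.ofReal_sum, Finset.mul_sum]
    refine Finset.sum_congr rfl fun k _ => ?_
    have := Complex.conj_mul' (M i k)
    push_cast
    rw [← this, starRingEnd_apply]; ring
  rw [h4, h5] at h
  have h6 : ‖(M * (D - Dᴴ) * Mᴴ) i i‖ ≤ 2 * (‖D‖ * ∑ k, ‖M i k‖ ^ 2) := by
    have h7 : (M * (D - Dᴴ) * Mᴴ) i i
        = ∑ k, M i k * ∑ l, (D - Dᴴ) k l * star (M i l) := by
      rw [Matrix.mul_assoc, Matrix.mul_apply]
      refine Finset.sum_congr rfl fun k _ => ?_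
      rw [Matrix.mul_apply]; rfl
    rw [h7]
    refine (norm_bilin_le _ (fun k => M i k) (fun k => star (M i k))).trans ?_
    rw [vnorm_star, ← sq, vnorm_sq]
    have h8 : ‖D - Dᴴ‖ ≤ 2 * ‖D‖ := by
      refine (norm_sub_le _ _).trans ?_
      rw [Matrix.l2_opNorm_conjTranspose]; linarith
    have h9 : 0 ≤ ∑ k, ‖M i k‖ ^ 2 := Finset.sum_nonneg fun _ _ => by positivity
    nlinarith
  have h10 := congrArg Complex.im h
  rw [Complex.add_im] at h10
  have h11 := (neg_le_abs _).trans ((Complex.abs_im_le_norm _).trans h6)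
  have e1 : ∀ r : ℝ, (2 * Complex.I * (r : ℂ)).im = 2 * r := fun r => by simp
  rw [e1, e1] at h10
  linarith

end LinearAlgebra

/-! ### Stability and uniqueness for the Dyson equation. -/

section Dyson

open scoped Matrix.Norms.L2Operator

variable {ι : Type*} [Fintype ι]

/-- Weighted Cauchy–Schwarz inequality, the source of contraction and stability of the Dyson
equation. -/
lemma weighted_cauchy_schwarz {S : ι → ι → ℝ} (hS : ∀ i j, 0 ≤ S i j) {r c a b d : ι → ℝ}
    (hr : ∀ k, 0 ≤ r k) (hc : ∀ k, 0 ≤ c k) (ha : ∀ k, 0 ≤ a k) (hb : ∀ k, 0 ≤ b k)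
    {D : ℝ} (hD : 0 ≤ D) (hd : ∀ j, d j ≤ D * √(a j * b j)) {x y a' b' : ℝ}
    (hx : 0 ≤ x) (hy : 0 ≤ y)
    (ha' : ∑ k, (∑ j, S k j * a j) * r k + x ≤ a') (hb' : ∑ k, (∑ j, S k j * b j) * c k + y ≤ b') :
    ∑ k, √(r k) * √(c k) * ∑ j, S k j * d j + D * (√x * √y) ≤ D * √(a' * b') := by
  have hSa : ∀ k, 0 ≤ ∑ j, S k j * a j :=
    fun k => Finset.sum_nonneg fun j _ => mul_nonneg (hS k j) (ha j)
  have hSb : ∀ k, 0 ≤ ∑ j, S k j * b j :=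
    fun k => Finset.sum_nonneg fun j _ => mul_nonneg (hS k j) (hb j)
  have h1 : ∀ k, ∑ j, S k j * d j ≤ D * (√(∑ j, S k j * a j) * √(∑ j, S k j * b j)) := by
    intro k
    calc ∑ j, S k j * d j ≤ ∑ j, D * (√(S k j * a j) * √(S k j * b j)) := by
          refine Finset.sum_le_sum fun j _ => ?_
          have e : √(S k j * a j) * √(S k j * b j) = S k j * √(a j * b j) := by
            rw [Real.sqrt_mul (hS k j), Real.sqrt_mul (hS k j), Real.sqrt_mul (ha j)]
            have := Real.mul_self_sqrt (hS k j)
            linear_combination (√(a j) * √(b j)) * this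
          rw [e]
          nlinarith [mul_le_mul_of_nonneg_left (hd j) (hS k j)]
      _ ≤ _ := by
          rw [← Finset.mul_sum]
          exact mul_le_mul_of_nonneg_left (Real.sum_sqrt_mul_sqrt_le _
            (fun j => mul_nonneg (hS k j) (ha j)) (fun j => mul_nonneg (hS k j) (hb j))) hD
  have h2 : ∑ k, √(r k) * √(c k) * ∑ j, S k j * d j
      ≤ D * (√(∑ k, (∑ j, S k j * a j) * r k) * √(∑ k, (∑ j, S k j * b j) * c k)) := by
    calc _ ≤ ∑ k, D * (√((∑ j, S k j * a j) * r k) * √((∑ j, S k j * b j) * c k)) := by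
          refine Finset.sum_le_sum fun k _ => ?_
          rw [Real.sqrt_mul (hSa k), Real.sqrt_mul (hSb k)]
          have := mul_le_mul_of_nonneg_left (h1 k)
            (mul_nonneg (Real.sqrt_nonneg (r k)) (Real.sqrt_nonneg (c k)))
          linarith
      _ ≤ _ := by
          rw [← Finset.mul_sum]
          exact mul_le_mul_of_nonneg_left (Real.sum_sqrt_mul_sqrt_le _
            (fun k => mul_nonneg (hSa k) (hr k)) (fun k => mul_nonneg (hSb k) (hc k))) hD
  set X := ∑ k, (∑ j, S k j * a j) * r k with hX
  set Y := ∑ k, (∑ j, S k j * b j) * c k with hY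
  have hX0 : 0 ≤ X := Finset.sum_nonneg fun k _ => mul_nonneg (hSa k) (hr k)
  have hY0 : 0 ≤ Y := Finset.sum_nonneg fun k _ => mul_nonneg (hSb k) (hc k)
  -- A third application of Cauchy–Schwarz, to the vectors `(√X, √x)` and `(√Y, √y)`, after those
  -- over `j` (`h1`) and over `k` (`h2`). The slack `x, y` later carries the part of `Im Λ` that
  -- makes the inequality strict.
  have h3 : √X * √Y + √x * √y ≤ √(a' * b') := by
    apply Real.le_sqrt_of_sq_le
    have e1 := Real.mul_self_sqrt hX0
    have e2 := Real.mul_self_sqrt hY0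
    have e3 := Real.mul_self_sqrt hx
    have e4 := Real.mul_self_sqrt hy
    have h4 : (X + x) * (Y + y) ≤ a' * b' := by gcongr; linarith
    refine le_trans ?_ h4
    nlinarith [sq_nonneg (√X * √y - √x * √Y)]
  nlinarith [mul_le_mul_of_nonneg_left h3 hD]

/-- The diagonal of `Λ + R(u)`. -/
def shiftDiag (S : ι → ι → ℝ) (Λ u : ι → ℂ) : ι → ℂ := fun i => Λ i + ∑ j, (S i j : ℂ) * u j

lemma im_shiftDiag (S : ι → ι → ℝ) (Λ u : ι → ℂ) (i : ι) :
    (shiftDiag S Λ u i).im = (Λ i).im + ∑ j, S i j * (u j).im := by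
  simp [shiftDiag, Complex.add_im, Complex.im_sum]

variable [DecidableEq ι]

/-- The matrix `(C - Λ - R(u))⁻¹`. -/
def dysonMat (C : Matrix ι ι ℂ) (S : ι → ι → ℝ) (Λ u : ι → ℂ) : Matrix ι ι ℂ :=
  (C - Matrix.diagonal (shiftDiag S Λ u))⁻¹

/-- Resolvent identity `M - G = M (R(u) - R(v) + D) G`. The squares under roots match the weights
`r`, `c` of `weighted_cauchy_schwarz`. -/
lemma norm_sub_entry_le {C D M G : Matrix ι ι ℂ} {S : ι → ι → ℝ} (hS : ∀ i j, 0 ≤ S i j)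
    {Λ u v : ι → ℂ}
    (hM : M * (C - Matrix.diagonal (shiftDiag S Λ u) - D) = 1)
    (hG : (C - Matrix.diagonal (shiftDiag S Λ v)) * G = 1) (i j : ι) :
    ‖(M - G) i j‖ ≤ ∑ k, √(‖M i k‖ ^ 2) * √(‖G k j‖ ^ 2) * ∑ l, S k l * ‖u l - v l‖
      + ‖D‖ * (√(∑ k, ‖M i k‖ ^ 2) * √(∑ k, ‖G k j‖ ^ 2)) := by
  have h1 : M - G = M * (Matrix.diagonal (fun k => ∑ l, (S k l : ℂ) * (u l - v l)) + D) * G := by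
    have e : Matrix.diagonal (fun k => ∑ l, (S k l : ℂ) * (u l - v l)) + D
        = (C - Matrix.diagonal (shiftDiag S Λ v))
          - (C - Matrix.diagonal (shiftDiag S Λ u) - D) := by
      have : Matrix.diagonal (fun k => ∑ l, (S k l : ℂ) * (u l - v l))
          = Matrix.diagonal (shiftDiag S Λ u) - Matrix.diagonal (shiftDiag S Λ v) := by
        rw [Matrix.diagonal_sub]
        congr 1; ext1 k
        simp [shiftDiag, mul_sub, Finset.sum_sub_distrib]
      rw [this]; abel
    rw [e, mul_sub, sub_mul, mul_assoc, hG, hM, mul_one, one_mul]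
  have h2 : (M - G) i j = ∑ k, M i k * (∑ l, (S k l : ℂ) * (u l - v l)) * G k j
      + ∑ k, M i k * ∑ l, D k l * G l j := by
    rw [h1, mul_add, add_mul, Matrix.add_apply, Matrix.mul_apply, Matrix.mul_assoc,
      Matrix.mul_apply]
    simp only [Matrix.mul_diagonal]
    simp only [Matrix.mul_apply]
  rw [h2]
  refine (norm_add_le _ _).trans (add_le_add ?_ (norm_bilin_le D (fun k => M i k) fun k => G k j))
  refine (norm_sum_le _ _).trans (Finset.sum_le_sum fun k _ => ?_)
  rw [norm_mul, norm_mul, Real.sqrt_sq (norm_nonneg _), Real.sqrt_sq (norm_nonneg _)]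
  have h3 : ‖∑ l, (S k l : ℂ) * (u l - v l)‖ ≤ ∑ l, S k l * ‖u l - v l‖ := by
    refine (norm_sum_le _ _).trans (le_of_eq (Finset.sum_congr rfl fun l _ => ?_))
    rw [norm_mul, Complex.norm_real, Real.norm_of_nonneg (hS k l)]
  calc _ = ‖M i k‖ * ‖G k j‖ * ‖∑ l, (S k l : ℂ) * (u l - v l)‖ := by ring
    _ ≤ _ := by gcongr

lemma sum_sq_row_pos {M A : Matrix ι ι ℂ} (h : M * A = 1) (i : ι) : 0 < ∑ k, ‖M i k‖ ^ 2 := by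
  by_contra! h0
  have h1 : ∀ k, M i k = 0 := by
    intro k
    have := (Finset.sum_eq_zero_iff_of_nonneg (fun k _ => by positivity)).1
      (le_antisymm h0 (Finset.sum_nonneg fun k _ => by positivity)) k (Finset.mem_univ k)
    simpa using this
  have h2 := congrFun (congrFun h i) i
  rw [Matrix.mul_apply] at h2
  simp [h1] at h2

lemma sum_sq_col_pos {M A : Matrix ι ι ℂ} (h : A * M = 1) (i : ι) : 0 < ∑ k, ‖M k i‖ ^ 2 := by
  have h' : Mᵀ * Aᵀ = 1 := by rw [← Matrix.transpose_mul, h, Matrix.transpose_one]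
  exact sum_sq_row_pos h' i

/-- **Stability of the Dyson equation**: a solution `M` of the equation perturbed by a matrix `D`
is close to the solution `G`, entry by entry. -/
theorem dyson_stability {C D M G : Matrix ι ι ℂ} (hC : C.IsHermitian) {S : ι → ι → ℝ}
    (hS : ∀ i j, 0 ≤ S i j) {Λ : ι → ℂ} {η : ℝ} (hη : 0 < η) (hΛ : ∀ i, η ≤ (Λ i).im)
    (hD : ‖D‖ ≤ η / 2)
    (hM : M * (C - Matrix.diagonal (shiftDiag S Λ fun i => M i i) - D) = 1)
    (hG : (C - Matrix.diagonal (shiftDiag S Λ fun i => G i i)) * G = 1)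
    (hMi : ∀ i, 0 ≤ (M i i).im) (hGi : ∀ i, 0 ≤ (G i i).im) (i j : ι) :
    ‖(M - G) i j‖ ≤ 2 * ‖D‖ / η * √((M i i).im * (G j j).im) := by
  set r : ι → ι → ℝ := fun i k => ‖M i k‖ ^ 2 with hr
  set c : ι → ι → ℝ := fun j k => ‖G k j‖ ^ 2 with hc
  have hrp : ∀ i, 0 < ∑ k, r i k := fun i => sum_sq_row_pos hM i
  have hcp : ∀ j, 0 < ∑ k, c j k := fun j => sum_sq_col_pos hG j
  -- Of the spectral shift `η`, one half pays for `‖D‖`; the remaining half is kept as slack.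
  have hα : ∀ i, ∑ k, (∑ l, S k l * (M l l).im) * r i k + η / 2 * ∑ k, r i k ≤ (M i i).im := by
    intro i
    refine le_trans ?_ (le_im_inv_row hC hM i)
    have h1 : ∑ k, (∑ l, S k l * (M l l).im) * r i k + η * ∑ k, r i k
        ≤ ∑ k, (shiftDiag S Λ (fun i => M i i) k).im * ‖M i k‖ ^ 2 := by
      rw [Finset.mul_sum, ← Finset.sum_add_distrib]
      refine Finset.sum_le_sum fun k _ => ?_
      rw [im_shiftDiag, ← add_mul]
      gcongr ?_ * _
      linarith [hΛ k]
    have h2 : ‖D‖ * ∑ k, r i k ≤ η / 2 * ∑ k, r i k :=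
      mul_le_mul_of_nonneg_right hD (hrp i).le
    simp only [hr] at *
    linarith
  have hβ : ∀ j, ∑ k, (∑ l, S k l * (G l l).im) * c j k + η / 2 * ∑ k, c j k ≤ (G j j).im := by
    intro j
    rw [im_inv_col hC hG j, Finset.mul_sum, ← Finset.sum_add_distrib]
    refine Finset.sum_le_sum fun k _ => ?_
    rw [im_shiftDiag, ← add_mul]
    gcongr ?_ * _
    linarith [hΛ k]
  have hSM : ∀ k, 0 ≤ ∑ l, S k l * (M l l).im :=
    fun k => Finset.sum_nonneg fun l _ => mul_nonneg (hS k l) (hMi l)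
  have hSG : ∀ k, 0 ≤ ∑ l, S k l * (G l l).im :=
    fun k => Finset.sum_nonneg fun l _ => mul_nonneg (hS k l) (hGi l)
  have hαp : ∀ i, 0 < (M i i).im := fun i => by
    refine lt_of_lt_of_le ?_ (hα i)
    have : 0 ≤ ∑ k, (∑ l, S k l * (M l l).im) * r i k :=
      Finset.sum_nonneg fun k _ => mul_nonneg (hSM k) (by simp only [hr]; positivity)
    have := mul_pos (half_pos hη) (hrp i)
    linarith
  have hβp : ∀ i, 0 < (G i i).im := fun i => by
    refine lt_of_lt_of_le ?_ (hβ i)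
    have : 0 ≤ ∑ k, (∑ l, S k l * (G l l).im) * c i k :=
      Finset.sum_nonneg fun k _ => mul_nonneg (hSG k) (by simp only [hc]; positivity)
    have := mul_pos (half_pos hη) (hcp i)
    linarith
  -- the core estimate, for a given bound on the diagonal differences
  have core : ∀ (K : ℝ), 0 ≤ K → (∀ l, ‖M l l - G l l‖ ≤ K * √((M l l).im * (G l l).im)) →
      ∀ i j, ‖(M - G) i j‖ ≤ K * √((M i i).im * (G j j).im)
        - (K * (η / 2) - ‖D‖) * (√(∑ k, r i k) * √(∑ k, c j k)) := by
    intro K hK hKd i j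
    have h1 := norm_sub_entry_le hS hM hG i j
    have h2 := weighted_cauchy_schwarz hS (r := r i) (c := c j)
      (fun k => by simp only [hr]; positivity) (fun k => by simp only [hc]; positivity)
      hMi hGi hK hKd
      (x := η / 2 * ∑ k, r i k) (y := η / 2 * ∑ k, c j k)
      (mul_pos (half_pos hη) (hrp i)).le (mul_pos (half_pos hη) (hcp j)).le (hα i) (hβ j)
    rw [Real.sqrt_mul (half_pos hη).le, Real.sqrt_mul (half_pos hη).le] at h2
    have h3 := Real.mul_self_sqrt (half_pos hη).le
    have h4 : K * (√(η / 2) * √(∑ k, r i k) * (√(η / 2) * √(∑ k, c j k)))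
        = K * (η / 2) * (√(∑ k, r i k) * √(∑ k, c j k)) := by
      linear_combination (K * (√(∑ k, r i k) * √(∑ k, c j k))) * h3
    rw [h4] at h2
    simp only [hr, hc] at *
    linarith
  -- Take for `K` the largest weighted diagonal difference. At a maximising index the left side of
  -- `core` equals `K √(⋯)`, so the subtracted term cannot be positive, and this forces `K ≤
  -- 2‖D‖/η`. Feeding that `K` back into `core` handles the off-diagonal entries.
  have hdiag : ∀ l, ‖M l l - G l l‖ ≤ 2 * ‖D‖ / η * √((M l l).im * (G l l).im) := by
    have : Nonempty ι := ⟨i⟩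
    obtain ⟨i₀, hi₀⟩ := Finite.exists_max fun l => ‖M l l - G l l‖ / √((M l l).im * (G l l).im)
    have hwp : ∀ l, 0 < √((M l l).im * (G l l).im) :=
      fun l => Real.sqrt_pos.2 (mul_pos (hαp l) (hβp l))
    set K := ‖M i₀ i₀ - G i₀ i₀‖ / √((M i₀ i₀).im * (G i₀ i₀).im) with hK
    have hKl : ∀ l, ‖M l l - G l l‖ ≤ K * √((M l l).im * (G l l).im) :=
      fun l => (div_le_iff₀ (hwp l)).1 (hi₀ l)
    have hK0 : 0 ≤ K := by positivity
    have h1 := core K hK0 hKl i₀ i₀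
    rw [Matrix.sub_apply] at h1
    have h2 : ‖M i₀ i₀ - G i₀ i₀‖ = K * √((M i₀ i₀).im * (G i₀ i₀).im) :=
      (div_mul_cancel₀ _ (hwp i₀).ne').symm
    have h3 : 0 < √(∑ k, r i₀ k) * √(∑ k, c i₀ k) :=
      mul_pos (Real.sqrt_pos.2 (hrp i₀)) (Real.sqrt_pos.2 (hcp i₀))
    have h4 : K * (η / 2) - ‖D‖ ≤ 0 := by
      by_contra! h5
      have := mul_pos h5 h3
      linarith
    have h5 : K ≤ 2 * ‖D‖ / η := by
      rw [le_div_iff₀ hη]; linarith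
    exact fun l => (hKl l).trans (mul_le_mul_of_nonneg_right h5 (hwp l).le)
  have h1 := core _ (by positivity) hdiag i j
  have h2 : 2 * ‖D‖ / η * (η / 2) - ‖D‖ = 0 := by field_simp; ring
  rw [h2, zero_mul, sub_zero] at h1
  exact h1

/-- Uniqueness of the solution of the Dyson equation. -/
theorem dyson_unique {C M G : Matrix ι ι ℂ} (hC : C.IsHermitian) {S : ι → ι → ℝ}
    (hS : ∀ i j, 0 ≤ S i j) {Λ : ι → ℂ} (hΛ : ∀ i, 0 < (Λ i).im)
    (hM : M * (C - Matrix.diagonal (shiftDiag S Λ fun i => M i i)) = 1)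
    (hG : (C - Matrix.diagonal (shiftDiag S Λ fun i => G i i)) * G = 1)
    (hMi : ∀ i, 0 ≤ (M i i).im) (hGi : ∀ i, 0 ≤ (G i i).im) : M = G := by
  ext i j
  have : Nonempty ι := ⟨i⟩
  obtain ⟨i₀, hi₀⟩ := Finite.exists_min fun i => (Λ i).im
  have h := dyson_stability (D := 0) hC hS (hΛ i₀) hi₀ (by simpa using (half_pos (hΛ i₀)).le)
    (by rwa [sub_zero]) hG hMi hGi i j
  rw [norm_zero, mul_zero, zero_div, zero_mul] at h
  exact sub_eq_zero.1 (norm_le_zero_iff.1 h)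

end Dyson

/-! ### Existence and analyticity of the solution of the Dyson equation. -/

section DysonExistence

open scoped Matrix.Norms.L2Operator

variable {ι : Type*} [Fintype ι] [DecidableEq ι]

lemma differentiableAt_det {A : ℂ → Matrix ι ι ℂ} {z : ℂ}
    (hA : ∀ i j, DifferentiableAt ℂ (fun z => A z i j) z) :
    DifferentiableAt ℂ (fun z => (A z).det) z := by
  simp only [Matrix.det_apply]
  refine DifferentiableAt.fun_sum fun σ _ => ?_
  refine DifferentiableAt.const_smul ?_ _
  exact DifferentiableAt.fun_finsetProd fun i _ => hA _ _

lemma differentiableAt_inv_entry {A : ℂ → Matrix ι ι ℂ} {z : ℂ}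
    (hA : ∀ i j, DifferentiableAt ℂ (fun z => A z i j) z) (hz : IsUnit (A z).det) (i j : ι) :
    DifferentiableAt ℂ (fun z => (A z)⁻¹ i j) z := by
  simp only [Matrix.inv_def, Matrix.smul_apply, Ring.inverse_eq_inv', smul_eq_mul,
    Matrix.adjugate_apply]
  refine ((differentiableAt_det hA).inv hz.ne_zero).mul (differentiableAt_det fun a b => ?_)
  by_cases h : a = j
  · subst h; simp
  · simp only [Matrix.updateRow_ne h]; exact hA a b

lemma tendsto_inv {α : Type*} {l : Filter α} {A : α → Matrix ι ι ℂ} {A₀ : Matrix ι ι ℂ}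
    (h : Tendsto A l (𝓝 A₀)) (h0 : IsUnit A₀.det) : Tendsto (fun a => (A a)⁻¹) l (𝓝 A₀⁻¹) := by
  obtain ⟨u, hu⟩ := (Matrix.isUnit_iff_isUnit_det A₀).2 h0
  simp only [Matrix.nonsing_inv_eq_ringInverse]
  have := NormedRing.inverse_continuousAt u
  rw [hu] at this
  exact this.tendsto.comp h

section Iteration

variable (C : Matrix ι ι ℂ) (S : ι → ι → ℝ)

/-- Fixed point iteration for the diagonal of the solution of the Dyson equation. -/
def dysonIter (Λ : ι → ℂ) : ℕ → ι → ℂ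
  | 0 => fun _ => Complex.I
  | n + 1 => fun i => dysonMat C S Λ (dysonIter Λ n) i i

/-- Size of the first step of the iteration. -/
def dysonStep (Λ : ι → ℂ) : ℝ :=
  ∑ j, ‖dysonIter C S Λ 1 j - Complex.I‖ / √((dysonIter C S Λ 1 j).im)

/-- The limit of the iteration. -/
def dysonLim (Λ : ι → ℂ) (i : ι) : ℂ := limUnder atTop fun n => dysonIter C S Λ n i

/-- An upper bound for `R(Im u)` along the iteration. -/
def dysonBound (η : ℝ) : ℝ := (∑ i, ∑ j, S i j) * (1 + η⁻¹)

/-- The contraction rate. -/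
def dysonRate (η : ℝ) : ℝ := dysonBound S η / (dysonBound S η + η)

variable {C S}

variable (hC : C.IsHermitian) (hS : ∀ i j, 0 ≤ S i j)

omit [DecidableEq ι] in
lemma sum_mul_im_nonneg (hS : ∀ i j, 0 ≤ S i j) {u : ι → ℂ} (hu : ∀ i, 0 ≤ (u i).im) (i : ι) :
    0 ≤ ∑ j, S i j * (u j).im :=
  Finset.sum_nonneg fun j _ => mul_nonneg (hS i j) (hu j)

include hC hS in
lemma dysonMat_spec {Λ u : ι → ℂ} {η : ℝ} (hη : 0 < η) (hΛ : ∀ i, η ≤ (Λ i).im)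
    (hu : ∀ i, 0 ≤ (u i).im) :
    IsUnit (C - Matrix.diagonal (shiftDiag S Λ u)).det ∧ ‖dysonMat C S Λ u‖ ≤ η⁻¹ ∧
    (∀ i, ∑ k, (shiftDiag S Λ u k).im * ‖dysonMat C S Λ u i k‖ ^ 2 ≤ (dysonMat C S Λ u i i).im) ∧
    (∀ i, ∑ k, (shiftDiag S Λ u k).im * ‖dysonMat C S Λ u k i‖ ^ 2 ≤ (dysonMat C S Λ u i i).im) ∧
    (∀ i, 0 < (dysonMat C S Λ u i i).im) := by
  have hw : ∀ i, η ≤ (shiftDiag S Λ u i).im := fun i => by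
    rw [im_shiftDiag]
    linarith [hΛ i, sum_mul_im_nonneg hS hu i]
  obtain ⟨h1, h2⟩ := inv_sub_diagonal hC hη hw
  have h3 : dysonMat C S Λ u * (C - Matrix.diagonal (shiftDiag S Λ u)) = 1 :=
    Matrix.nonsing_inv_mul _ h1
  have h4 : (C - Matrix.diagonal (shiftDiag S Λ u)) * dysonMat C S Λ u = 1 :=
    Matrix.mul_nonsing_inv _ h1
  refine ⟨h1, h2, fun i => ?_, fun i => (im_inv_col hC h4 i).ge, fun i => ?_⟩
  · have := le_im_inv_row (D := 0) hC (by rwa [sub_zero]) i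
    simpa using this
  · rw [im_inv_col hC h4 i]
    have h5 := sum_sq_col_pos h4 i
    calc 0 < η * ∑ k, ‖dysonMat C S Λ u k i‖ ^ 2 := mul_pos hη h5
      _ ≤ _ := by
        rw [Finset.mul_sum]
        exact Finset.sum_le_sum fun k _ => by gcongr; exact hw k

-- In the bound `1 + η⁻¹`, the 1 accounts for the starting value `Complex.I` and `η⁻¹` for every
-- later iterate.
include hC hS in
lemma dysonIter_spec {Λ : ι → ℂ} {η : ℝ} (hη : 0 < η) (hΛ : ∀ i, η ≤ (Λ i).im) (n : ℕ) :
    (∀ i, 0 < (dysonIter C S Λ n i).im) ∧ (∀ i, ‖dysonIter C S Λ n i‖ ≤ 1 + η⁻¹) := by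
  induction n with
  | zero =>
    refine ⟨fun i => by simp [dysonIter], fun i => ?_⟩
    simp only [dysonIter, Complex.norm_I]
    have : 0 < η⁻¹ := by positivity
    linarith
  | succ n ih =>
    obtain ⟨-, h2, -, -, h5⟩ := dysonMat_spec hC hS hη hΛ fun i => (ih.1 i).le
    exact ⟨h5, fun i => (entry_le_norm _ i i).trans (by linarith)⟩

omit [DecidableEq ι] in
include hS in
lemma dysonBound_nonneg {η : ℝ} (hη : 0 < η) : 0 ≤ dysonBound S η :=
  mul_nonneg (Finset.sum_nonneg fun i _ => Finset.sum_nonneg fun j _ => hS i j) (by positivity)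

omit [DecidableEq ι] in
include hS in
lemma sum_mul_im_le {u : ι → ℂ} {η : ℝ} (hη : 0 < η) (hu : ∀ i, ‖u i‖ ≤ 1 + η⁻¹) (k : ι) :
    ∑ j, S k j * (u j).im ≤ dysonBound S η := by
  have hη' : 0 < η⁻¹ := by positivity
  calc ∑ j, S k j * (u j).im ≤ ∑ j, S k j * (1 + η⁻¹) := by
        refine Finset.sum_le_sum fun j _ => mul_le_mul_of_nonneg_left ?_ (hS k j)
        exact (le_abs_self _).trans ((Complex.abs_im_le_norm _).trans (hu j))
    _ = (∑ j, S k j) * (1 + η⁻¹) := by rw [Finset.sum_mul]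
    _ ≤ _ := by
        refine mul_le_mul_of_nonneg_right ?_ (by positivity)
        exact Finset.single_le_sum (f := fun i => ∑ j, S i j)
          (fun i _ => Finset.sum_nonneg fun j _ => hS i j) (Finset.mem_univ k)

-- Contraction in the weighted distance `|u - v| / √(Im u · Im v)`. The imaginary weights of the
-- inverse are `Im Λ + R(Im u)`, with `Im Λ ≥ η` and `R(Im u) ≤ B` for `B = dysonBound S η`. So
-- `R(Im u)` is at most the fraction `B/(B + η)` of them, and `weighted_cauchy_schwarz` transfers
-- this fraction to the distance.
include hC hS in
lemma dysonMat_contract {Λ u v : ι → ℂ} {η : ℝ} (hη : 0 < η) (hΛ : ∀ i, η ≤ (Λ i).im)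
    (hu : ∀ i, 0 ≤ (u i).im) (hv : ∀ i, 0 ≤ (v i).im)
    (hu' : ∀ i, ‖u i‖ ≤ 1 + η⁻¹) (hv' : ∀ i, ‖v i‖ ≤ 1 + η⁻¹) {D : ℝ} (hD : 0 ≤ D)
    (hd : ∀ j, ‖u j - v j‖ ≤ D * √((u j).im * (v j).im)) (i : ι) :
    ‖dysonMat C S Λ u i i - dysonMat C S Λ v i i‖ ≤ D * dysonRate S η *
      √((dysonMat C S Λ u i i).im * (dysonMat C S Λ v i i).im) := by
  obtain ⟨hu1, -, hu3, -, -⟩ := dysonMat_spec hC hS hη hΛ hu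
  obtain ⟨hv1, -, -, hv4, -⟩ := dysonMat_spec hC hS hη hΛ hv
  have hb := dysonBound_nonneg hS hη
  have hθ0 : 0 ≤ dysonRate S η := div_nonneg hb (by linarith)
  have hθ : ∀ {u : ι → ℂ}, (∀ i, 0 ≤ (u i).im) → (∀ i, ‖u i‖ ≤ 1 + η⁻¹) → ∀ k,
      ∑ j, S k j * (u j).im ≤ dysonRate S η * (shiftDiag S Λ u k).im := by
    intro u h0 h1 k
    have h2 := sum_mul_im_le hS hη h1 k
    have h3 := sum_mul_im_nonneg hS h0 k
    rw [im_shiftDiag, dysonRate, div_mul_eq_mul_div, le_div_iff₀ (by linarith)]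
    have h4 := hΛ k
    nlinarith [mul_le_mul_of_nonneg_left h4 hb]
  have h1 := norm_sub_entry_le (D := 0) (M := dysonMat C S Λ u) (G := dysonMat C S Λ v) hS
    (by rw [sub_zero]; exact Matrix.nonsing_inv_mul _ hu1) (Matrix.mul_nonsing_inv _ hv1) i i
  rw [norm_zero, zero_mul, add_zero, Matrix.sub_apply] at h1
  have h2 := weighted_cauchy_schwarz hS (r := fun k => ‖dysonMat C S Λ u i k‖ ^ 2)
    (c := fun k => ‖dysonMat C S Λ v k i‖ ^ 2) (x := 0) (y := 0)
    (a' := dysonRate S η * (dysonMat C S Λ u i i).im)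
    (b' := dysonRate S η * (dysonMat C S Λ v i i).im)
    (fun k => by positivity) (fun k => by positivity) hu hv hD hd le_rfl le_rfl
    (by
      rw [add_zero]
      refine le_trans ?_ (mul_le_mul_of_nonneg_left (hu3 i) hθ0)
      rw [Finset.mul_sum]
      refine Finset.sum_le_sum fun k _ => ?_
      rw [← mul_assoc]
      gcongr
      exact hθ hu hu' k)
    (by
      rw [add_zero]
      refine le_trans ?_ (mul_le_mul_of_nonneg_left (hv4 i) hθ0)
      rw [Finset.mul_sum]
      refine Finset.sum_le_sum fun k _ => ?_
      rw [← mul_assoc]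
      gcongr
      exact hθ hv hv' k)
  rw [Real.sqrt_zero, zero_mul, mul_zero, add_zero] at h2
  refine h1.trans (h2.trans (le_of_eq ?_))
  have e : dysonRate S η * (dysonMat C S Λ u i i).im * (dysonRate S η * (dysonMat C S Λ v i i).im)
      = dysonRate S η ^ 2 * ((dysonMat C S Λ u i i).im * (dysonMat C S Λ v i i).im) := by ring
  rw [e, Real.sqrt_mul (sq_nonneg _), Real.sqrt_sq hθ0, mul_assoc]

include hC hS in
lemma dysonIter_step {Λ : ι → ℂ} {η : ℝ} (hη : 0 < η) (hΛ : ∀ i, η ≤ (Λ i).im) (n : ℕ) :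
    ∀ i, ‖dysonIter C S Λ (n + 1) i - dysonIter C S Λ n i‖ ≤
      dysonStep C S Λ * dysonRate S η ^ n *
        √((dysonIter C S Λ (n + 1) i).im * (dysonIter C S Λ n i).im) := by
  have hb := dysonBound_nonneg hS hη
  have hθ0 : 0 ≤ dysonRate S η := div_nonneg hb (by linarith)
  have hs0 : 0 ≤ dysonStep C S Λ := Finset.sum_nonneg fun _ _ => by positivity
  induction n with
  | zero =>
    intro i
    have h1 := (dysonIter_spec hC hS hη hΛ 1).1 i
    have h2 : (dysonIter C S Λ 0 i) = Complex.I := rfl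
    rw [zero_add, h2, pow_zero, mul_one, Complex.I_im, mul_one, ← div_le_iff₀ (Real.sqrt_pos.2 h1)]
    exact Finset.single_le_sum
      (f := fun j => ‖dysonIter C S Λ 1 j - Complex.I‖ / √((dysonIter C S Λ 1 j).im))
      (fun _ _ => by positivity) (Finset.mem_univ i)
  | succ n ih =>
    intro i
    have h1 := dysonIter_spec hC hS hη hΛ (n + 1)
    have h2 := dysonIter_spec hC hS hη hΛ n
    have := dysonMat_contract hC hS hη hΛ (fun i => (h1.1 i).le) (fun i => (h2.1 i).le) h1.2 h2.2
      (mul_nonneg hs0 (pow_nonneg hθ0 n)) ih i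
    rw [pow_succ, ← mul_assoc]
    exact this

-- The imaginary parts are at most `1 + η⁻¹`, so geometric decay of the weighted distance implies
-- geometric decay of the usual one.
include hC hS in
lemma dysonIter_dist {Λ : ι → ℂ} {η : ℝ} (hη : 0 < η) (hΛ : ∀ i, η ≤ (Λ i).im) (n : ℕ) (i : ι) :
    dist (dysonIter C S Λ n i) (dysonIter C S Λ (n + 1) i)
      ≤ dysonStep C S Λ * (1 + η⁻¹) * dysonRate S η ^ n := by
  have hb := dysonBound_nonneg hS hη
  have hθ0 : 0 ≤ dysonRate S η := div_nonneg hb (by linarith)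
  have hs0 : 0 ≤ dysonStep C S Λ := Finset.sum_nonneg fun _ _ => by positivity
  have hη' : 0 < η⁻¹ := by positivity
  have h1 := dysonIter_spec hC hS hη hΛ (n + 1)
  have h2 := dysonIter_spec hC hS hη hΛ n
  rw [dist_comm, dist_eq_norm]
  refine (dysonIter_step hC hS hη hΛ n i).trans ?_
  have him : ∀ z : ℂ, ‖z‖ ≤ 1 + η⁻¹ → z.im ≤ 1 + η⁻¹ :=
    fun z hz => (le_abs_self _).trans ((Complex.abs_im_le_norm _).trans hz)
  have h3 : √((dysonIter C S Λ (n + 1) i).im * (dysonIter C S Λ n i).im) ≤ 1 + η⁻¹ := by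
    rw [Real.sqrt_le_left (by linarith), sq]
    exact mul_le_mul (him _ (h1.2 i)) (him _ (h2.2 i)) (h2.1 i).le (by linarith)
  calc _ ≤ dysonStep C S Λ * dysonRate S η ^ n * (1 + η⁻¹) :=
        mul_le_mul_of_nonneg_left h3 (mul_nonneg hs0 (pow_nonneg hθ0 n))
    _ = _ := by ring

omit [DecidableEq ι] in
include hS in
lemma dysonRate_lt_one {η : ℝ} (hη : 0 < η) : dysonRate S η < 1 := by
  have hb := dysonBound_nonneg hS hη
  rw [dysonRate, div_lt_one (by linarith)]; linarith

include hC hS in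
lemma tendsto_dysonIter {Λ : ι → ℂ} {η : ℝ} (hη : 0 < η) (hΛ : ∀ i, η ≤ (Λ i).im) (i : ι) :
    Tendsto (fun n => dysonIter C S Λ n i) atTop (𝓝 (dysonLim C S Λ i)) :=
  (cauchySeq_of_le_geometric _ _ (dysonRate_lt_one hS hη)
    (dysonIter_dist hC hS hη hΛ · i)).tendsto_limUnder

include hC hS in
lemma dysonLim_im_nonneg {Λ : ι → ℂ} {η : ℝ} (hη : 0 < η) (hΛ : ∀ i, η ≤ (Λ i).im) (i : ι) :
    0 ≤ (dysonLim C S Λ i).im :=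
  ge_of_tendsto' ((Complex.continuous_im.tendsto _).comp (tendsto_dysonIter hC hS hη hΛ i))
    fun n => ((dysonIter_spec hC hS hη hΛ n).1 i).le

include hC hS in
lemma dysonLim_fixed {Λ : ι → ℂ} {η : ℝ} (hη : 0 < η) (hΛ : ∀ i, η ≤ (Λ i).im) (i : ι) :
    dysonMat C S Λ (dysonLim C S Λ) i i = dysonLim C S Λ i := by
  have hu := (dysonMat_spec hC hS hη hΛ fun i => dysonLim_im_nonneg hC hS hη hΛ i).1
  have h1 : Tendsto (fun n => C - Matrix.diagonal (shiftDiag S Λ (dysonIter C S Λ n))) atTop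
      (𝓝 (C - Matrix.diagonal (shiftDiag S Λ (dysonLim C S Λ)))) := by
    refine tendsto_const_nhds.sub ?_
    have h2 : Tendsto (fun n => shiftDiag S Λ (dysonIter C S Λ n)) atTop
        (𝓝 (shiftDiag S Λ (dysonLim C S Λ))) := by
      refine tendsto_pi_nhds.2 fun k => ?_
      refine tendsto_const_nhds.add (tendsto_finsetSum _ fun j _ => ?_)
      exact (tendsto_dysonIter hC hS hη hΛ j).const_mul _
    exact (Continuous.matrix_diagonal continuous_id).tendsto _ |>.comp h2
  have h3 := tendsto_inv h1 hu
  have h4 : Tendsto (fun n => dysonIter C S Λ (n + 1) i) atTop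
      (𝓝 (dysonMat C S Λ (dysonLim C S Λ) i i)) :=
    ((continuous_id.matrix_elem i i).tendsto _).comp h3
  exact tendsto_nhds_unique h4
    ((tendsto_add_atTop_iff_nat 1).2 (tendsto_dysonIter hC hS hη hΛ i))

lemma differentiableAt_dysonMat_entry {Λ : ι → ℂ} {k : ι} {u : ℂ → ι → ℂ} {z : ℂ}
    (hu : ∀ i, DifferentiableAt ℂ (fun z => u z i) z)
    (hd : IsUnit (C - Matrix.diagonal (shiftDiag S (Function.update Λ k z) (u z))).det) (i j : ι) :
    DifferentiableAt ℂ (fun z => dysonMat C S (Function.update Λ k z) (u z) i j) z := by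
  refine differentiableAt_inv_entry (fun a b => ?_) hd i j
  simp only [Matrix.sub_apply]
  refine (differentiableAt_const _).sub ?_
  by_cases hab : a = b
  · subst hab
    simp only [Matrix.diagonal_apply_eq, shiftDiag]
    refine DifferentiableAt.add ?_ (DifferentiableAt.fun_sum fun j _ => (hu j).const_mul _)
    by_cases hak : a = k
    · subst hak; simp
    · simp [hak]
  · simp [Matrix.diagonal_apply_ne _ hab]

include hC hS in
lemma differentiableAt_dysonIter {Λ : ι → ℂ} {k : ι} {η : ℝ} (hη : 0 < η) {z : ℂ}
    (hΛ : ∀ i, η ≤ (Function.update Λ k z i).im) (n : ℕ) (i : ι) :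
    DifferentiableAt ℂ (fun z => dysonIter C S (Function.update Λ k z) n i) z := by
  induction n generalizing i with
  | zero => simp [dysonIter]
  | succ n ih =>
    exact differentiableAt_dysonMat_entry ih
      (dysonMat_spec hC hS hη hΛ fun i => ((dysonIter_spec hC hS hη hΛ n).1 i).le).1 i i

-- The contraction rate depends only on `η`, and the size of the first step is continuous, hence
-- bounded on the closed ball. Convergence is then uniform, and a uniform limit of holomorphic
-- functions is holomorphic.
include hC hS in
lemma differentiableOn_dysonLim {Λ : ι → ℂ} {k : ι} {η : ℝ} (hη : 0 < η) {s : ℂ} {ρ : ℝ}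
    (hΛ : ∀ z ∈ Metric.closedBall s ρ, ∀ i, η ≤ (Function.update Λ k z i).im) (i : ι) :
    DifferentiableOn ℂ (fun z => dysonLim C S (Function.update Λ k z) i) (Metric.ball s ρ) := by
  have hstep : ContinuousOn (fun z => dysonStep C S (Function.update Λ k z))
      (Metric.closedBall s ρ) := by
    refine continuousOn_finsetSum _ fun j _ => ?_
    have h1 : ContinuousOn (fun z => dysonIter C S (Function.update Λ k z) 1 j)
        (Metric.closedBall s ρ) := fun z hz =>
      (differentiableAt_dysonIter hC hS hη (hΛ z hz) 1 j).continuousAt.continuousWithinAt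
    refine ContinuousOn.div (h1.sub continuousOn_const).norm
      (Real.continuous_sqrt.comp_continuousOn (Complex.continuous_im.comp_continuousOn h1))
      fun z hz => ?_
    exact (Real.sqrt_pos.2 ((dysonIter_spec hC hS hη (hΛ z hz) 1).1 j)).ne'
  obtain ⟨K, hK⟩ := (isCompact_closedBall s ρ).exists_bound_of_continuousOn hstep
  have hθ1 := dysonRate_lt_one hS hη
  have hb := dysonBound_nonneg hS hη
  have hθ0 : 0 ≤ dysonRate S η := div_nonneg hb (by linarith)
  have hunif : TendstoUniformlyOn (fun n z => dysonIter C S (Function.update Λ k z) n i)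
      (fun z => dysonLim C S (Function.update Λ k z) i) atTop (Metric.ball s ρ) := by
    rw [Metric.tendstoUniformlyOn_iff]
    intro ε hε
    have h1 : Tendsto (fun n : ℕ => K * (1 + η⁻¹) * dysonRate S η ^ n / (1 - dysonRate S η)) atTop
        (𝓝 0) := by
      have := ((tendsto_pow_atTop_nhds_zero_of_lt_one hθ0 hθ1).const_mul
        (K * (1 + η⁻¹))).div_const (1 - dysonRate S η)
      simpa using this
    filter_upwards [h1.eventually_lt_const hε] with n hn z hz
    have hz' := Metric.ball_subset_closedBall hz
    rw [dist_comm]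
    refine (dist_le_of_le_geometric_of_tendsto _ _ hθ1 (fun n => ?_)
      (tendsto_dysonIter hC hS hη (hΛ z hz') i) n).trans_lt hn
    refine (dysonIter_dist hC hS hη (hΛ z hz') n i).trans ?_
    gcongr
    exact (le_abs_self _).trans (hK z hz')
  exact hunif.tendstoLocallyUniformlyOn.differentiableOn (Eventually.of_forall fun n z hz =>
    (differentiableAt_dysonIter hC hS hη (hΛ z (Metric.ball_subset_closedBall hz))
      n i).differentiableWithinAt) Metric.isOpen_ball

end Iteration

/-- Existence of an analytic solution of the Dyson equation. -/
theorem exists_dyson {C : Matrix ι ι ℂ} (hC : C.IsHermitian) {S : ι → ι → ℝ}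
    (hS : ∀ i j, 0 ≤ S i j) : ∃ G : (ι → ℂ) → Matrix ι ι ℂ,
      (∀ Λ ∈ DPlus ι, IsUnit (C - Matrix.diagonal (shiftDiag S Λ fun i => G Λ i i)).det ∧
        G Λ = (C - Matrix.diagonal (shiftDiag S Λ fun i => G Λ i i))⁻¹ ∧
        ∀ i, 0 < (G Λ i i).im) ∧
      ∀ Λ ∈ DPlus ι, ∀ k i j, AnalyticAt ℂ (fun z => G (Function.update Λ k z) i j) (Λ k) := by
  have hmin : ∀ Λ ∈ DPlus ι, ∃ η : ℝ, 0 < η ∧ ∀ i, η ≤ (Λ i).im := by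
    intro Λ hΛ
    rcases isEmpty_or_nonempty ι with h | h
    · exact ⟨1, one_pos, fun i => (h.false i).elim⟩
    · obtain ⟨i, hi⟩ := Finite.exists_min fun i => (Λ i).im
      exact ⟨_, hΛ i, hi⟩
  -- Only the diagonal is iterated: one more inversion recovers the whole matrix, whose diagonal is
  -- again the limit.
  refine ⟨fun Λ => dysonMat C S Λ (dysonLim C S Λ), fun Λ hΛ => ?_, fun Λ hΛ k i j => ?_⟩
  · obtain ⟨η, hη, hηΛ⟩ := hmin Λ hΛ
    obtain ⟨h1, -, -, -, h5⟩ :=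
      dysonMat_spec hC hS hη hηΛ fun i => dysonLim_im_nonneg hC hS hη hηΛ i
    have h6 : (fun i => dysonMat C S Λ (dysonLim C S Λ) i i) = dysonLim C S Λ :=
      funext fun i => dysonLim_fixed hC hS hη hηΛ i
    simp only [h6]
    exact ⟨h1, rfl, h5⟩
  · obtain ⟨η, hη, hηΛ⟩ := hmin Λ hΛ
    have hball : ∀ z ∈ Metric.closedBall (Λ k) (η / 2), ∀ i,
        η / 2 ≤ (Function.update Λ k z i).im := by
      intro z hz i
      by_cases hik : i = k
      · subst hik
        rw [Function.update_self]
        have h1 := (abs_le.1 ((Complex.abs_im_le_norm (z - Λ i)).trans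
          (mem_closedBall_iff_norm.1 hz))).1
        rw [Complex.sub_im] at h1
        linarith [hηΛ i]
      · rw [Function.update_of_ne hik]
        linarith [hηΛ i]
    have hη2 := half_pos hη
    refine DifferentiableOn.analyticAt (s := Metric.ball (Λ k) (η / 2)) (fun z hz => ?_)
      (Metric.ball_mem_nhds _ hη2)
    have hz' := Metric.ball_subset_closedBall hz
    refine (differentiableAt_dysonMat_entry (fun l => ?_) ?_ i j).differentiableWithinAt
    · exact (differentiableOn_dysonLim hC hS hη2 hball l).differentiableAt
        (Metric.isOpen_ball.mem_nhds hz)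
    · exact (dysonMat_spec hC hS hη2 (hball z hz')
        fun i => dysonLim_im_nonneg hC hS hη2 (hball z hz') i).1

end DysonExistence

/-! ### The algebra fixed by `id₄ ⊗ Δ`, and the square equivalent. -/

section BlockStructure

open scoped Matrix.Norms.L2Operator

variable {n m p : ℕ}

/-- Two indices are in the same class when `id₄ ⊗ Δ` keeps the corresponding entry. -/
def blockClass : BIdx n m p → Fin n ⊕ Fin m ⊕ Fin p
  | .inl i => .inl i
  | .inr (.inl i) => .inr (.inl i)
  | .inr (.inr (.inl k)) => .inr (.inr k)
  | .inr (.inr (.inr k)) => .inr (.inr k)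

/-- The involution exchanging the last two blocks. -/
def blockSwap : BIdx n m p ≃ BIdx n m p :=
  Equiv.sumCongr (Equiv.refl _) (Equiv.sumCongr (Equiv.refl _) (Equiv.sumComm _ _))

lemma eq_or_eq_blockSwap {a b : BIdx n m p} (h : blockClass a = blockClass b) :
    b = a ∨ b = blockSwap a := by
  rcases a with a | a | a | a <;> rcases b with b | b | b | b <;>
    simp_all [blockClass, blockSwap]

lemma idDelta_apply (M : Matrix (BIdx n m p) (BIdx n m p) ℂ) (a b : BIdx n m p) :
    idDelta M a b = if blockClass a = blockClass b then M a b else 0 := by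
  rcases a with a | a | a | a <;> rcases b with b | b | b | b <;> simp [idDelta, blockClass]

/-- Matrices fixed by `id₄ ⊗ Δ`. -/
def IsBlock (A : Matrix (BIdx n m p) (BIdx n m p) ℂ) : Prop :=
  ∀ a b, blockClass a ≠ blockClass b → A a b = 0

lemma idDelta_diag (M : Matrix (BIdx n m p) (BIdx n m p) ℂ) (a : BIdx n m p) :
    idDelta M a a = M a a := by simp [idDelta_apply]

/-- `id₄ ⊗ Δ` restricts a matrix to an equivalence relation on indices, so the matrices it fixes
form an algebra over which it is a module map, like a conditional expectation. -/
lemma IsBlock.idDelta_mul {A : Matrix (BIdx n m p) (BIdx n m p) ℂ} (hA : IsBlock A)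
    (M : Matrix (BIdx n m p) (BIdx n m p) ℂ) : idDelta (A * M) = A * idDelta M := by
  ext a b
  rw [idDelta_apply, Matrix.mul_apply, Matrix.mul_apply]
  by_cases h : blockClass a = blockClass b
  · rw [if_pos h]
    refine Finset.sum_congr rfl fun k _ => ?_
    rw [idDelta_apply]
    by_cases hk : blockClass a = blockClass k
    · rw [if_pos (hk.symm.trans h)]
    · rw [hA a k hk, zero_mul, zero_mul]
  · rw [if_neg h]
    refine (Finset.sum_eq_zero fun k _ => ?_).symm
    rw [idDelta_apply]
    by_cases hk : blockClass a = blockClass k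
    · rw [if_neg (fun h' => h (hk.trans h')), mul_zero]
    · rw [hA a k hk, zero_mul]

lemma idDelta_one : idDelta (1 : Matrix (BIdx n m p) (BIdx n m p) ℂ) = 1 := by
  ext a b
  rw [idDelta_apply]
  by_cases h : a = b
  · simp [h]
  · simp [Matrix.one_apply_ne h]

lemma idDelta_sub (M M' : Matrix (BIdx n m p) (BIdx n m p) ℂ) :
    idDelta (M - M') = idDelta M - idDelta M' := by
  ext a b
  simp only [idDelta_apply, Matrix.sub_apply]; split_ifs <;> simp

/-- Applying the module property to `A A⁻¹ = 1` shows that `id₄ ⊗ Δ` of the inverse is again the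
inverse. This is why `id₄ ⊗ Δ` can be dropped from the fixed point equation. -/
lemma IsBlock.idDelta_inv {A : Matrix (BIdx n m p) (BIdx n m p) ℂ} (hA : IsBlock A)
    (hu : IsUnit A.det) : idDelta A⁻¹ = A⁻¹ := by
  refine (Matrix.inv_eq_right_inv ?_).symm
  rw [← hA.idDelta_mul, Matrix.mul_nonsing_inv _ hu, idDelta_one]

lemma IsBlock.sub_diagonal {A : Matrix (BIdx n m p) (BIdx n m p) ℂ} (hA : IsBlock A)
    (w : BIdx n m p → ℂ) : IsBlock (A - Matrix.diagonal w) := by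
  intro a b h
  rw [Matrix.sub_apply, hA a b h, Matrix.diagonal_apply_ne _ (fun h' => h (by rw [h'])), sub_zero]

lemma idDelta_isBlock (M : Matrix (BIdx n m p) (BIdx n m p) ℂ) : IsBlock (idDelta M) :=
  fun a b h => by rw [idDelta_apply, if_neg h]

lemma IsBlock.idDelta_eq {A : Matrix (BIdx n m p) (BIdx n m p) ℂ} (hA : IsBlock A) :
    idDelta A = A := by
  ext a b
  rw [idDelta_apply]
  split_ifs with h
  · rfl
  · exact (hA a b h).symm

/-- Operator norm of a matrix fixed by `id₄ ⊗ Δ`, in terms of its entries. -/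
lemma IsBlock.norm_le {A : Matrix (BIdx n m p) (BIdx n m p) ℂ} (hA : IsBlock A) {B : ℝ}
    (hB0 : 0 ≤ B) (hB : ∀ a b, ‖A a b‖ ≤ B) : ‖A‖ ≤ 2 * B := by
  refine opnorm_le_of_vnorm (by positivity) fun x => ?_
  -- Row `a` has nonzero entries at most in the columns `a` and `blockSwap a`, so entrywise bounds
  -- control the operator norm independently of the dimension. The two columns may coincide, hence
  -- the two separate indicators below.
  have h1 : ∀ a, ‖(A *ᵥ x) a‖ ≤ B * (‖x a‖ + ‖x (blockSwap a)‖) := by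
    intro a
    have h2 : ∀ b, ‖A a b * x b‖ ≤
        (if b = a then B * ‖x b‖ else 0) + if b = blockSwap a then B * ‖x b‖ else 0 := by
      intro b
      have h0 : 0 ≤ B * ‖x b‖ := by positivity
      have hAb : ‖A a b * x b‖ ≤ B * ‖x b‖ := by
        rw [norm_mul]; exact mul_le_mul_of_nonneg_right (hB _ _) (norm_nonneg _)
      by_cases hab : blockClass a = blockClass b
      · rcases eq_or_eq_blockSwap hab with rfl | rfl
        · rw [if_pos rfl]; split_ifs <;> linarith
        · rw [if_pos (rfl : blockSwap a = blockSwap a)]; split_ifs <;> linarith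
      · rw [hA a b hab, zero_mul, norm_zero]
        split_ifs <;> linarith
    refine (norm_sum_le _ _).trans ((Finset.sum_le_sum fun b _ => h2 b).trans (le_of_eq ?_))
    rw [Finset.sum_add_distrib, Finset.sum_ite_eq', Finset.sum_ite_eq', if_pos (Finset.mem_univ _),
      if_pos (Finset.mem_univ _), mul_add]
  have h3 : vnorm (A *ᵥ x) ^ 2 ≤ (2 * B * vnorm x) ^ 2 := by
    rw [mul_pow, vnorm_sq, vnorm_sq]
    have h4 : ∑ a, ‖x (blockSwap a)‖ ^ 2 = ∑ a, ‖x a‖ ^ 2 :=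
      blockSwap.sum_comp (fun a => ‖x a‖ ^ 2)
    calc _ ≤ ∑ a, 2 * B ^ 2 * (‖x a‖ ^ 2 + ‖x (blockSwap a)‖ ^ 2) := by
          refine Finset.sum_le_sum fun a _ => ?_
          have h5 := pow_le_pow_left₀ (norm_nonneg _) (h1 a) 2
          refine h5.trans ?_
          rw [mul_pow]
          nlinarith [sq_nonneg (B * (‖x a‖ - ‖x (blockSwap a)‖))]
      _ = _ := by
          rw [← Finset.mul_sum, Finset.sum_add_distrib, h4]; ring
  exact (pow_le_pow_iff_left₀ (vnorm_nonneg _)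
    (mul_nonneg (by positivity) (vnorm_nonneg _)) two_ne_zero).1 h3

lemma cMat_isHermitian : (cMat n m p).IsHermitian := by
  ext a b
  rcases a with a | a | a | a <;> rcases b with b | b | b | b <;>
    simp [cMat, Matrix.conjTranspose_apply, Matrix.one_apply, eq_comm]

lemma cMat_isBlock : IsBlock (cMat n m p) := by
  intro a b h
  rcases a with a | a | a | a <;> rcases b with b | b | b | b <;>
    simp_all [cMat, blockClass]

lemma norm_cMat_entry_le (a b : BIdx n m p) : ‖cMat n m p a b‖ ≤ 1 := by
  rcases a with a | a | a | a <;> rcases b with b | b | b | b <;>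
    simp [cMat, Matrix.one_apply] <;> split_ifs <;> simp

/-- The variance profile `(γᵢⱼ^{(L)})² / N`. -/
def varProfile (m : ℕ) (h : ℝ[X]) (U : Matrix (Fin n) (Fin p) ℝ) (i j : BIdx n m p) : ℝ :=
  profileL m h U i j ^ 2 / bigN n m p

lemma bigN_nonneg : 0 ≤ bigN n m p := by unfold bigN; positivity

lemma varProfile_nonneg (h : ℝ[X]) (U : Matrix (Fin n) (Fin p) ℝ) (i j : BIdx n m p) :
    0 ≤ varProfile m h U i j := div_nonneg (sq_nonneg _) bigN_nonneg

lemma sub_covMap (h : ℝ[X]) (U : Matrix (Fin n) (Fin p) ℝ) (Λ : BIdx n m p → ℂ)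
    (M : Matrix (BIdx n m p) (BIdx n m p) ℂ) :
    cMat n m p - Matrix.diagonal Λ - covMap h U M
      = cMat n m p - Matrix.diagonal (shiftDiag (varProfile m h U) Λ fun i => M i i) := by
  rw [covMap, sub_sub, Matrix.diagonal_add]
  rfl

lemma imMat_diag {I : Type*} (M : Matrix I I ℂ) (i : I) : imMat M i i = ((M i i).im : ℂ) := by
  have h : M i i - star (M i i) = 2 * Complex.I * ((M i i).im : ℂ) := by
    apply Complex.ext <;> simp; ring
  rw [imMat, Matrix.smul_apply, Matrix.sub_apply, Matrix.conjTranspose_apply, h, smul_eq_mul,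
    one_div, inv_mul_cancel_left₀ (by simp)]

/-- A square equivalent is the solution of the Dyson equation. -/
lemma IsSquareEquivalent.spec {h : ℝ[X]} {U : Matrix (Fin n) (Fin p) ℝ}
    {G : (BIdx n m p → ℂ) → Matrix (BIdx n m p) (BIdx n m p) ℂ} (hG : IsSquareEquivalent h U G)
    {Λ : BIdx n m p → ℂ} (hΛ : Λ ∈ DPlus (BIdx n m p)) :
    (cMat n m p - Matrix.diagonal (shiftDiag (varProfile m h U) Λ fun i => G Λ i i)) * G Λ = 1 ∧
    G Λ * (cMat n m p - Matrix.diagonal (shiftDiag (varProfile m h U) Λ fun i => G Λ i i)) = 1 ∧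
    ∀ i, 0 < (G Λ i i).im := by
  have him : ∀ i, 0 < (G Λ i i).im := by
    intro i
    have := (hG.im_posDef Λ hΛ).diag_pos (i := i)
    rw [imMat_diag] at this
    exact_mod_cast this
  have hu : IsUnit (cMat n m p -
      Matrix.diagonal (shiftDiag (varProfile m h U) Λ fun i => G Λ i i)).det := by
    refine isUnit_det_sub_diagonal cMat_isHermitian fun i => ?_
    rw [im_shiftDiag]
    have := sum_mul_im_nonneg (varProfile_nonneg h U) (fun i => (him i).le) i
    linarith [hΛ i]
  have hf := hG.fixed_point Λ hΛ
  rw [sub_covMap, (cMat_isBlock.sub_diagonal _).idDelta_inv hu] at hf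
  have h1 := Matrix.mul_nonsing_inv _ hu
  have h2 := Matrix.nonsing_inv_mul _ hu
  rw [← hf] at h1 h2
  exact ⟨h1, h2, him⟩

lemma imMat_inv_posDef {ι : Type*} [Fintype ι] [DecidableEq ι] {T : Matrix ι ι ℂ}
    (hT : T.IsHermitian) {w : ι → ℂ} (hw : ∀ i, 0 < (w i).im) :
    (imMat (T - Matrix.diagonal w)⁻¹).PosDef := by
  have hu := isUnit_det_sub_diagonal hT hw
  set M := (T - Matrix.diagonal w)⁻¹ with hM
  have h1 : M * (T - Matrix.diagonal w - 0) = 1 := by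
    rw [sub_zero]; exact Matrix.nonsing_inv_mul _ hu
  have h2 : imMat M = M * Matrix.diagonal (fun i => ((w i).im : ℂ)) * Mᴴ := by
    rw [imMat, inv_sub_conjTranspose hT h1, Matrix.conjTranspose_zero, sub_zero, add_zero,
      ← Matrix.smul_mul, ← Matrix.mul_smul]
    congr 2
    rw [← Matrix.diagonal_smul]
    congr 1
    ext i
    simp only [Pi.smul_apply, smul_eq_mul, one_div]
    rw [inv_mul_cancel_left₀ (by simp)]
  rw [h2]
  refine (Matrix.PosDef.diagonal fun i => by exact_mod_cast hw i).mul_mul_conjTranspose_same ?_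
  refine Matrix.vecMul_injective_iff_isUnit.2 ?_
  exact (Matrix.isUnit_iff_isUnit_det _).2 (Matrix.isUnit_nonsing_inv_det _ hu)

/-- Existence and uniqueness of the square equivalent. -/
theorem exists_squareEquivalent (m : ℕ) (h : ℝ[X]) (U : Matrix (Fin n) (Fin p) ℝ) :
    ∃ G : (BIdx n m p → ℂ) → Matrix (BIdx n m p) (BIdx n m p) ℂ,
      IsSquareEquivalent h U G ∧
        ∀ G', IsSquareEquivalent h U G' → Set.EqOn G' G (DPlus (BIdx n m p)) := by
  obtain ⟨G, hG, hGa⟩ := exists_dyson (cMat_isHermitian (n := n) (m := m) (p := p))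
    (varProfile_nonneg h U)
  have hw : ∀ Λ ∈ DPlus (BIdx n m p), ∀ i,
      0 < (shiftDiag (varProfile m h U) Λ (fun i => G Λ i i) i).im := by
    intro Λ hΛ i
    rw [im_shiftDiag]
    have := sum_mul_im_nonneg (varProfile_nonneg h U) (fun i => ((hG Λ hΛ).2.2 i).le) i
    linarith [hΛ i]
  have hsq : IsSquareEquivalent h U G := by
    refine ⟨fun Λ hΛ => ?_, fun Λ hΛ => ?_, hGa⟩
    · obtain ⟨h1, h2, -⟩ := hG Λ hΛ
      rw [sub_covMap, (cMat_isBlock.sub_diagonal _).idDelta_inv h1]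
      exact h2
    · rw [(hG Λ hΛ).2.1]
      exact imMat_inv_posDef cMat_isHermitian (hw Λ hΛ)
  refine ⟨G, hsq, fun G' hG' Λ hΛ => ?_⟩
  obtain ⟨-, h2, h3⟩ := hG'.spec hΛ
  obtain ⟨h4, -, h5⟩ := hsq.spec hΛ
  exact dyson_unique cMat_isHermitian (varProfile_nonneg h U) hΛ h2 h4
    (fun i => (h3 i).le) fun i => (h5 i).le

end BlockStructure

/-! ### Operator norm of symmetric Gaussian matrices with a variance profile. -/

section GaussianMatrix

open scoped Matrix.Norms.L2Operator

variable {ι E : Type*} [Fintype ι] [DecidableEq ι] [Fintype E]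

/-- The symmetric matrix through which the Gaussian variable `e` enters. -/
def coefMat (a b : E → ι) (s : E → ℝ) (e : E) : Matrix ι ι ℂ :=
  (s e : ℂ) • (Matrix.single (a e) (b e) 1 + Matrix.single (b e) (a e) 1)

/-- The Gaussian symmetric matrix `∑ₑ gₑ sₑ (E_{a(e) b(e)} + E_{b(e) a(e)})`. -/
def gaussMat (a b : E → ι) (s : E → ℝ) (g : E → ℝ) : Matrix ι ι ℂ :=
  ∑ e, (g e : ℂ) • coefMat a b s e

/-- The variance profile of `gaussMat`. -/
def gaussVar (a b : E → ι) (s : E → ℝ) (i j : ι) : ℝ :=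
  ∑ e, s e ^ 2 * ((if a e = i ∧ b e = j then 1 else 0) + if b e = i ∧ a e = j then 1 else 0)

variable (a b : E → ι) (s : E → ℝ)

/-- Exchanges sums over Gaussian variables with sums over matrix positions; each variable occupies
both `(a e, b e)` and `(b e, a e)`. It serves real variance estimates and the complex covariance map
alike. -/
lemma sum_gaussVar_mul {R : Type*} [CommRing R] [Algebra ℝ R] (f : ι → ι → R) :
    ∑ i, ∑ j, algebraMap ℝ R (gaussVar a b s i j) * f i j
      = ∑ e, algebraMap ℝ R (s e ^ 2) * (f (a e) (b e) + f (b e) (a e)) := by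
  simp only [gaussVar, map_sum, map_mul, map_add, Finset.sum_mul]
  have h1 : ∀ i : ι, ∑ j : ι, ∑ e : E, algebraMap ℝ R (s e ^ 2) *
      (algebraMap ℝ R (if a e = i ∧ b e = j then 1 else 0)
        + algebraMap ℝ R (if b e = i ∧ a e = j then 1 else 0)) * f i j
      = ∑ e : E, ∑ j : ι, algebraMap ℝ R (s e ^ 2) *
      (algebraMap ℝ R (if a e = i ∧ b e = j then 1 else 0)
        + algebraMap ℝ R (if b e = i ∧ a e = j then 1 else 0)) * f i j :=
    fun i => Finset.sum_comm
  simp only [h1]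
  rw [Finset.sum_comm]
  refine Finset.sum_congr rfl fun e _ => ?_
  simp only [mul_assoc, ← Finset.mul_sum]
  congr 1
  simp only [add_mul, Finset.sum_add_distrib]
  have h2 : ∀ u v : ι, ∑ i, ∑ j, algebraMap ℝ R (if u = i ∧ v = j then 1 else 0) * f i j
      = f u v := by
    intro u v
    rw [Finset.sum_eq_single u, Finset.sum_eq_single v]
    · simp
    · intro j _ hj; simp [hj.symm]
    · simp
    · intro i _ hi; simp [hi.symm]
    · simp
  rw [h2, h2]

lemma sum_gaussVar_mul_real (f : ι → ι → ℝ) :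
    ∑ i, ∑ j, gaussVar a b s i j * f i j
      = ∑ e, s e ^ 2 * (f (a e) (b e) + f (b e) (a e)) := sum_gaussVar_mul a b s f

omit [Fintype ι] [Fintype E] in
lemma coefMat_isHermitian (e : E) : (coefMat a b s e).IsHermitian := by
  rw [Matrix.IsHermitian, coefMat, Matrix.conjTranspose_smul, Matrix.conjTranspose_add,
    Matrix.conjTranspose_single, Matrix.conjTranspose_single, star_one, add_comm]
  congr 1
  simp

omit [Fintype ι] in
lemma gaussMat_isHermitian (g : E → ℝ) : (gaussMat a b s g).IsHermitian := by
  rw [Matrix.IsHermitian, gaussMat, Matrix.conjTranspose_sum]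
  refine Finset.sum_congr rfl fun e _ => ?_
  rw [Matrix.conjTranspose_smul, (coefMat_isHermitian a b s e).eq]
  simp

omit [Fintype ι] in
lemma continuous_gaussMat : Continuous (gaussMat a b s) := by
  unfold gaussMat
  refine continuous_finsetSum _ fun e _ => ?_
  exact (Complex.continuous_ofReal.comp (continuous_apply e)).smul continuous_const

/-- The quadratic form of the Gaussian matrix. -/
def gaussForm (g : E → ℝ) (x : ι → ℂ) : ℝ := (star x ⬝ᵥ (gaussMat a b s g *ᵥ x)).re

omit [Fintype E] in
lemma star_dotProduct_coefMat_mulVec (e : E) (x : ι → ℂ) :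
    star x ⬝ᵥ (coefMat a b s e *ᵥ x) = ((2 * s e * (star (x (a e)) * x (b e)).re : ℝ) : ℂ) := by
  have h1 : ∀ u v : ι, star x ⬝ᵥ (Matrix.single u v (1 : ℂ) *ᵥ x) = star (x u) * x v := by
    intro u v
    simp only [dotProduct]
    rw [Finset.sum_eq_single u]
    · simp [Matrix.single_mulVec]
    · intro i _ hi; simp [Matrix.single_mulVec, Function.update_of_ne hi]
    · simp
  rw [coefMat, Matrix.smul_mulVec, Matrix.add_mulVec, dotProduct_smul, dotProduct_add, h1, h1]
  apply Complex.ext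
  · simp; ring
  · simp; right; ring

lemma gaussForm_eq (g : E → ℝ) (x : ι → ℂ) :
    gaussForm a b s g x = ∑ e, (2 * s e * (star (x (a e)) * x (b e)).re) * g e := by
  rw [gaussForm, gaussMat, Matrix.sum_mulVec, dotProduct_sum, Complex.re_sum]
  refine Finset.sum_congr rfl fun e _ => ?_
  rw [Matrix.smul_mulVec, dotProduct_smul, star_dotProduct_coefMat_mulVec, smul_eq_mul,
    ← Complex.ofReal_mul, Complex.ofReal_re, mul_comm]

/-- The left side is the variance of the quadratic form at `x`; it depends on the profile only
through its maximum. -/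
lemma sum_sq_form_le {σ : ℝ} (hσ : ∀ i j, gaussVar a b s i j ≤ σ) (x : ι → ℂ) :
    ∑ e, (2 * s e * (star (x (a e)) * x (b e)).re) ^ 2 ≤ 4 * σ * (∑ i, ‖x i‖ ^ 2) ^ 2 := by
  have h1 : ∀ e, (2 * s e * (star (x (a e)) * x (b e)).re) ^ 2
      ≤ 4 * (s e ^ 2 * (‖x (a e)‖ ^ 2 * ‖x (b e)‖ ^ 2 + ‖x (b e)‖ ^ 2 * ‖x (a e)‖ ^ 2)) := by
    intro e
    have h2 : (star (x (a e)) * x (b e)).re ^ 2 ≤ ‖x (a e)‖ ^ 2 * ‖x (b e)‖ ^ 2 := by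
      rw [← mul_pow, ← norm_star (x (a e)), ← norm_mul, ← sq_abs (Complex.re _)]
      exact pow_le_pow_left₀ (abs_nonneg _) (Complex.abs_re_le_norm _) 2
    have h3 : 0 ≤ ‖x (a e)‖ ^ 2 * ‖x (b e)‖ ^ 2 := by positivity
    rw [mul_pow, mul_pow]
    nlinarith [mul_le_mul_of_nonneg_left h2 (sq_nonneg (s e)), mul_nonneg (sq_nonneg (s e)) h3]
  calc _ ≤ ∑ e, 4 * (s e ^ 2 * (‖x (a e)‖ ^ 2 * ‖x (b e)‖ ^ 2 + ‖x (b e)‖ ^ 2 * ‖x (a e)‖ ^ 2)) :=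
        Finset.sum_le_sum fun e _ => h1 e
    _ = 4 * ∑ i, ∑ j, gaussVar a b s i j * (‖x i‖ ^ 2 * ‖x j‖ ^ 2) := by
        rw [← Finset.mul_sum, sum_gaussVar_mul_real]
    _ ≤ 4 * ∑ i, ∑ j, σ * (‖x i‖ ^ 2 * ‖x j‖ ^ 2) := by
        gcongr with i _ j _
        exact hσ i j
    _ = _ := by
        simp only [← Finset.mul_sum]
        rw [← Finset.sum_mul]; ring

/-- A Hermitian matrix has a unit vector on which the quadratic form attains the norm. -/
lemma exists_unit_form_eq [Nonempty ι] {H : Matrix ι ι ℂ} (hH : H.IsHermitian) :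
    ∃ v : ι → ℂ, vnorm v = 1 ∧ |(star v ⬝ᵥ (H *ᵥ v)).re| = ‖H‖ := by
  have hsa : IsSelfAdjoint H := hH
  obtain ⟨μ, hμ, hμn⟩ := spectrum.exists_nnnorm_eq_spectralRadius H
  rw [hsa.spectralRadius_eq_nnnorm, ENNReal.coe_inj] at hμn
  have hμn' : ‖μ‖ = ‖H‖ := congrArg NNReal.toReal hμn
  have hμre : μ = (μ.re : ℂ) := hsa.mem_spectrum_eq_re hμ
  rw [spectrum.mem_iff, ← Matrix.mulVec_injective_iff_isUnit] at hμ
  obtain ⟨x, y, hxy, hne⟩ : ∃ x y, (algebraMap ℂ (Matrix ι ι ℂ) μ - H) *ᵥ x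
      = (algebraMap ℂ (Matrix ι ι ℂ) μ - H) *ᵥ y ∧ x ≠ y := by
    simpa [Function.Injective] using hμ
  set w := x - y with hw
  have hw0 : w ≠ 0 := sub_ne_zero.2 hne
  have hHw : H *ᵥ w = μ • w := by
    have h1 : (algebraMap ℂ (Matrix ι ι ℂ) μ - H) *ᵥ w = 0 := by
      rw [hw, Matrix.mulVec_sub, hxy, sub_self]
    rw [Matrix.sub_mulVec, sub_eq_zero] at h1
    rw [← h1, Algebra.algebraMap_eq_smul_one, Matrix.smul_mulVec, Matrix.one_mulVec]
  have hc : 0 < vnorm w := lt_of_le_of_ne (vnorm_nonneg _) (Ne.symm (mt vnorm_eq_zero.1 hw0))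
  have hww : star w ⬝ᵥ w = ((vnorm w ^ 2 : ℝ) : ℂ) := by
    rw [vnorm_sq, Complex.ofReal_sum, dotProduct]
    refine Finset.sum_congr rfl fun i _ => ?_
    have := Complex.conj_mul' (w i)
    rw [Pi.star_apply, ← starRingEnd_apply, this]; push_cast; rfl
  refine ⟨((vnorm w)⁻¹ : ℂ) • w, ?_, ?_⟩
  · rw [vnorm_eq, WithLp.toLp_smul, norm_smul, ← vnorm_eq, ← Complex.ofReal_inv,
      Complex.norm_real, Real.norm_of_nonneg (by positivity), inv_mul_cancel₀ hc.ne']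
  · have hc' : ((vnorm w : ℝ) : ℂ) ≠ 0 := by exact_mod_cast hc.ne'
    have h2 : star ((vnorm w : ℂ)⁻¹ • w) ⬝ᵥ (H *ᵥ ((vnorm w : ℂ)⁻¹ • w)) = (μ.re : ℂ) := by
      rw [Matrix.mulVec_smul, hHw, star_smul, smul_dotProduct, dotProduct_smul, dotProduct_smul,
        hww, ← Complex.ofReal_inv]
      have h3 : star (((vnorm w)⁻¹ : ℝ) : ℂ) = (((vnorm w)⁻¹ : ℝ) : ℂ) := Complex.conj_ofReal _
      rw [h3]
      simp only [smul_eq_mul]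
      rw [hμre, Complex.ofReal_re]
      push_cast
      field_simp
    rw [h2, Complex.ofReal_re, ← hμn', hμre, Complex.norm_real, Complex.ofReal_re, Real.norm_eq_abs]

lemma form_sub_form_le {H : Matrix ι ι ℂ} (x v : ι → ℂ) :
    |(star x ⬝ᵥ (H *ᵥ x)).re - (star v ⬝ᵥ (H *ᵥ v)).re|
      ≤ ‖H‖ * (vnorm (x - v) * (vnorm x + vnorm v)) := by
  have h1 : star x ⬝ᵥ (H *ᵥ x) - star v ⬝ᵥ (H *ᵥ v)
      = star x ⬝ᵥ (H *ᵥ (x - v)) + star (x - v) ⬝ᵥ (H *ᵥ v) := by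
    rw [Matrix.mulVec_sub, dotProduct_sub, star_sub, sub_dotProduct]; ring
  have h2 : ∀ y z : ι → ℂ, ‖star y ⬝ᵥ (H *ᵥ z)‖ ≤ ‖H‖ * (vnorm y * vnorm z) := by
    intro y z
    have := norm_bilin_le H (fun i => star (y i)) z
    rwa [vnorm_star] at this
  rw [← Complex.sub_re, h1]
  refine (Complex.abs_re_le_norm _).trans ((norm_add_le _ _).trans ?_)
  have h3 := h2 x (x - v)
  have h4 := h2 (x - v) v
  linarith

lemma lintegral_exp_gaussForm_le {σ : ℝ} (hσ : ∀ i j, gaussVar a b s i j ≤ σ) (t : ℝ)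
    (x : ι → ℂ) : ∫⁻ g, ENNReal.ofReal (Real.exp (t * gaussForm a b s g x)) ∂(stdG E)
      ≤ ENNReal.ofReal (Real.exp (2 * t ^ 2 * σ * vnorm x ^ 4)) := by
  have h1 : ∀ g : E → ℝ, t * gaussForm a b s g x
      = ∑ e, (t * (2 * s e * (star (x (a e)) * x (b e)).re)) * g e := by
    intro g
    rw [gaussForm_eq, Finset.mul_sum]
    exact Finset.sum_congr rfl fun e _ => by ring
  simp only [h1]
  rw [lintegral_exp_linear_stdG]
  apply ENNReal.ofReal_le_ofReal
  apply Real.exp_le_exp.2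
  have h2 := sum_sq_form_le a b s hσ x
  have h3 : ∑ e, (t * (2 * s e * (star (x (a e)) * x (b e)).re)) ^ 2
      = t ^ 2 * ∑ e, (2 * s e * (star (x (a e)) * x (b e)).re) ^ 2 := by
    rw [Finset.mul_sum]; exact Finset.sum_congr rfl fun e _ => by ring
  have h4 : vnorm x ^ 4 = (∑ i, ‖x i‖ ^ 2) ^ 2 := by rw [← vnorm_sq]; ring
  rw [h3, h4]
  nlinarith [mul_le_mul_of_nonneg_left h2 (sq_nonneg t)]

/-- Exponential moment of the operator norm of a Gaussian matrix. -/
lemma lintegral_exp_norm_gaussMat_le [Nonempty ι] {σ : ℝ} (hσ0 : 0 ≤ σ)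
    (hσ : ∀ i j, gaussVar a b s i j ≤ σ) {t : ℝ} (ht : 0 ≤ t) :
    ∫⁻ g, ENNReal.ofReal (Real.exp (t * ‖gaussMat a b s g‖ / 2)) ∂(stdG E)
      ≤ ENNReal.ofReal (2 * 256 ^ Fintype.card ι * Real.exp (32 * t ^ 2 * σ)) := by
  -- A volume average replaces an `ε`-net. If `v` is a unit vector attaining the norm, then on the
  -- ball of radius `1/8` around `v` the form is still at least half the norm in absolute value,
  -- since `1/8 · (9/8 + 1) ≤ 1/2`. That ball lies in the fixed ball of radius 2, over which the
  -- expectation can be taken pointwise in `x`. `F` adds both signs because the sign of the form at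
  -- `v` is unknown.
  let μ : Measure (EuclideanSpace ℂ ι) := volume
  have hfin : Module.finrank ℝ (EuclideanSpace ℂ ι) = 2 * Fintype.card ι := by
    rw [finrank_real_of_complex, finrank_euclideanSpace]
  have hnt : Nontrivial (EuclideanSpace ℂ ι) := by
    rw [← Module.finrank_pos_iff (R := ℂ), finrank_euclideanSpace]
    exact Fintype.card_pos
  set F : (E → ℝ) → EuclideanSpace ℂ ι → ENNReal := fun g x =>
    ENNReal.ofReal (Real.exp (t * gaussForm a b s g x.ofLp))
      + ENNReal.ofReal (Real.exp (-t * gaussForm a b s g x.ofLp)) with hF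
  have hFm : Measurable (Function.uncurry F) := by
    have hc : Continuous fun z : (E → ℝ) × EuclideanSpace ℂ ι => gaussForm a b s z.1 z.2.ofLp := by
      simp only [gaussForm_eq]
      have h0 : ∀ i, Continuous fun z : (E → ℝ) × EuclideanSpace ℂ ι => z.2.ofLp i := fun i => by fun_prop
      refine continuous_finsetSum _ fun e _ => ?_
      have h1 := h0 (a e)
      have h2 := h0 (b e)
      have h3 : Continuous fun z : (E → ℝ) × EuclideanSpace ℂ ι => (star (z.2.ofLp (a e)) * z.2.ofLp (b e)).re :=
        Complex.continuous_re.comp (h1.star.mul h2)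
      fun_prop
    have := hc.measurable
    simp only [hF, Function.uncurry_def]
    fun_prop
  -- lower bound for a fixed matrix
  have hlow : ∀ g, μ (Metric.ball 0 (1 / 8)) *
      ENNReal.ofReal (Real.exp (t * ‖gaussMat a b s g‖ / 2))
        ≤ ∫⁻ x in Metric.ball 0 2, F g x ∂μ := by
    intro g
    obtain ⟨v, hv1, hv2⟩ := exists_unit_form_eq (gaussMat_isHermitian a b s g)
    have hsub : Metric.ball (WithLp.toLp 2 v : EuclideanSpace ℂ ι) (1 / 8) ⊆ Metric.ball 0 2 := by
      apply Metric.ball_subset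
      rw [dist_zero_right, ← vnorm_eq, hv1]; norm_num
    calc _ = ∫⁻ _ in Metric.ball (WithLp.toLp 2 v : EuclideanSpace ℂ ι) (1 / 8),
          ENNReal.ofReal (Real.exp (t * ‖gaussMat a b s g‖ / 2)) ∂μ := by
          rw [setLIntegral_const, mul_comm, Measure.addHaar_ball_center μ (WithLp.toLp 2 v)]
      _ ≤ ∫⁻ x in Metric.ball (WithLp.toLp 2 v : EuclideanSpace ℂ ι) (1 / 8), F g x ∂μ := by
          refine setLIntegral_mono' measurableSet_ball fun x hx => ?_
          have hxv : vnorm (x.ofLp - v) < 1 / 8 := by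
            rw [mem_ball_iff_norm] at hx
            rw [vnorm_eq]; exact hx
          have hx2 : vnorm x.ofLp ≤ 9 / 8 := by
            have := vnorm_add_le (x.ofLp - v) v
            rw [sub_add_cancel, hv1] at this
            linarith
          have h1 := form_sub_form_le (H := gaussMat a b s g) x.ofLp v
          have h2 : vnorm (x.ofLp - v) * (vnorm x.ofLp + vnorm v) ≤ 1 / 2 := by
            rw [hv1]
            have := vnorm_nonneg (x.ofLp - v)
            have := vnorm_nonneg x.ofLp
            nlinarith
          have h3 := h1.trans (mul_le_mul_of_nonneg_left h2 (norm_nonneg _))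
          have h4 : ‖gaussMat a b s g‖ / 2 ≤ |gaussForm a b s g x.ofLp| := by
            have h5 := abs_sub_abs_le_abs_sub (star v ⬝ᵥ (gaussMat a b s g *ᵥ v)).re
              (star x.ofLp ⬝ᵥ (gaussMat a b s g *ᵥ x.ofLp)).re
            rw [abs_sub_comm, hv2] at h5
            unfold gaussForm
            linarith
          have h6 : t * ‖gaussMat a b s g‖ / 2 ≤ t * |gaussForm a b s g x.ofLp| := by
            rw [mul_div_assoc]; exact mul_le_mul_of_nonneg_left h4 ht
          simp only [hF]
          rcases abs_choice (gaussForm a b s g x.ofLp) with h7 | h7 <;> rw [h7] at h6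
          · exact le_add_right (ENNReal.ofReal_le_ofReal (Real.exp_le_exp.2 h6))
          · exact le_add_left (ENNReal.ofReal_le_ofReal (Real.exp_le_exp.2 (by linarith)))
      _ ≤ _ := lintegral_mono_set hsub
  -- upper bound for the average
  have hup : ∫⁻ g, ∫⁻ x in Metric.ball 0 2, F g x ∂μ ∂(stdG E)
      ≤ ENNReal.ofReal (2 * Real.exp (32 * t ^ 2 * σ)) * μ (Metric.ball 0 2) := by
    rw [lintegral_lintegral_swap hFm.aemeasurable, ← setLIntegral_const]
    refine setLIntegral_mono' measurableSet_ball fun x hx => ?_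
    have hx2 : vnorm x.ofLp ≤ 2 := by
      rw [mem_ball_zero_iff] at hx
      rw [vnorm_eq]; exact hx.le
    have h1 : ∀ t' : ℝ, t' ^ 2 = t ^ 2 → ∫⁻ g, ENNReal.ofReal
        (Real.exp (t' * gaussForm a b s g x.ofLp)) ∂(stdG E)
          ≤ ENNReal.ofReal (Real.exp (32 * t ^ 2 * σ)) := by
      intro t' ht'
      refine (lintegral_exp_gaussForm_le a b s hσ t' x.ofLp).trans
        (ENNReal.ofReal_le_ofReal (Real.exp_le_exp.2 ?_))
      rw [ht']
      have h2 : vnorm x.ofLp ^ 4 ≤ 2 ^ 4 := pow_le_pow_left₀ (vnorm_nonneg _) hx2 4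
      nlinarith [mul_le_mul_of_nonneg_left h2 (mul_nonneg (sq_nonneg t) hσ0)]
    simp only [hF]
    rw [lintegral_add_left (by
      have : Continuous fun g => gaussForm a b s g x.ofLp := by
        simp only [gaussForm_eq]; fun_prop
      have := this.measurable
      fun_prop)]
    rw [two_mul, ENNReal.ofReal_add (Real.exp_pos _).le (Real.exp_pos _).le]
    exact add_le_add (h1 t rfl) (h1 (-t) (neg_sq t))
  -- The radii have ratio 16 and the real dimension is `2 · card ι`, whence `16² = 256` per index.
  have hvol : μ (Metric.ball 0 2) = ENNReal.ofReal (256 ^ Fintype.card ι) *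
      μ (Metric.ball 0 (1 / 8)) := by
    rw [Measure.addHaar_ball μ 0 (by norm_num : (0 : ℝ) ≤ 2),
      Measure.addHaar_ball μ 0 (by norm_num : (0 : ℝ) ≤ 1 / 8), ← mul_assoc,
      ← ENNReal.ofReal_mul (by positivity), hfin, pow_mul, pow_mul, ← mul_pow]
    norm_num
  have hpos : μ (Metric.ball 0 (1 / 8)) ≠ 0 := (Metric.measure_ball_pos μ 0 (by norm_num)).ne'
  have hne : μ (Metric.ball 0 (1 / 8)) ≠ ⊤ := measure_ball_lt_top.ne
  have hmain : μ (Metric.ball 0 (1 / 8)) *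
      ∫⁻ g, ENNReal.ofReal (Real.exp (t * ‖gaussMat a b s g‖ / 2)) ∂(stdG E)
        ≤ μ (Metric.ball 0 (1 / 8)) *
          ENNReal.ofReal (2 * 256 ^ Fintype.card ι * Real.exp (32 * t ^ 2 * σ)) := by
    rw [← lintegral_const_mul' _ _ hne]
    refine (lintegral_mono hlow).trans (hup.trans (le_of_eq ?_))
    rw [hvol, ← mul_assoc, ← ENNReal.ofReal_mul (by positivity), mul_comm]
    congr 2; ring
  exact (ENNReal.mul_le_mul_iff_right hpos hne).1 hmain

/-- Tail bound for the operator norm of a Gaussian matrix. -/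
theorem measure_norm_gaussMat_ge_le {σ : ℝ} (hσ0 : 0 ≤ σ)
    (hσ : ∀ i j, gaussVar a b s i j ≤ σ / Fintype.card ι) :
    stdG E {g | 2 * (32 * σ + 7) ≤ ‖gaussMat a b s g‖}
      ≤ ENNReal.ofReal (2 * Real.exp (-(Fintype.card ι : ℝ))) := by
  rcases isEmpty_or_nonempty ι with hι | hι
  · have : ∀ g, ‖gaussMat a b s g‖ = 0 := fun g => by
      rw [norm_eq_zero]; exact Subsingleton.elim _ _
    have h1 : {g | 2 * (32 * σ + 7) ≤ ‖gaussMat a b s g‖} = ∅ := by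
      ext g; simp only [this, Set.mem_ofPred_eq, Set.mem_empty_iff_false, iff_false]; linarith
    rw [h1, measure_empty]; exact zero_le
  set N : ℝ := (Fintype.card ι : ℝ) with hN
  have hNp : 0 < N := by rw [hN]; exact_mod_cast Fintype.card_pos
  have h1 := lintegral_exp_norm_gaussMat_le a b s (div_nonneg hσ0 hNp.le) hσ hNp.le
  have hcont : Continuous fun g => Real.exp (N * ‖gaussMat a b s g‖ / 2) :=
    Real.continuous_exp.comp (((continuous_gaussMat a b s).norm.const_mul N).div_const 2)
  have h2 := mul_meas_ge_le_lintegral (μ := stdG E)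
    (f := fun g => ENNReal.ofReal (Real.exp (N * ‖gaussMat a b s g‖ / 2)))
    (ENNReal.measurable_ofReal.comp hcont.measurable)
    (ENNReal.ofReal (Real.exp (N * (32 * σ + 7))))
  have h3 : {g | 2 * (32 * σ + 7) ≤ ‖gaussMat a b s g‖}
      ⊆ {g | ENNReal.ofReal (Real.exp (N * (32 * σ + 7)))
        ≤ ENNReal.ofReal (Real.exp (N * ‖gaussMat a b s g‖ / 2))} := by
    intro g hg
    refine ENNReal.ofReal_le_ofReal (Real.exp_le_exp.2 ?_)
    have : (2 * (32 * σ + 7) : ℝ) ≤ ‖gaussMat a b s g‖ := hg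
    nlinarith
  have h4 : ENNReal.ofReal (Real.exp (N * (32 * σ + 7))) ≠ 0 := by
    simpa using Real.exp_pos _
  rw [← ENNReal.mul_le_mul_iff_right h4 ENNReal.ofReal_ne_top,
    ← ENNReal.ofReal_mul (Real.exp_pos _).le]
  refine (mul_le_mul_right (measure_mono h3) _).trans (h2.trans (h1.trans ?_))
  apply ENNReal.ofReal_le_ofReal
  -- Markov's inequality is used with `t = N`. The threshold constant is `7 = 6 + 1`: `256 ≤ e⁶`
  -- absorbs the volume ratio, and the extra 1 leaves the factor `e^{-N}`.
  have h5 : (256 : ℝ) ^ Fintype.card ι ≤ Real.exp (6 * N) := by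
    have h6 : (256 : ℝ) ≤ Real.exp 6 := by
      have h7 : Real.exp 6 = Real.exp 1 ^ 6 := by rw [← Real.exp_nat_mul]; norm_num
      rw [h7]
      have := Real.exp_one_gt_d9
      calc (256 : ℝ) ≤ 2.7 ^ 6 := by norm_num
        _ ≤ _ := by gcongr; linarith
    calc (256 : ℝ) ^ Fintype.card ι ≤ Real.exp 6 ^ Fintype.card ι := by gcongr
      _ = _ := by rw [← Real.exp_nat_mul, hN, mul_comm]
  have h6 : 32 * N ^ 2 * (σ / N) = 32 * N * σ := by field_simp
  rw [h6]
  calc 2 * 256 ^ Fintype.card ι * Real.exp (32 * N * σ)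
      ≤ 2 * Real.exp (6 * N) * Real.exp (32 * N * σ) := by gcongr
    _ = Real.exp (N * (32 * σ + 7)) * (2 * Real.exp (-N)) := by
        have : Real.exp (N * (32 * σ + 7)) * (2 * Real.exp (-N))
            = 2 * (Real.exp (N * (32 * σ + 7)) * Real.exp (-N)) := by ring
        rw [this, ← Real.exp_add, mul_assoc, ← Real.exp_add]
        congr 2; ring
    _ ≤ _ := le_rfl

end GaussianMatrix

/-! ### Concentration of the resolvent. -/

section GaussianResolvent

open scoped Matrix.Norms.L2Operator

variable {ι E : Type*} [Fintype ι] [DecidableEq ι] [Fintype E]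

/-- The resolvent of `C + gaussMat`. -/
def gaussRes (C : Matrix ι ι ℂ) (a b : E → ι) (s : E → ℝ) (Λ : ι → ℂ) (g : E → ℝ) :
    Matrix ι ι ℂ := (C + gaussMat a b s g - Matrix.diagonal Λ)⁻¹

variable {C : Matrix ι ι ℂ} {a b : E → ι} {s : E → ℝ} {Λ : ι → ℂ} {η : ℝ}

lemma gaussRes_spec (hC : C.IsHermitian) (hη : 0 < η) (hΛ : ∀ i, η ≤ (Λ i).im) (g : E → ℝ) :
    IsUnit (C + gaussMat a b s g - Matrix.diagonal Λ).det ∧ ‖gaussRes C a b s Λ g‖ ≤ η⁻¹ :=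
  inv_sub_diagonal (hC.add (gaussMat_isHermitian a b s g)) hη hΛ

lemma gaussRes_im_nonneg (hC : C.IsHermitian) (hη : 0 < η) (hΛ : ∀ i, η ≤ (Λ i).im) (g : E → ℝ)
    (i : ι) : 0 ≤ (gaussRes C a b s Λ g i i).im := by
  have h := im_inv_col (hC.add (gaussMat_isHermitian a b s g))
    (Matrix.mul_nonsing_inv _ (gaussRes_spec hC hη hΛ g).1) i
  refine le_of_le_of_eq ?_ h.symm
  exact Finset.sum_nonneg fun k _ => mul_nonneg (hη.le.trans (hΛ k)) (by positivity)

/-- The derivative of `gaussMat`. -/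
def gaussMatDeriv (a b : E → ι) (s : E → ℝ) : (E → ℝ) →L[ℝ] Matrix ι ι ℂ :=
  ∑ e, (ContinuousLinearMap.proj (R := ℝ) (φ := fun _ : E => ℝ) e).smulRight (coefMat a b s e)

omit [Fintype ι] in
lemma gaussMatDeriv_apply (g : E → ℝ) : gaussMatDeriv a b s g = gaussMat a b s g := by
  rw [gaussMatDeriv, sum_apply, gaussMat]
  refine Finset.sum_congr rfl fun e _ => ?_
  simp only [ContinuousLinearMap.smulRight_apply, ContinuousLinearMap.proj_apply]
  rfl

lemma hasFDerivAt_gaussRes (hC : C.IsHermitian) (hη : 0 < η) (hΛ : ∀ i, η ≤ (Λ i).im)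
    (g : E → ℝ) : HasFDerivAt (gaussRes C a b s Λ)
      (-(ContinuousLinearMap.mulLeftRight ℝ (Matrix ι ι ℂ) (gaussRes C a b s Λ g)
        (gaussRes C a b s Λ g)).comp (gaussMatDeriv a b s)) g := by
  have hu := (gaussRes_spec (a := a) (b := b) (s := s) hC hη hΛ g).1
  obtain ⟨u, hu'⟩ := (Matrix.isUnit_iff_isUnit_det _).2 hu
  have hinv : ((u⁻¹ : (Matrix ι ι ℂ)ˣ) : Matrix ι ι ℂ) = gaussRes C a b s Λ g := by
    rw [gaussRes, ← hu', Matrix.coe_units_inv]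
  have h1 := hasFDerivAt_ringInverse (𝕜 := ℝ) u
  rw [hu', hinv] at h1
  have h2 : HasFDerivAt (fun g => C + gaussMat a b s g - Matrix.diagonal Λ)
      (gaussMatDeriv a b s) g := by
    have h3 := (((gaussMatDeriv a b s).hasFDerivAt (x := g)).const_add C).sub_const
      (Matrix.diagonal Λ)
    simpa only [gaussMatDeriv_apply] using h3
  have h4 := h1.comp g h2
  have h5 : gaussRes C a b s Λ
      = Ring.inverse ∘ fun g => C + gaussMat a b s g - Matrix.diagonal Λ := by
    ext1 g; simp only [gaussRes, Matrix.nonsing_inv_eq_ringInverse]; rfl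
  rw [← h5] at h4
  exact h4.congr_fderiv (ContinuousLinearMap.neg_comp _ _)

lemma continuous_gaussRes (hC : C.IsHermitian) (hη : 0 < η) (hΛ : ∀ i, η ≤ (Λ i).im) :
    Continuous (gaussRes C a b s Λ) :=
  continuous_iff_continuousAt.2 fun g => (hasFDerivAt_gaussRes hC hη hΛ g).continuousAt

lemma continuous_gaussRes_entry (hC : C.IsHermitian) (hη : 0 < η) (hΛ : ∀ i, η ≤ (Λ i).im)
    (i j : ι) : Continuous fun g => gaussRes C a b s Λ g i j :=
  (continuous_gaussRes hC hη hΛ).matrix_elem i j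

lemma norm_gaussRes_entry_le (hC : C.IsHermitian) (hη : 0 < η) (hΛ : ∀ i, η ≤ (Λ i).im)
    (g : E → ℝ) (i j : ι) : ‖gaussRes C a b s Λ g i j‖ ≤ η⁻¹ :=
  (entry_le_norm _ i j).trans (gaussRes_spec hC hη hΛ g).2

lemma integrable_gaussRes_entry (hC : C.IsHermitian) (hη : 0 < η) (hΛ : ∀ i, η ≤ (Λ i).im)
    (i j : ι) : Integrable (fun g => gaussRes C a b s Λ g i j) (stdG E) :=
  .of_bound (continuous_gaussRes_entry hC hη hΛ i j).aestronglyMeasurable _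
    (ae_of_all _ fun g => norm_gaussRes_entry_le hC hη hΛ g i j)

/-- The real linear functional `M ↦ Re Tr(A M)`. -/
def reTrace (A : Matrix ι ι ℂ) : Matrix ι ι ℂ →L[ℝ] ℝ :=
  LinearMap.toContinuousLinearMap
    { toFun := fun M => (A * M).trace.re
      map_add' := fun M M' => by rw [mul_add, Matrix.trace_add, Complex.add_re]
      map_smul' := fun r M => by
        rw [Matrix.mul_smul, Matrix.trace_smul, Complex.smul_re, RingHom.id_apply] }

lemma reTrace_apply (A M : Matrix ι ι ℂ) : reTrace A M = (A * M).trace.re := rfl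

omit [Fintype E] in
lemma trace_mul_coefMat (K : Matrix ι ι ℂ) (e : E) :
    (K * coefMat a b s e).trace = s e * (K (b e) (a e) + K (a e) (b e)) := by
  rw [coefMat, Matrix.mul_smul, Matrix.trace_smul, mul_add, Matrix.trace_add,
    Matrix.trace_mul_single, Matrix.trace_mul_single, MulOpposite.op_one, one_smul, one_smul,
    smul_eq_mul]

/-- Linear statistics of the resolvent are sub-Gaussian. -/
lemma hasSubgaussianMGF_reTrace (hC : C.IsHermitian) (hη : 0 < η) (hΛ : ∀ i, η ≤ (Λ i).im)
    {σ : ℝ} (hσ0 : 0 ≤ σ) (hσ : ∀ i j, gaussVar a b s i j ≤ σ) (A : Matrix ι ι ℂ) {F : ℝ}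
    (hF : ∑ i, ∑ j, ‖A i j‖ ^ 2 ≤ F) :
    HasSubgaussianMGF (fun g => (A * gaussRes C a b s Λ g).trace.re
      - ∫ g', (A * gaussRes C a b s Λ g').trace.re ∂(stdG E))
      ((Real.pi ^ 2 / 4).toNNReal * (2 * σ * (η⁻¹) ^ 4 * F).toNNReal) (stdG E) := by
  set Q := gaussRes C a b s Λ with hQ
  have hη' : 0 < η⁻¹ := by positivity
  have hF0 : 0 ≤ F := (Finset.sum_nonneg fun i _ => Finset.sum_nonneg fun j _ => by
    positivity).trans hF
  -- By cyclicity the partial derivative of `Re Tr(AQ)` along variable `e` is `-Re Tr(QAQ B_e)`,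
  -- with `B_e` its coefficient matrix. The squared gradient is thus at most `2σ` times the squared
  -- Frobenius norm of `QAQ`, itself at most `η⁻⁴` times that of `A`.
  refine hasSubgaussianMGF_of_gradient_le (fun g => (A * Q g).trace.re)
    (fun g e => -((Q g * A * Q g) * coefMat a b s e).trace.re) (fun g => ?_) ?_ (fun g => ?_)
    (B := ‖reTrace A‖ * η⁻¹) fun g => ?_
  · have h1 := (reTrace A).hasFDerivAt.comp g (hasFDerivAt_gaussRes (a := a) (b := b) (s := s)
      hC hη hΛ g)
    refine h1.congr_fderiv ?_
    ext v
    simp only [ContinuousLinearMap.comp_apply, neg_apply, map_neg, gaussMatDeriv_apply,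
      ContinuousLinearMap.mulLeftRight_apply, sum_apply,
      smul_apply, ContinuousLinearMap.proj_apply, smul_eq_mul, reTrace_apply]
    rw [gaussMat, Matrix.mul_sum, Matrix.sum_mul, Matrix.mul_sum, Matrix.trace_sum,
      Complex.re_sum, ← Finset.sum_neg_distrib]
    refine Finset.sum_congr rfl fun e _ => ?_
    rw [Matrix.mul_smul, Matrix.smul_mul, Matrix.mul_smul, Matrix.trace_smul, smul_eq_mul,
      Complex.re_ofReal_mul, neg_mul, mul_comm]
    congr 2
    rw [← hQ, ← mul_assoc, ← mul_assoc, Matrix.trace_mul_comm, ← mul_assoc, ← mul_assoc]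
  · have hQc : Continuous Q := continuous_gaussRes hC hη hΛ
    refine continuous_pi fun e => ?_
    exact (Complex.continuous_re.comp
      (((hQc.mul continuous_const).mul hQc).mul continuous_const).matrix_trace).neg
  · rw [Real.coe_toNNReal _ (by positivity)]
    set K := Q g * A * Q g with hK
    have hQn : ‖Q g‖ ≤ η⁻¹ := (gaussRes_spec hC hη hΛ g).2
    have h1 : ∀ e, (-(K * coefMat a b s e).trace.re) ^ 2
        ≤ 2 * (s e ^ 2 * (‖K (a e) (b e)‖ ^ 2 + ‖K (b e) (a e)‖ ^ 2)) := by
      intro e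
      rw [trace_mul_coefMat, neg_sq, Complex.re_ofReal_mul, mul_pow]
      have h2 : (K (b e) (a e) + K (a e) (b e)).re ^ 2
          ≤ 2 * (‖K (a e) (b e)‖ ^ 2 + ‖K (b e) (a e)‖ ^ 2) := by
        have h3 := (Complex.abs_re_le_norm (K (b e) (a e) + K (a e) (b e))).trans (norm_add_le _ _)
        have h4 := pow_le_pow_left₀ (abs_nonneg _) h3 2
        rw [sq_abs] at h4
        nlinarith [sq_nonneg (‖K (b e) (a e)‖ - ‖K (a e) (b e)‖)]
      nlinarith [mul_le_mul_of_nonneg_left h2 (sq_nonneg (s e))]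
    calc _ ≤ ∑ e, 2 * (s e ^ 2 * (‖K (a e) (b e)‖ ^ 2 + ‖K (b e) (a e)‖ ^ 2)) :=
          Finset.sum_le_sum fun e _ => h1 e
      _ = 2 * ∑ i, ∑ j, gaussVar a b s i j * ‖K i j‖ ^ 2 := by
          rw [← Finset.mul_sum, sum_gaussVar_mul_real a b s (fun i j => ‖K i j‖ ^ 2)]
      _ ≤ 2 * ∑ i, ∑ j, σ * ‖K i j‖ ^ 2 := by
          gcongr with i _ j _
          exact hσ i j
      _ = 2 * σ * ∑ i, ∑ j, ‖K i j‖ ^ 2 := by simp only [← Finset.mul_sum]; ring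
      _ ≤ 2 * σ * ((η⁻¹) ^ 2 * ((η⁻¹) ^ 2 * F)) := by
          refine mul_le_mul_of_nonneg_left ?_ (by positivity)
          refine (sum_sq_mul_le' _ _).trans ?_
          refine mul_le_mul (pow_le_pow_left₀ (norm_nonneg _) hQn 2) ?_
            (Finset.sum_nonneg fun i _ => Finset.sum_nonneg fun j _ => by positivity)
            (by positivity)
          refine (sum_sq_mul_le _ _).trans ?_
          exact mul_le_mul (pow_le_pow_left₀ (norm_nonneg _) hQn 2) hF
            (Finset.sum_nonneg fun i _ => Finset.sum_nonneg fun j _ => by positivity)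
            (by positivity)
      _ = _ := by ring
  · rw [← reTrace_apply, ← Real.norm_eq_abs]
    refine ((reTrace A).le_opNorm _).trans ?_
    exact mul_le_mul_of_nonneg_left (gaussRes_spec hC hη hΛ g).2 (norm_nonneg _)

/-- Tail bound for an entry of the resolvent. -/
lemma measure_entry_sub_mean_ge_le (hC : C.IsHermitian) (hη : 0 < η) (hΛ : ∀ i, η ≤ (Λ i).im)
    {σ : ℝ} (hσ0 : 0 < σ) (hσ : ∀ i j, gaussVar a b s i j ≤ σ) (i j : ι) {t : ℝ} (ht : 0 ≤ t) :
    stdG E {g | t ≤ ‖gaussRes C a b s Λ g i j - ∫ g', gaussRes C a b s Λ g' i j ∂(stdG E)‖}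
      ≤ ENNReal.ofReal (4 * Real.exp (-(t ^ 2 * η ^ 4 / (48 * σ)))) := by
  set Q := gaussRes C a b s Λ with hQ
  set M := ∫ g', Q g' i j ∂(stdG E) with hM
  have hQi : Integrable (fun g => Q g i j) (stdG E) := integrable_gaussRes_entry hC hη hΛ i j
  -- The multipliers `z = ±1, ±i` reduce the modulus to four one-sided real deviations of size
  -- `t/2`. The constant 48 is `4π²` rounded up with `π² ≤ 12`.
  have key : ∀ z : ℂ, ‖z‖ = 1 → stdG E {g | t / 2 ≤ (z * (Q g i j - M)).re}
      ≤ ENNReal.ofReal (Real.exp (-(t ^ 2 * η ^ 4 / (48 * σ)))) := by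
    intro z hz
    have htr : ∀ g, (Matrix.single j i z * Q g).trace = z * Q g i j := by
      intro g
      rw [Matrix.trace_single_mul, smul_eq_mul]
    have hsum : ∑ k, ∑ l, ‖Matrix.single j i z k l‖ ^ 2 ≤ 1 := by
      rw [Finset.sum_eq_single j, Finset.sum_eq_single i]
      · simp [hz]
      · intro l _ hl; simp [hl.symm]
      · simp
      · intro k _ hk; simp [hk.symm]
      · simp
    have h1 := hasSubgaussianMGF_reTrace (a := a) (b := b) (s := s) hC hη hΛ hσ0.le hσ
      (Matrix.single j i z) hsum
    have h2 := h1.measure_ge_le (ε := t / 2) (by positivity)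
    simp only [← hQ, htr] at h2
    have hmean : ∫ g', (z * Q g' i j).re ∂(stdG E) = (z * M).re := by
      rw [hM, ← integral_const_mul]
      exact integral_re (hQi.const_mul z)
    rw [hmean] at h2
    have h3 : {g | t / 2 ≤ (z * (Q g i j - M)).re}
        = {g | t / 2 ≤ (z * Q g i j).re - (z * M).re} := by
      simp only [mul_sub, Complex.sub_re]
    rw [h3, ← ofReal_measureReal]
    refine ENNReal.ofReal_le_ofReal (h2.trans (Real.exp_le_exp.2 ?_))
    push_cast
    rw [Real.coe_toNNReal _ (by positivity), Real.coe_toNNReal _ (by positivity), neg_div]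
    apply neg_le_neg
    rw [div_le_div_iff₀ (by positivity) (by positivity)]
    have hpi : Real.pi ^ 2 ≤ 12 := by
      have := Real.pi_lt_d2
      nlinarith [Real.pi_pos]
    have h4 : η ^ 4 * (η⁻¹) ^ 4 = 1 := by rw [← mul_pow, mul_inv_cancel₀ hη.ne', one_pow]
    calc _ = t ^ 2 * σ * Real.pi ^ 2 * (η ^ 4 * (η⁻¹) ^ 4) := by ring
      _ = t ^ 2 * σ * Real.pi ^ 2 := by rw [h4, mul_one]
      _ ≤ t ^ 2 * σ * 12 := by gcongr
      _ = _ := by ring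
  have hsub : {g | t ≤ ‖Q g i j - M‖} ⊆ (({g | t / 2 ≤ (1 * (Q g i j - M)).re} ∪
      {g | t / 2 ≤ ((-1) * (Q g i j - M)).re}) ∪ {g | t / 2 ≤ ((-Complex.I) * (Q g i j - M)).re}) ∪
      {g | t / 2 ≤ (Complex.I * (Q g i j - M)).re} := by
    intro g hg
    have hg' : t ≤ ‖Q g i j - M‖ := hg
    have h1 := hg'.trans (Complex.norm_le_abs_re_add_abs_im _)
    by_contra hcon
    simp only [Set.mem_union, Set.mem_ofPred_eq, not_or, not_le, one_mul, neg_mul, Complex.neg_re,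
      Complex.I_mul_re, neg_neg] at hcon
    obtain ⟨⟨⟨h2, h3⟩, h4⟩, h5⟩ := hcon
    have h6 : |(Q g i j - M).re| < t / 2 := abs_lt.2 ⟨by linarith, h2⟩
    have h7 : |(Q g i j - M).im| < t / 2 := abs_lt.2 ⟨by linarith, h4⟩
    linarith
  refine (measure_mono hsub).trans ((measure_union_le _ _).trans ?_)
  have hsplit : ENNReal.ofReal (4 * Real.exp (-(t ^ 2 * η ^ 4 / (48 * σ))))
      = ENNReal.ofReal (Real.exp (-(t ^ 2 * η ^ 4 / (48 * σ))))
        + ENNReal.ofReal (Real.exp (-(t ^ 2 * η ^ 4 / (48 * σ))))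
        + ENNReal.ofReal (Real.exp (-(t ^ 2 * η ^ 4 / (48 * σ))))
        + ENNReal.ofReal (Real.exp (-(t ^ 2 * η ^ 4 / (48 * σ)))) := by
    have := (Real.exp_pos (-(t ^ 2 * η ^ 4 / (48 * σ)))).le
    rw [← ENNReal.ofReal_add this this, ← ENNReal.ofReal_add (by linarith) this,
      ← ENNReal.ofReal_add (by linarith) this]
    congr 1; ring
  rw [hsplit]
  refine add_le_add ((measure_union_le _ _).trans (add_le_add ((measure_union_le _ _).trans
    (add_le_add (key 1 (by simp)) (key (-1) (by simp)))) (key _ (by simp)))) (key _ (by simp))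

/-- The weighted traces of the resolvent concentrate in `L¹`. -/
lemma integral_norm_weighted_trace_le (hC : C.IsHermitian) (hη : 0 < η)
    (hΛ : ∀ i, η ≤ (Λ i).im) {σ : ℝ} (hσ0 : 0 < σ) (hσ : ∀ i j, gaussVar a b s i j ≤ σ)
    (c : ι → ℝ) (hc : ∀ i, |c i| ≤ σ) :
    ∫ g, ‖∑ j, (c j : ℂ) * (gaussRes C a b s Λ g j j
        - ∫ g', gaussRes C a b s Λ g' j j ∂(stdG E))‖ ∂(stdG E)
      ≤ 20 * √(Fintype.card ι * σ ^ 3) * (η⁻¹) ^ 2 := by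
  set Q := gaussRes C a b s Λ with hQ
  set M : ι → ℂ := fun j => ∫ g', Q g' j j ∂(stdG E) with hM
  have hQi : ∀ j, Integrable (fun g => Q g j j) (stdG E) :=
    fun j => integrable_gaussRes_entry hC hη hΛ j j
  set Y : (E → ℝ) → ℂ := fun g => ∑ j, (c j : ℂ) * (Q g j j - M j) with hY
  have hYc : Continuous Y := by
    refine continuous_finsetSum _ fun j _ => ?_
    have : Continuous fun g => Q g j j := continuous_gaussRes_entry hC hη hΛ j j
    fun_prop
  -- `2K` bounds the second moment of a real part: it is `8` times the sub-Gaussian parameter with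
  -- `π² ≤ 12`. The two real parts together give `2√(2K)`, and `√48 ≤ 10` produces the 20 of the
  -- statement.
  set K : ℝ := 24 * σ * (η⁻¹) ^ 4 * (Fintype.card ι * σ ^ 2) with hK
  have hK0 : 0 ≤ K := by positivity
  have key : ∀ z : ℂ, ‖z‖ = 1 → ∫ g, (z * Y g).re ^ 2 ∂(stdG E) ≤ 2 * K ∧
      ∫ g, |(z * Y g).re| ∂(stdG E) ≤ √(2 * K) := by
    intro z hz
    set A : Matrix ι ι ℂ := Matrix.diagonal fun j => z * (c j : ℂ) with hA
    have htr : ∀ g, (A * Q g).trace = z * ∑ j, (c j : ℂ) * Q g j j := by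
      intro g
      simp only [hA, Matrix.trace, Matrix.diag_apply, Matrix.diagonal_mul, Finset.mul_sum, mul_assoc]
    have hsum : ∑ k, ∑ l, ‖A k l‖ ^ 2 ≤ Fintype.card ι * σ ^ 2 := by
      calc _ ≤ ∑ _ : ι, σ ^ 2 := by
            refine Finset.sum_le_sum fun k _ => ?_
            rw [Finset.sum_eq_single k]
            · rw [hA, Matrix.diagonal_apply_eq, norm_mul, hz, one_mul, Complex.norm_real,
                Real.norm_eq_abs]
              exact pow_le_pow_left₀ (abs_nonneg _) (hc k) 2
            · intro l _ hl; simp [hA, Matrix.diagonal_apply_ne _ hl.symm]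
            · simp
        _ = _ := by simp
    have h1 := hasSubgaussianMGF_reTrace (a := a) (b := b) (s := s) hC hη hΛ hσ0.le hσ A hsum
    simp only [← hQ, htr] at h1
    have hmean : ∫ g', (z * ∑ j, (c j : ℂ) * Q g' j j).re ∂(stdG E)
        = (z * ∑ j, (c j : ℂ) * M j).re := by
      have h2 : ∫ g', (z * ∑ j, (c j : ℂ) * Q g' j j) ∂(stdG E) = z * ∑ j, (c j : ℂ) * M j := by
        rw [integral_const_mul, integral_finsetSum _ fun j _ => (hQi j).const_mul _]
        simp only [integral_const_mul, hM]
      rw [← h2]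
      exact integral_re ((integrable_finsetSum _ fun j _ => (hQi j).const_mul _).const_mul z)
    have h3 : (fun g => (z * ∑ j, (c j : ℂ) * Q g j j).re
        - ∫ g', (z * ∑ j, (c j : ℂ) * Q g' j j).re ∂(stdG E)) = fun g => (z * Y g).re := by
      ext g
      rw [hmean, ← Complex.sub_re, ← mul_sub]
      simp only [hY, mul_sub, Finset.sum_sub_distrib]
    rw [h3] at h1
    have h4 := integral_sq_le_of_hasSubgaussianMGF h1
    have hpi : Real.pi ^ 2 ≤ 12 := by
      have := Real.pi_lt_d2
      nlinarith [Real.pi_pos]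
    have h5 : ∫ g, (z * Y g).re ^ 2 ∂(stdG E) ≤ 2 * K := by
      refine h4.trans ?_
      push_cast
      rw [Real.coe_toNNReal _ (by positivity), Real.coe_toNNReal _ (by positivity)]
      calc _ = Real.pi ^ 2 * (4 * σ * (η⁻¹) ^ 4 * (Fintype.card ι * σ ^ 2)) := by ring
        _ ≤ 12 * (4 * σ * (η⁻¹) ^ 4 * (Fintype.card ι * σ ^ 2)) := by gcongr
        _ = _ := by rw [hK]; ring
    refine ⟨h5, ?_⟩
    apply Real.le_sqrt_of_sq_le
    refine le_trans ?_ h5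
    have h6 : MemLp (fun g => |(z * Y g).re|) 2 (stdG E) := (h1.memLp 2).abs
    have h7 := variance_nonneg (fun g => |(z * Y g).re|) (stdG E)
    rw [variance_eq_sub h6] at h7
    simp only [Pi.pow_apply, sq_abs] at h7
    linarith
  have hre := (key 1 (by simp)).2
  have him := (key (-Complex.I) (by simp)).2
  simp only [one_mul, neg_mul, Complex.neg_re, Complex.I_mul_re, neg_neg] at hre him
  have hYi : Integrable Y (stdG E) :=
    integrable_finsetSum _ fun j _ => ((hQi j).sub (integrable_const _)).const_mul _
  calc ∫ g, ‖Y g‖ ∂(stdG E) ≤ ∫ g, (|(Y g).re| + |(Y g).im|) ∂(stdG E) :=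
        integral_mono hYi.norm (hYi.re.abs.add hYi.im.abs)
          fun g => Complex.norm_le_abs_re_add_abs_im _
    _ = ∫ g, |(Y g).re| ∂(stdG E) + ∫ g, |(Y g).im| ∂(stdG E) :=
        integral_add hYi.re.abs hYi.im.abs
    _ ≤ √(2 * K) + √(2 * K) := add_le_add hre him
    _ ≤ _ := by
        have h8 : 2 * K = 48 * ((Fintype.card ι * σ ^ 3) * ((η⁻¹) ^ 2) ^ 2) := by rw [hK]; ring
        rw [h8, Real.sqrt_mul (by norm_num), Real.sqrt_mul (by positivity),
          Real.sqrt_sq (by positivity)]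
        have h9 : √(48 : ℝ) ≤ 10 := by
          rw [Real.sqrt_le_left (by norm_num)]; norm_num
        have h10 : 0 ≤ √(Fintype.card ι * σ ^ 3) * (η⁻¹) ^ 2 := by positivity
        nlinarith

end GaussianResolvent

/-! ### The approximate Dyson equation for the mean resolvent. -/

section MeanEquation

open scoped Matrix.Norms.L2Operator

variable {ι E : Type*} [Fintype ι] [DecidableEq ι] [Fintype E]

/-- The mean of the Gaussian resolvent. -/
def meanRes (C : Matrix ι ι ℂ) (a b : E → ι) (s : E → ℝ) (Λ : ι → ℂ) : Matrix ι ι ℂ :=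
  fun i j => ∫ g, gaussRes C a b s Λ g i j ∂(stdG E)

/-- This is the covariance map `𝔼[H Q H]` with `Q` frozen. Its diagonal part is the map `R` of the
Dyson equation; the transposed part, due to the symmetry of `H`, is of lower order. -/
lemma sum_coefMat_mul_mul (a b : E → ι) (s : E → ℝ) (Q : Matrix ι ι ℂ) (i k : ι) :
    (∑ e, coefMat a b s e * Q * coefMat a b s e) i k
      = (if i = k then ∑ v, (gaussVar a b s i v : ℂ) * Q v v else 0)
        + (gaussVar a b s i k : ℂ) * Q k i := by
  have h1 : ∀ e, (coefMat a b s e * Q * coefMat a b s e) i k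
      = ((s e ^ 2 : ℝ) : ℂ) * (
        (Matrix.single (a e) (a e) (Q (b e) (b e)) i k + Matrix.single (a e) (b e) (Q (b e) (a e)) i k)
        + (Matrix.single (b e) (b e) (Q (a e) (a e)) i k
          + Matrix.single (b e) (a e) (Q (a e) (b e)) i k)) := by
    intro e
    rw [coefMat]
    simp only [Matrix.smul_mul, Matrix.mul_smul, add_mul, mul_add, Matrix.single_mul_mul_single,
      one_mul, mul_one, Matrix.smul_apply, Matrix.add_apply, smul_eq_mul]
    push_cast; ring
  rw [Matrix.sum_apply]
  simp only [h1]
  have h2 := sum_gaussVar_mul a b s (R := ℂ)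
    (fun u v => Matrix.single u u (Q v v) i k + Matrix.single u v (Q v u) i k)
  simp only [Complex.coe_algebraMap] at h2
  rw [← h2]
  simp only [mul_add, Finset.sum_add_distrib]
  congr 1
  · rw [Finset.sum_eq_single i]
    · split_ifs with h
      · subst h; simp
      · simp [h]
    · intro u _ hu; simp [hu]
    · simp
  · rw [Finset.sum_eq_single i, Finset.sum_eq_single k]
    · simp
    · intro v _ hv; simp [hv]
    · simp
    · intro u _ hu; simp [hu]
    · simp

variable {C : Matrix ι ι ℂ} {a b : E → ι} {s : E → ℝ} {Λ : ι → ℂ} {η : ℝ}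

/-- Integration by parts in the variable `g e`, along which the derivative of `Q` is `-Q B Q` with
`B = coefMat a b s e`. -/
lemma integral_mul_gaussRes (hC : C.IsHermitian) (hη : 0 < η) (hΛ : ∀ i, η ≤ (Λ i).im)
    (e : E) (i j : ι) :
    ∫ g, (g e : ℂ) * (coefMat a b s e * gaussRes C a b s Λ g) i j ∂(stdG E)
      = ∫ g, -(coefMat a b s e * gaussRes C a b s Λ g * coefMat a b s e
          * gaussRes C a b s Λ g) i j ∂(stdG E) := by
  classical
  set Q := gaussRes C a b s Λ with hQ
  set B := coefMat a b s e with hB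
  have hQc : Continuous Q := continuous_gaussRes hC hη hΛ
  have hQn : ∀ g, ‖Q g‖ ≤ η⁻¹ := fun g => (gaussRes_spec hC hη hΛ g).2
  have hη' : 0 ≤ η⁻¹ := by positivity
  refine stein e (fun g => (B * Q g) i j) (fun g => -(B * Q g * B * Q g) i j)
    ((continuous_const.mul hQc).matrix_elem i j)
    ((((continuous_const.mul hQc).mul continuous_const).mul hQc).matrix_elem i j).neg
    (fun g => ?_) (B := ‖B‖ * η⁻¹ + ‖B‖ * η⁻¹ * ‖B‖ * η⁻¹) (fun g => ?_) (fun g => ?_)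
  · have h0 : Function.update g e (g e) = g := Function.update_eq_self e g
    have h1 := hasFDerivAt_gaussRes (a := a) (b := b) (s := s) hC hη hΛ g
    rw [← h0] at h1
    have h2 := h1.comp_hasDerivAt (g e) (hasDerivAt_update g e (g e))
    rw [h0] at h2
    have h3 : (-(ContinuousLinearMap.mulLeftRight ℝ (Matrix ι ι ℂ) (gaussRes C a b s Λ g)
        (gaussRes C a b s Λ g)).comp (gaussMatDeriv a b s)) (Pi.single e 1) = -(Q g * B * Q g) := by
      rw [neg_apply, ContinuousLinearMap.comp_apply, gaussMatDeriv_apply,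
        ContinuousLinearMap.mulLeftRight_apply]
      have : gaussMat a b s (Pi.single e 1) = B := by
        rw [gaussMat, Finset.sum_eq_single e]
        · simp [hB]
        · intro e' _ he'; simp [he']
        · simp
      rw [this]
    rw [h3] at h2
    have h4 := h2.const_mul B
    let φ : Matrix ι ι ℂ →L[ℝ] ℂ := LinearMap.toContinuousLinearMap
      { toFun := fun M => M i j
        map_add' := fun M M' => rfl
        map_smul' := fun r M => rfl }
    have h5 := φ.hasFDerivAt.comp_hasDerivAt (g e) h4
    refine h5.congr_deriv ?_
    change (B * -(Q g * B * Q g)) i j = _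
    rw [mul_neg, Matrix.neg_apply, ← mul_assoc, ← mul_assoc]
  · refine (entry_le_norm _ i j).trans ((norm_mul_le _ _).trans ?_)
    have : ‖B‖ * ‖Q g‖ ≤ ‖B‖ * η⁻¹ := mul_le_mul_of_nonneg_left (hQn g) (norm_nonneg _)
    have h2 : 0 ≤ ‖B‖ * η⁻¹ * ‖B‖ * η⁻¹ := by positivity
    linarith
  · rw [norm_neg]
    refine (entry_le_norm _ i j).trans ?_
    have h1 : ‖B * Q g * B * Q g‖ ≤ ‖B‖ * ‖Q g‖ * ‖B‖ * ‖Q g‖ :=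
      (norm_mul_le _ _).trans (mul_le_mul_of_nonneg_right ((norm_mul_le _ _).trans
        (mul_le_mul_of_nonneg_right (norm_mul_le _ _) (norm_nonneg _))) (norm_nonneg _))
    have h2 : ‖B‖ * ‖Q g‖ * ‖B‖ * ‖Q g‖ ≤ ‖B‖ * η⁻¹ * ‖B‖ * η⁻¹ := by
      have := hQn g
      gcongr
    have h3 : 0 ≤ ‖B‖ * η⁻¹ := by positivity
    linarith

/-- The mean of the resolvent approximately solves the Dyson equation. -/
theorem norm_meanRes_dyson_le (hC : C.IsHermitian) (hη : 0 < η)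
    (hΛ : ∀ i, η ≤ (Λ i).im) {σ : ℝ} (hσ0 : 0 < σ) (hσ : ∀ i j, gaussVar a b s i j ≤ σ)
    (hS0 : ∀ i j, 0 ≤ gaussVar a b s i j) (i j : ι) :
    ‖((C - Matrix.diagonal (shiftDiag (gaussVar a b s) Λ fun i => meanRes C a b s Λ i i))
        * meanRes C a b s Λ - 1) i j‖
      ≤ 20 * √(Fintype.card ι * σ ^ 3) * (η⁻¹) ^ 3 + σ * (η⁻¹) ^ 2 := by
  set Q := gaussRes C a b s Λ with hQ
  set M := meanRes C a b s Λ with hM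
  set S := gaussVar a b s with hS
  have hη' : 0 ≤ η⁻¹ := by positivity
  have hQn : ∀ g, ‖Q g‖ ≤ η⁻¹ := fun g => (gaussRes_spec hC hη hΛ g).2
  have hQe : ∀ g i j, ‖Q g i j‖ ≤ η⁻¹ := fun g i j => norm_gaussRes_entry_le hC hη hΛ g i j
  have hQc : Continuous Q := continuous_gaussRes hC hη hΛ
  have hQec : ∀ i j, Continuous fun g => Q g i j := fun i j =>
    continuous_gaussRes_entry hC hη hΛ i j
  have hQi : ∀ i j, Integrable (fun g => Q g i j) (stdG E) :=
    fun i j => integrable_gaussRes_entry hC hη hΛ i j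
  have hQQ : ∀ k l i j, Integrable (fun g => Q g k l * Q g i j) (stdG E) := fun k l i j =>
    (hQi i j).bdd_mul (hQec k l).aestronglyMeasurable (ae_of_all _ fun g => hQe g k l)
  -- the equation for the resolvent
  have hres : ∀ g, ∑ e, (g e : ℂ) * (coefMat a b s e * Q g) i j
      = (1 : Matrix ι ι ℂ) i j - ∑ k, (C - Matrix.diagonal Λ) i k * Q g k j := by
    intro g
    have h1 := Matrix.mul_nonsing_inv _ (gaussRes_spec (a := a) (b := b) (s := s) hC hη hΛ g).1
    have h2 : C + gaussMat a b s g - Matrix.diagonal Λ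
        = (C - Matrix.diagonal Λ) + gaussMat a b s g := by abel
    have h3 : (C - Matrix.diagonal Λ) * Q g + gaussMat a b s g * Q g = 1 := by
      rw [← add_mul, ← h2]; exact h1
    have h4 := congrFun (congrFun h3 i) j
    rw [Matrix.add_apply, gaussMat, Matrix.sum_mul, Matrix.sum_apply] at h4
    rw [← h4, Matrix.mul_apply]
    simp only [Matrix.smul_mul, Matrix.smul_apply, smul_eq_mul]
    ring
  have hei : ∀ e, Integrable (fun g : E → ℝ => (g e : ℂ) * (coefMat a b s e * Q g) i j)
      (stdG E) := by
    intro e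
    have h1 : Integrable (fun x : E → ℝ => ((x e : ℝ) : ℂ)) (stdG E) :=
      ((IsGaussian.integrable_id (μ := stdG E)).eval e).ofReal
    refine h1.mul_bdd (c := ‖coefMat a b s e‖ * η⁻¹)
      ((continuous_const.mul hQc).matrix_elem i j).aestronglyMeasurable (ae_of_all _ fun g => ?_)
    exact (entry_le_norm _ i j).trans ((norm_mul_le _ _).trans
      (mul_le_mul_of_nonneg_left (hQn g) (norm_nonneg _)))
  have hBi : ∀ e, Integrable (fun g : E → ℝ => -(coefMat a b s e * Q g * coefMat a b s e * Q g) i j)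
      (stdG E) := by
    intro e
    set B := coefMat a b s e
    refine .of_bound ((((continuous_const.mul hQc).mul continuous_const).mul
      hQc).matrix_elem i j).neg.aestronglyMeasurable (‖B‖ * η⁻¹ * ‖B‖ * η⁻¹)
      (ae_of_all _ fun g => ?_)
    rw [norm_neg]
    refine (entry_le_norm _ i j).trans ?_
    refine ((norm_mul_le _ _).trans (mul_le_mul_of_nonneg_right ((norm_mul_le _ _).trans
        (mul_le_mul_of_nonneg_right (norm_mul_le _ _) (norm_nonneg _))) (norm_nonneg _))).trans ?_
    have := hQn g
    gcongr
  -- The two terms produced by integration by parts: `R(Q) Q`, and the transposed correction.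
  set T : (E → ℝ) → ℂ := fun g =>
    (∑ v, (S i v : ℂ) * Q g v v) * Q g i j + ∑ k, (S i k : ℂ) * (Q g k i * Q g k j) with hT
  have hTsum : ∀ g, ∑ e, -(coefMat a b s e * Q g * coefMat a b s e * Q g) i j = -T g := by
    intro g
    rw [Finset.sum_neg_distrib, ← Matrix.sum_apply, ← Matrix.sum_mul, Matrix.mul_apply]
    simp only [sum_coefMat_mul_mul, add_mul, Finset.sum_add_distrib, ite_mul, zero_mul,
      Finset.sum_ite_eq, Finset.mem_univ, if_true, hT]
    simp only [mul_assoc]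
    rfl
  have hleft : ∑ e, ∫ g, (g e : ℂ) * (coefMat a b s e * Q g) i j ∂(stdG E)
      = (1 : Matrix ι ι ℂ) i j - ∑ k, (C - Matrix.diagonal Λ) i k * M k j := by
    rw [← integral_finsetSum _ fun e _ => hei e]
    simp only [hres]
    rw [integral_sub (integrable_const _)
      (integrable_finsetSum _ fun k _ => (hQi k j).const_mul _),
      integral_finsetSum _ fun k _ => (hQi k j).const_mul _]
    simp only [integral_const_mul, integral_const, probReal_univ, one_smul]
    rfl
  have hright : ∑ e, ∫ g, (g e : ℂ) * (coefMat a b s e * Q g) i j ∂(stdG E)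
      = -∫ g, T g ∂(stdG E) := by
    rw [Finset.sum_congr rfl fun e _ => integral_mul_gaussRes hC hη hΛ e i j,
      ← integral_finsetSum _ fun e _ => hBi e, ← integral_neg]
    exact integral_congr_ae (ae_of_all _ hTsum)
  have hTi : Integrable T (stdG E) := by
    refine Integrable.add ?_ (integrable_finsetSum _ fun k _ => (hQQ k i k j).const_mul _)
    have : (fun g => (∑ v, (S i v : ℂ) * Q g v v) * Q g i j)
        = fun g => ∑ v, (S i v : ℂ) * (Q g v v * Q g i j) := by
      ext g; rw [Finset.sum_mul]; exact Finset.sum_congr rfl fun v _ => by ring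
    rw [this]
    exact integrable_finsetSum _ fun v _ => (hQQ v v i j).const_mul _
  -- The Dyson error is `𝔼[Y Q_ij]` plus the correction. Concentration bounds `𝔼|Y|`, while
  -- Cauchy–Schwarz on two columns of `Q` bounds the correction by `σ η⁻²`.
  set Y : (E → ℝ) → ℂ := fun g => ∑ v, (S i v : ℂ) * (Q g v v - M v v) with hY
  have herr : ((C - Matrix.diagonal (shiftDiag S Λ fun i => M i i)) * M - 1) i j
      = ∫ g, (Y g * Q g i j + ∑ k, (S i k : ℂ) * (Q g k i * Q g k j)) ∂(stdG E) := by
    have h1 : ((C - Matrix.diagonal (shiftDiag S Λ fun i => M i i)) * M - 1) i j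
        = ∑ k, (C - Matrix.diagonal Λ) i k * M k j - (1 : Matrix ι ι ℂ) i j
          - (∑ v, (S i v : ℂ) * M v v) * M i j := by
      have h2 : C - Matrix.diagonal (shiftDiag S Λ fun i => M i i)
          = (C - Matrix.diagonal Λ) - Matrix.diagonal fun k => ∑ v, (S k v : ℂ) * M v v := by
        rw [sub_sub, Matrix.diagonal_add]; rfl
      rw [h2, sub_mul, Matrix.sub_apply, Matrix.sub_apply, Matrix.diagonal_mul, Matrix.mul_apply]
      ring
    have h3 : ∑ k, (C - Matrix.diagonal Λ) i k * M k j - (1 : Matrix ι ι ℂ) i j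
        = ∫ g, T g ∂(stdG E) := by
      linear_combination hleft - hright
    have h4 : (∑ v, (S i v : ℂ) * M v v) * M i j
        = ∫ g, (∑ v, (S i v : ℂ) * M v v) * Q g i j ∂(stdG E) := (integral_const_mul _ _).symm
    rw [h1, h3, h4, ← integral_sub hTi ((hQi i j).const_mul _)]
    refine integral_congr_ae (ae_of_all _ fun g => ?_)
    simp only [hT, hY, mul_sub, Finset.sum_sub_distrib]
    ring
  have hYi : Integrable Y (stdG E) :=
    integrable_finsetSum _ fun v _ => ((hQi v v).sub (integrable_const _)).const_mul _
  have hYb := integral_norm_weighted_trace_le (a := a) (b := b) (s := s) hC hη hΛ hσ0 hσ (S i)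
    fun k => by rw [abs_of_nonneg (hS0 i k)]; exact hσ i k
  rw [herr]
  calc _ ≤ ∫ g, (‖Y g‖ * η⁻¹ + σ * (η⁻¹) ^ 2) ∂(stdG E) := by
        refine norm_integral_le_of_norm_le ((hYi.norm.mul_const _).add (integrable_const _))
          (ae_of_all _ fun g => (norm_add_le _ _).trans (add_le_add ?_ ?_))
        · rw [norm_mul]; exact mul_le_mul_of_nonneg_left (hQe g i j) (norm_nonneg _)
        · calc ‖∑ k, (S i k : ℂ) * (Q g k i * Q g k j)‖
              ≤ ∑ k, σ * (‖Q g k i‖ * ‖Q g k j‖) := by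
                refine (norm_sum_le _ _).trans (Finset.sum_le_sum fun k _ => ?_)
                rw [norm_mul, norm_mul, Complex.norm_real, Real.norm_of_nonneg (hS0 i k)]
                exact mul_le_mul_of_nonneg_right (hσ i k) (by positivity)
            _ = σ * ∑ k, ‖Q g k i‖ * ‖Q g k j‖ := by rw [Finset.mul_sum]
            _ ≤ σ * (vnorm (fun k => Q g k i) * vnorm (fun k => Q g k j)) :=
                mul_le_mul_of_nonneg_left (Real.sum_mul_le_sqrt_mul_sqrt _ _ _) hσ0.le
            _ ≤ σ * (η⁻¹ * η⁻¹) := by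
                refine mul_le_mul_of_nonneg_left (mul_le_mul ((vnorm_col_le _ _).trans (hQn g))
                  ((vnorm_col_le _ _).trans (hQn g)) (vnorm_nonneg _) hη') hσ0.le
            _ = _ := by ring
    _ = (∫ g, ‖Y g‖ ∂(stdG E)) * η⁻¹ + σ * (η⁻¹) ^ 2 := by
        rw [integral_add (hYi.norm.mul_const _) (integrable_const _), integral_mul_const]
        simp
    _ ≤ 20 * √(Fintype.card ι * σ ^ 3) * (η⁻¹) ^ 2 * η⁻¹ + σ * (η⁻¹) ^ 2 := by
        gcongr
        exact hYb
    _ = _ := by ring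

end MeanEquation

/-! ### The linearization as a Gaussian matrix. -/

section Linearization

variable {n m p : ℕ}

/-- Index set of the Gaussian entries of the linearization. -/
abbrev GIdx (n m p : ℕ) : Type := (Fin m × Fin p) ⊕ (Fin n × Fin p) ⊕ (Fin m × Fin n)

/-- Row of the linearization in which a Gaussian entry sits. -/
def gRow : GIdx n m p → BIdx n m p
  | .inl e => .inr (.inl e.1)
  | .inr (.inl e) => .inl e.1
  | .inr (.inr e) => .inr (.inl e.1)

/-- Column of the linearization in which a Gaussian entry sits. -/
def gCol : GIdx n m p → BIdx n m p
  | .inl e => .inr (.inr (.inr e.2))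
  | .inr (.inl e) => .inr (.inr (.inl e.2))
  | .inr (.inr e) => .inl e.2

/-- Coefficient of a Gaussian entry in the linearization. -/
def gCoef (m : ℕ) (h : ℝ[X]) (U : Matrix (Fin n) (Fin p) ℝ) : GIdx n m p → ℝ
  | .inl _ => -1 / √(p : ℝ)
  | .inr (.inl e) => -(dLin h U e.1 * U e.1 e.2) / √(n : ℝ)
  | .inr (.inr e) => dChaos h U e.2 / √(n : ℝ)

lemma map_linMat (h : ℝ[X]) (U : Matrix (Fin n) (Fin p) ℝ) (g : GIdx n m p → ℝ)
    (W : Matrix (Fin m) (Fin p) ℝ) (X : Matrix (Fin n) (Fin p) ℝ) (Z : Matrix (Fin m) (Fin n) ℝ)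
    (hW : ∀ i j, g (.inl (i, j)) = W i j) (hX : ∀ i j, g (.inr (.inl (i, j))) = X i j)
    (hZ : ∀ i j, g (.inr (.inr (i, j))) = Z i j) :
    (linMat h U W X Z).map (fun x : ℝ => (x : ℂ))
      = cMat n m p + gaussMat gRow gCol (gCoef m h U) g := by
  ext i j
  rw [Matrix.map_apply, Matrix.add_apply, gaussMat, Matrix.sum_apply]
  simp only [coefMat, Matrix.smul_apply, Matrix.add_apply, smul_eq_mul, Matrix.single_apply,
    Fintype.sum_sum_type, Fintype.sum_prod_type, gRow, gCol, gCoef, hW, hX, hZ]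
  rcases i with i | i | i | i <;> rcases j with j | j | j | j <;>
    simp [linMat, cMat, ite_and, Matrix.one_apply, apply_ite (fun x : ℝ => (x : ℂ))] <;> try ring

/-- The factors `c_n² = N/n` and `c_p² = N/p`, divided by `N`, are the variances `1/n` and `1/p` of
the normalised entries. So the `R_N` of the statement is exactly the covariance map of the Gaussian
part. -/
lemma gaussVar_eq_varProfile (h : ℝ[X]) (U : Matrix (Fin n) (Fin p) ℝ) :
    gaussVar gRow gCol (gCoef m h U) = varProfile m h U := by
  ext i j
  have hN : bigN n m p ≠ 0 := by
    have h1 : 0 < Fintype.card (BIdx n m p) := Fintype.card_pos_iff.2 ⟨i⟩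
    have h2 : ((Fintype.card (BIdx n m p) : ℕ) : ℝ) = bigN n m p := by
      simp [bigN]; ring
    rw [← h2]; exact_mod_cast h1.ne'
  have hs : √(bigN n m p) ^ 2 = bigN n m p := Real.sq_sqrt bigN_nonneg
  have hk : ∀ k : ℕ, √(k : ℝ) ^ 2 = k := fun k => Real.sq_sqrt (Nat.cast_nonneg k)
  simp only [gaussVar, Fintype.sum_sum_type, Fintype.sum_prod_type, gRow, gCol, gCoef, varProfile]
  rcases i with i | i | i | i <;> rcases j with j | j | j | j <;>
    simp [profileL, ite_and, mul_pow, div_pow, hs, hk] <;>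
    try field_simp

lemma card_BIdx : (Fintype.card (BIdx n m p) : ℝ) = bigN n m p := by
  simp [bigN]; ring

end Linearization

/-! ### Invertibility of `L - Λ_λ` on the real axis. -/

section LowerBound

open scoped Matrix.Norms.L2Operator

/-- If the off-diagonal entries of a Hermitian matrix `T` anticommute with the signs `ε`, then
the real part of its quadratic form twisted by `ε` only sees the diagonal. -/
lemma re_twisted_quadForm {ι : Type*} [Fintype ι] [DecidableEq ι] {T : Matrix ι ι ℂ}
    (hT : T.IsHermitian) (ε : ι → ℝ) (hε : ∀ i j, i ≠ j → ((ε i + ε j : ℝ) : ℂ) * T i j = 0)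
    (x : ι → ℂ) :
    (∑ i, (ε i : ℂ) * star (x i) * (T *ᵥ x) i).re = ∑ i, ε i * (T i i).re * ‖x i‖ ^ 2 := by
  set z := ∑ i, (ε i : ℂ) * star (x i) * (T *ᵥ x) i with hz
  have h1 : z = ∑ i, ∑ j, (ε i : ℂ) * star (x i) * T i j * x j := by
    simp only [hz, Matrix.mulVec, dotProduct, Finset.mul_sum, mul_assoc]
  have h2 : star z = ∑ i, ∑ j, (ε j : ℂ) * star (x i) * T i j * x j := by
    rw [h1, star_sum]
    simp only [star_sum]
    rw [Finset.sum_comm]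
    refine Finset.sum_congr rfl fun i _ => Finset.sum_congr rfl fun j _ => ?_
    have h3 : star (T j i) = T i j := hT.apply i j
    have h5 : star (ε j : ℂ) = ε j := Complex.conj_ofReal _
    simp only [star_mul', star_star, h3, h5]
    ring
  have h4 : z + star z = ∑ i, ((2 * (ε i * (T i i).re * ‖x i‖ ^ 2) : ℝ) : ℂ) := by
    rw [h2, h1, ← Finset.sum_add_distrib]
    refine Finset.sum_congr rfl fun i _ => ?_
    rw [← Finset.sum_add_distrib, Finset.sum_eq_single i]
    · have h5 : ((T i i).re : ℂ) = T i i := hT.coe_re_apply_self i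
      have h6 : star (x i) * x i = ((‖x i‖ ^ 2 : ℝ) : ℂ) := by
        push_cast; exact Complex.conj_mul' (x i)
      have h7 : ((2 * (ε i * (T i i).re * ‖x i‖ ^ 2) : ℝ) : ℂ)
          = 2 * (ε i * T i i * ((‖x i‖ ^ 2 : ℝ) : ℂ)) := by
        rw [← h5]; push_cast; simp
      rw [h7, ← h6]; ring
    · intro j _ hj
      have := hε i j hj.symm
      push_cast at this
      linear_combination star (x i) * x j * this
    · simp
  have h8 := congrArg Complex.re h4
  rw [← Complex.ofReal_sum, Complex.ofReal_re, ← Finset.mul_sum] at h8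
  have : (z + star z).re = 2 * z.re := by
    rw [Complex.add_re]; simp; ring
  linarith

variable {n m p : ℕ}

/-- The signs `(1, -1, -1, 1)` of the four blocks. -/
def blockSign : BIdx n m p → ℝ
  | .inl _ => 1
  | .inr (.inl _) => -1
  | .inr (.inr (.inl _)) => -1
  | .inr (.inr (.inr _)) => 1

/-- The pencil `L - Λ_λ`. -/
def pencil (h : ℝ[X]) (U : Matrix (Fin n) (Fin p) ℝ) (lam : ℝ) (g : GIdx n m p → ℝ) :
    Matrix (BIdx n m p) (BIdx n m p) ℂ :=
  cMat n m p + gaussMat gRow gCol (gCoef m h U) g - Matrix.diagonal (specPoint n m p lam 0)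

lemma gaussMat_apply_eq_zero (s : GIdx n m p → ℝ) (g : GIdx n m p → ℝ) {i j : BIdx n m p}
    (hij : blockSign i = blockSign j) : gaussMat gRow gCol s g i j = 0 := by
  rw [gaussMat, Matrix.sum_apply]
  refine Finset.sum_eq_zero fun e _ => ?_
  have : ∀ e : GIdx n m p, blockSign (gRow e) ≠ blockSign (gCol e) := by
    rintro (e | e | e) <;> norm_num [gRow, gCol, blockSign]
  simp only [coefMat, Matrix.smul_apply, Matrix.add_apply, Matrix.single_apply]
  rw [if_neg, if_neg]
  · simp
  · rintro ⟨rfl, rfl⟩; exact this e hij.symm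
  · rintro ⟨rfl, rfl⟩; exact this e hij

lemma gaussMat_apply_inr_inr (s : GIdx n m p → ℝ) (g : GIdx n m p → ℝ) (i j : Fin p ⊕ Fin p) :
    gaussMat gRow gCol s g (.inr (.inr i) : BIdx n m p) (.inr (.inr j)) = 0 := by
  rw [gaussMat, Matrix.sum_apply]
  refine Finset.sum_eq_zero fun e _ => ?_
  rcases e with e | e | e <;> simp [coefMat, gRow, gCol]

/-- Here `x` and `y` are the lengths of a vector and of its image, `r` the length of its first two
blocks. Eliminating `r` gives `x² ≤ B y x + 2y²`, which is impossible when `x > (B + 2) y`. -/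
lemma twoBlock_lower_bound {lam τ r y x : ℝ} (hlam : 0 < lam) (hy : 0 ≤ y)
    (hx : 0 ≤ x) (h1 : min lam 1 * r ^ 2 ≤ y * x)
    (h2 : x ^ 2 ≤ r ^ 2 + (2 * τ ^ 2 * r ^ 2 + 2 * y ^ 2)) :
    ((1 + 2 * τ ^ 2) / min lam 1 + 2)⁻¹ * x ≤ y := by
  set B := (1 + 2 * τ ^ 2) / min lam 1 with hB
  have hm : 0 < min lam 1 := lt_min hlam one_pos
  have hB0 : 0 ≤ B := by positivity
  rw [inv_mul_le_iff₀ (by positivity)]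
  by_contra! hlt
  have h3 : (1 + 2 * τ ^ 2) * r ^ 2 ≤ B * (y * x) := by
    rw [hB, div_mul_eq_mul_div, le_div_iff₀ hm]
    nlinarith [mul_le_mul_of_nonneg_left h1 (by positivity : 0 ≤ 1 + 2 * τ ^ 2)]
  have hx0 : 0 < x := lt_of_le_of_lt (by positivity) hlt
  have h4 : (B + 2) * y * x < x * x := by nlinarith
  nlinarith [mul_nonneg hB0 hy, mul_nonneg hy hx]

lemma pencil_isHermitian (h : ℝ[X]) (U : Matrix (Fin n) (Fin p) ℝ) (lam : ℝ)
    (g : GIdx n m p → ℝ) : (pencil h U lam g).IsHermitian := by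
  refine (cMat_isHermitian.add (gaussMat_isHermitian _ _ _ g)).sub
    (Matrix.isHermitian_diagonal_iff.2 fun i => ?_)
  rcases i with i | i <;> simp [specPoint, isSelfAdjoint_iff]

/-- With the signs `(1, -1, -1, 1)`, every Gaussian block and both `-I_p` blocks join blocks of
opposite sign, so they drop out of the real part of the twisted form. What survives is `λ` on the
first block and `(-1)(-1) = 1` on the second: this controls those two blocks of `x`. The last two
rows of the equation then express the remaining blocks through the image and through `H` applied to
the first two. -/
lemma pencil_lower_bound (h : ℝ[X]) (U : Matrix (Fin n) (Fin p) ℝ) {lam τ : ℝ} (hlam : 0 < lam)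
    (g : GIdx n m p → ℝ) (hg : ‖gaussMat gRow gCol (gCoef m h U) g‖ ≤ τ) (x : BIdx n m p → ℂ) :
    ((1 + 2 * τ ^ 2) / min lam 1 + 2)⁻¹ * vnorm x ≤ vnorm (pencil h U lam g *ᵥ x) := by
  set T := pencil h U lam g with hT
  set H := gaussMat gRow gCol (gCoef m h U) g with hH
  set y := T *ᵥ x with hy
  set x' : BIdx n m p → ℂ := Sum.elim (fun i => x (.inl i)) (Sum.elim (fun i => x (.inr (.inl i))) 0)
    with hx'
  have hr : vnorm x' ^ 2 = ∑ i, ‖x (.inl i)‖ ^ 2 + ∑ i, ‖x (.inr (.inl i))‖ ^ 2 := by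
    rw [vnorm_sq]; simp [hx', Fintype.sum_sum_type]
  refine twoBlock_lower_bound (r := vnorm x') hlam (vnorm_nonneg _)
    (vnorm_nonneg _) ?_ ?_
  · have hq := re_twisted_quadForm (pencil_isHermitian h U lam g) blockSign (fun i j hij => ?_) x
    · have h1 : min lam 1 * vnorm x' ^ 2
          ≤ ∑ i, blockSign i * (T i i).re * ‖x i‖ ^ 2 := by
        rw [hr, Fintype.sum_sum_type, Fintype.sum_sum_type, Fintype.sum_sum_type, mul_add,
          Finset.mul_sum, Finset.mul_sum]
        have hd : ∀ i : BIdx n m p, T i i = cMat n m p i i - specPoint n m p lam 0 i := by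
          intro i
          rw [hT, pencil, Matrix.sub_apply, Matrix.add_apply, gaussMat_apply_eq_zero _ _ rfl]
          simp
        have h3 : ∑ i : Fin p, blockSign (.inr (.inr (.inl i)) : BIdx n m p)
            * (T (.inr (.inr (.inl i))) (.inr (.inr (.inl i)))).re
            * ‖x (.inr (.inr (.inl i)))‖ ^ 2 = 0 :=
          Finset.sum_eq_zero fun i _ => by rw [hd]; simp [cMat, specPoint]
        have h4 : ∑ i : Fin p, blockSign (.inr (.inr (.inr i)) : BIdx n m p)
            * (T (.inr (.inr (.inr i))) (.inr (.inr (.inr i)))).re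
            * ‖x (.inr (.inr (.inr i)))‖ ^ 2 = 0 :=
          Finset.sum_eq_zero fun i _ => by rw [hd]; simp [cMat, specPoint]
        rw [h3, h4, add_zero, add_zero]
        refine add_le_add (Finset.sum_le_sum fun i _ => ?_) (Finset.sum_le_sum fun i _ => ?_)
        · refine mul_le_mul_of_nonneg_right ?_ (by positivity)
          rw [hd]; simp [cMat, specPoint, blockSign]
        · refine mul_le_mul_of_nonneg_right ?_ (by positivity)
          rw [hd]; simp [cMat, specPoint, blockSign]
      refine h1.trans (hq ▸ ((Complex.re_le_norm _).trans ?_))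
      refine (norm_sum_mul_le (fun i => (blockSign i : ℂ) * star (x i)) y).trans (le_of_eq ?_)
      rw [mul_comm]
      congr 1
      have : ∀ i : BIdx n m p, |blockSign i| = 1 := by
        rintro (i | i | i | i) <;> simp [blockSign]
      simp [vnorm, this]
    · by_cases hs : blockSign i = blockSign j
      · have h0 : pencil h U lam g i j = cMat n m p i j := by
          rw [pencil, Matrix.sub_apply, Matrix.add_apply, gaussMat_apply_eq_zero _ _ hs,
            Matrix.diagonal_apply_ne _ hij]
          simp
        rw [h0]
        rcases i with i | i | i | i <;> rcases j with j | j | j | j <;>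
          first
          | (norm_num [blockSign] at hs; done)
          | (simp [cMat]; done)
          | (simp only [cMat]; rw [Matrix.one_apply_ne (fun e => hij (by rw [e]))]; simp)
      · have : blockSign i + blockSign j = 0 := by
          rcases i with i | i | i | i <;> rcases j with j | j | j | j <;>
            simp_all [blockSign]
        rw [this]; simp
  · have hH2 : vnorm (H *ᵥ x') ^ 2 ≤ τ ^ 2 * vnorm x' ^ 2 := by
      rw [← mul_pow]
      exact pow_le_pow_left₀ (vnorm_nonneg _) ((vnorm_mulVec_le _ _).trans
        (mul_le_mul_of_nonneg_right hg (vnorm_nonneg _))) 2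
    -- `H` vanishes on the lower right two-by-two array of blocks, so these rows of `H x` see only
    -- the truncation `x'`.
    have hHx : ∀ i : Fin p ⊕ Fin p, (H *ᵥ x) (.inr (.inr i)) = (H *ᵥ x') (.inr (.inr i)) := by
      intro i
      simp only [Matrix.mulVec, dotProduct, Fintype.sum_sum_type (α₁ := Fin n),
        Fintype.sum_sum_type (α₁ := Fin m), hH, gaussMat_apply_inr_inr, hx']
      simp
    have hyx : ∀ i : Fin p ⊕ Fin p,
        ‖x (.inr (.inr i.swap))‖ ^ 2 ≤ 2 * ‖(H *ᵥ x') (.inr (.inr i))‖ ^ 2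
          + 2 * ‖y (.inr (.inr i))‖ ^ 2 := by
      intro i
      have h1 : (cMat n m p *ᵥ x) (.inr (.inr i)) = -x (.inr (.inr i.swap)) := by
        rcases i with i | i <;>
          simp [Matrix.mulVec, dotProduct, Fintype.sum_sum_type, cMat, Matrix.one_apply]
      have h2 : y (.inr (.inr i)) = -x (.inr (.inr i.swap)) + (H *ᵥ x') (.inr (.inr i)) := by
        rw [hy, hT, pencil, Matrix.sub_mulVec, Matrix.add_mulVec, Pi.sub_apply, Pi.add_apply, h1,
          hHx, Matrix.mulVec_diagonal]
        simp [specPoint]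
      have h3 : ‖x (.inr (.inr i.swap))‖ ≤ ‖(H *ᵥ x') (.inr (.inr i))‖ + ‖y (.inr (.inr i))‖ := by
        have : x (.inr (.inr i.swap)) = (H *ᵥ x') (.inr (.inr i)) - y (.inr (.inr i)) := by
          rw [h2]; ring
        rw [this]; exact norm_sub_le _ _
      nlinarith [norm_nonneg (x (.inr (.inr i.swap))),
        sq_nonneg (‖(H *ᵥ x') (.inr (.inr i))‖ - ‖y (.inr (.inr i))‖)]
    have htail : ∀ z : BIdx n m p → ℂ, ∑ i : Fin p ⊕ Fin p, ‖z (.inr (.inr i))‖ ^ 2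
        ≤ vnorm z ^ 2 := by
      intro z
      rw [vnorm_sq, Fintype.sum_sum_type (α₁ := Fin n), Fintype.sum_sum_type (α₁ := Fin m)]
      have h1 : 0 ≤ ∑ i : Fin n, ‖z (.inl i)‖ ^ 2 := by positivity
      have h2 : 0 ≤ ∑ i : Fin m, ‖z (.inr (.inl i))‖ ^ 2 := by positivity
      linarith
    have hsum : ∑ i : Fin p ⊕ Fin p, ‖x (.inr (.inr i))‖ ^ 2
        ≤ 2 * (τ ^ 2 * vnorm x' ^ 2) + 2 * vnorm y ^ 2 := by
      calc ∑ i : Fin p ⊕ Fin p, ‖x (.inr (.inr i))‖ ^ 2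
          = ∑ i : Fin p ⊕ Fin p, ‖x (.inr (.inr i.swap))‖ ^ 2 :=
            ((Equiv.sumComm (Fin p) (Fin p)).sum_comp
              fun i => ‖x (.inr (.inr i))‖ ^ 2).symm
        _ ≤ ∑ i : Fin p ⊕ Fin p, (2 * ‖(H *ᵥ x') (.inr (.inr i))‖ ^ 2
              + 2 * ‖y (.inr (.inr i))‖ ^ 2) := Finset.sum_le_sum fun i _ => hyx i
        _ = 2 * ∑ i : Fin p ⊕ Fin p, ‖(H *ᵥ x') (.inr (.inr i))‖ ^ 2
              + 2 * ∑ i : Fin p ⊕ Fin p, ‖y (.inr (.inr i))‖ ^ 2 := by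
            rw [Finset.sum_add_distrib, ← Finset.mul_sum, ← Finset.mul_sum]
        _ ≤ 2 * (τ ^ 2 * vnorm x' ^ 2) + 2 * vnorm y ^ 2 := by
            have := htail (H *ᵥ x')
            have := htail y
            linarith
    have hx2 : vnorm x ^ 2 = vnorm x' ^ 2 + ∑ i : Fin p ⊕ Fin p, ‖x (.inr (.inr i))‖ ^ 2 := by
      rw [hr, vnorm_sq, Fintype.sum_sum_type, Fintype.sum_sum_type (α₁ := Fin m), add_assoc]
    linarith

/-- On the event `‖H‖ ≤ τ`, the resolvent is bounded uniformly up to the real axis. -/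
theorem gaussRes_specPoint_bounds (h : ℝ[X]) (U : Matrix (Fin n) (Fin p) ℝ) {lam τ η : ℝ}
    (hlam : 0 < lam) (hη : 0 < η) (g : GIdx n m p → ℝ)
    (hg : ‖gaussMat gRow gCol (gCoef m h U) g‖ ≤ τ) {K : ℝ}
    (hK : K = (1 + 2 * τ ^ 2) / min lam 1 + 2) :
    ‖gaussRes (cMat n m p) gRow gCol (gCoef m h U) (specPoint n m p lam η) g‖ ≤ 2 * K ∧
    ‖gaussRes (cMat n m p) gRow gCol (gCoef m h U) (specPoint n m p lam η) g
      - gaussRes (cMat n m p) gRow gCol (gCoef m h U) (specPoint n m p lam 0) g‖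
      ≤ 2 * K ^ 2 * η := by
  have hm : 0 < min lam 1 := lt_min hlam one_pos
  have hK0 : 0 < K := by rw [hK]; positivity
  obtain ⟨hu0, hn0⟩ := inv_of_lower_bound (by positivity) (pencil_lower_bound h U hlam g hg)
  rw [inv_inv, ← hK] at hn0
  have hη' : ∀ i, η ≤ (specPoint n m p lam η i).im := by
    rintro (i | i) <;> simp [specPoint]
  obtain ⟨hu, hn⟩ := gaussRes_spec (C := cMat n m p) (a := gRow) (b := gCol)
    (s := gCoef m h U) cMat_isHermitian hη hη' g
  set Q := gaussRes (cMat n m p) gRow gCol (gCoef m h U) (specPoint n m p lam η) g with hQ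
  set Q0 := gaussRes (cMat n m p) gRow gCol (gCoef m h U) (specPoint n m p lam 0) g with hQ0
  replace hn0 : ‖Q0‖ ≤ K := hn0
  have hdiff : Q - Q0 = ((η : ℂ) * Complex.I) • (Q * Q0) := by
    have h1 : Q * (cMat n m p + gaussMat gRow gCol (gCoef m h U) g
        - Matrix.diagonal (specPoint n m p lam η)) = 1 := Matrix.nonsing_inv_mul _ hu
    have h2 : (cMat n m p + gaussMat gRow gCol (gCoef m h U) g
        - Matrix.diagonal (specPoint n m p lam 0)) * Q0 = 1 := Matrix.mul_nonsing_inv _ hu0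
    have h3 : Matrix.diagonal (specPoint n m p lam η)
        = Matrix.diagonal (specPoint n m p lam 0) + ((η : ℂ) * Complex.I) • 1 := by
      rw [← Matrix.diagonal_one, ← Matrix.diagonal_smul, Matrix.diagonal_add]
      congr 1; ext i
      rcases i with i | i <;> simp [specPoint]
    set A0 := cMat n m p + gaussMat gRow gCol (gCoef m h U) g
        - Matrix.diagonal (specPoint n m p lam 0) with hA0
    have h4 : cMat n m p + gaussMat gRow gCol (gCoef m h U) g
        - Matrix.diagonal (specPoint n m p lam η) = A0 - ((η : ℂ) * Complex.I) • 1 := by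
      rw [h3, hA0]; abel
    rw [h4, mul_sub, Matrix.mul_smul, mul_one] at h1
    calc Q - Q0 = Q * (A0 * Q0) - (Q * A0 - ((η : ℂ) * Complex.I) • Q) * Q0 := by
          rw [h1, h2, mul_one, one_mul]
      _ = _ := by rw [sub_mul (Q * A0), mul_assoc, Matrix.smul_mul]; abel
  have hnd : ‖Q - Q0‖ ≤ η * (‖Q‖ * ‖Q0‖) := by
    rw [hdiff, norm_smul]
    have : ‖(η : ℂ) * Complex.I‖ = η := by simp [abs_of_pos hη]
    rw [this]; exact mul_le_mul_of_nonneg_left (norm_mul_le _ _) hη.le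
  -- Bootstrap: the trivial bound `‖Q‖ ≤ η⁻¹` cancels the `η` of the resolvent identity, so `‖Q -
  -- Q0‖ ≤ K`. The bound `2K` obtained here then makes the difference of order `η`.
  have hQ2 : ‖Q‖ ≤ 2 * K := by
    have h1 : η * (‖Q‖ * ‖Q0‖) ≤ K := by
      calc η * (‖Q‖ * ‖Q0‖) ≤ η * (η⁻¹ * K) := by gcongr
        _ = K := by field_simp
    have h2 : ‖Q‖ ≤ ‖Q - Q0‖ + ‖Q0‖ := by simpa using norm_add_le (Q - Q0) Q0
    linarith
  refine ⟨hQ2, hnd.trans ?_⟩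
  calc η * (‖Q‖ * ‖Q0‖) ≤ η * (2 * K * K) := by gcongr
    _ = _ := by ring

end LowerBound

/-! ### From the mean resolvent to the square equivalent. -/

section MeanComparison

open scoped Matrix.Norms.L2Operator

variable {n m p : ℕ}

/-- The resolvent of the linearization, as a function of its Gaussian entries. -/
def linRes (m : ℕ) (h : ℝ[X]) (U : Matrix (Fin n) (Fin p) ℝ) (lam η : ℝ) (g : GIdx n m p → ℝ) :
    Matrix (BIdx n m p) (BIdx n m p) ℂ :=
  gaussRes (cMat n m p) gRow gCol (gCoef m h U) (specPoint n m p lam η) g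

/-- The mean of the resolvent of the linearization. -/
def linMean (m : ℕ) (h : ℝ[X]) (U : Matrix (Fin n) (Fin p) ℝ) (lam η : ℝ) :
    Matrix (BIdx n m p) (BIdx n m p) ℂ :=
  meanRes (cMat n m p) gRow gCol (gCoef m h U) (specPoint n m p lam η)

lemma le_im_specPoint (lam η : ℝ) (i : BIdx n m p) : η ≤ (specPoint n m p lam η i).im := by
  rcases i with i | i <;> simp [specPoint]

/-- The bound `K` for the resolvent at the real axis on the event `‖H‖ ≤ τ`. -/
def resBound (lam τ : ℝ) : ℝ := (1 + 2 * τ ^ 2) / min lam 1 + 2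

lemma resBound_pos {lam : ℝ} (hlam : 0 < lam) (τ : ℝ) : 0 < resBound lam τ := by
  have : 0 < min lam 1 := lt_min hlam one_pos
  unfold resBound; positivity

/-- On the event `‖H‖ ≤ τ` the resolvent is at most `2K`; off it, the trivial bound `η⁻¹` meets an
exponentially small probability. -/
lemma norm_linMean_entry_le (h : ℝ[X]) (U : Matrix (Fin n) (Fin p) ℝ) {lam η σ : ℝ}
    (hlam : 0 < lam) (hη : 0 < η) (hσ0 : 0 ≤ σ)
    (hσ : ∀ i j, varProfile m h U i j ≤ σ / bigN n m p) (i j : BIdx n m p) :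
    ‖linMean m h U lam η i j‖ ≤ 2 * resBound lam (2 * (32 * σ + 7))
      + η⁻¹ * (2 * Real.exp (-bigN n m p)) := by
  set τ := 2 * (32 * σ + 7) with hτ
  set K := resBound lam τ with hK
  set H := gaussMat gRow gCol (gCoef m h U) with hH
  set B : Set (GIdx n m p → ℝ) := {g | τ ≤ ‖H g‖} with hB
  have hBm : MeasurableSet B := by
    have : Continuous fun g => ‖H g‖ := (continuous_gaussMat _ _ _).norm
    exact measurableSet_le measurable_const this.measurable
  have hP : stdG (GIdx n m p) B ≤ ENNReal.ofReal (2 * Real.exp (-bigN n m p)) := by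
    rw [← card_BIdx]
    refine measure_norm_gaussMat_ge_le _ _ _ hσ0 ?_
    rw [gaussVar_eq_varProfile, card_BIdx]; exact hσ
  have hP' : (stdG (GIdx n m p)).real B ≤ 2 * Real.exp (-bigN n m p) :=
    ENNReal.toReal_le_of_le_ofReal (by positivity) hP
  have hpt : ∀ g, ‖linRes m h U lam η g i j‖ ≤ 2 * K + B.indicator (fun _ => η⁻¹) g := by
    intro g
    by_cases hg : g ∈ B
    · rw [Set.indicator_of_mem hg]
      have h1 := norm_gaussRes_entry_le (a := gRow) (b := gCol) (s := gCoef m h U)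
        (cMat_isHermitian (n := n) (m := m) (p := p)) hη (le_im_specPoint lam η) g i j
      have := resBound_pos hlam τ
      refine h1.trans ?_; linarith
    · rw [Set.indicator_of_notMem hg, add_zero]
      have hg' : ‖H g‖ ≤ τ := by
        rw [hB, Set.mem_ofPred_eq, not_le] at hg; exact hg.le
      exact (entry_le_norm _ i j).trans (gaussRes_specPoint_bounds h U hlam hη g hg' rfl).1
  have hind : Integrable (B.indicator fun _ => η⁻¹) (stdG (GIdx n m p)) :=
    (integrable_const _).indicator hBm
  calc ‖linMean m h U lam η i j‖
      ≤ ∫ g, (2 * K + B.indicator (fun _ => η⁻¹) g) ∂(stdG (GIdx n m p)) :=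
        norm_integral_le_of_norm_le ((integrable_const _).add hind) (ae_of_all _ hpt)
    _ = 2 * K + η⁻¹ * (stdG (GIdx n m p)).real B := by
        rw [integral_add (integrable_const _) hind, integral_indicator_const _ hBm]
        simp [mul_comm]
    _ ≤ _ := by gcongr

/-- Distance between the mean resolvent and the square equivalent, when the mean resolvent is
bounded by `K` and solves the Dyson equation up to an error `ε`. -/
theorem norm_idDelta_linMean_sub_le {h : ℝ[X]} {U : Matrix (Fin n) (Fin p) ℝ}
    {G : (BIdx n m p → ℂ) → Matrix (BIdx n m p) (BIdx n m p) ℂ} (hG : IsSquareEquivalent h U G)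
    {lam η σ K ε : ℝ} (hlam : 0 ≤ lam) (hη : 0 < η) (hσ0 : 0 ≤ σ)
    (hσ : ∀ i j, varProfile m h U i j ≤ σ / bigN n m p)
    (hK0 : 0 ≤ K) (hK : ∀ i, ‖linMean m h U lam η i i‖ ≤ K) (hε0 : 0 ≤ ε)
    (hε : ∀ i j, ‖((cMat n m p - Matrix.diagonal (shiftDiag (varProfile m h U)
        (specPoint n m p lam η) fun i => linMean m h U lam η i i)) * linMean m h U lam η - 1) i j‖
        ≤ ε)
    (hsmall : ε ≤ 1 / 4) (hsmall2 : 8 * ε * (1 + lam + η + σ * K) ≤ η / 2) :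
    ‖idDelta (linMean m h U lam η) - G (specPoint n m p lam η)‖
      ≤ 2 * (2 * (8 * ε * (1 + lam + η + σ * K)) / η * √(K * η⁻¹)) := by
  set M := linMean m h U lam η with hM
  set Λ := specPoint n m p lam η with hΛ
  set S := varProfile m h U with hS
  have hΛη : ∀ i, η ≤ (Λ i).im := le_im_specPoint lam η
  obtain ⟨hG1, hG2, hG3⟩ := hG.spec (Λ := Λ) fun i => hη.trans_le (hΛη i)
  set A := cMat n m p - Matrix.diagonal (shiftDiag S Λ fun i => M i i) with hA
  have hAb : IsBlock A := cMat_isBlock.sub_diagonal _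
  -- Projecting first is essential: the full error matrix is only small entrywise, but its
  -- projection `R` has at most two entries per row and is small in operator norm. Since `A` is in
  -- the fixed algebra, projection preserves the equation and gives `A M' = 1 + R`.
  set M' := idDelta M with hM'
  set R := idDelta (A * M - 1) with hR
  have hAM : A * M' = 1 + R := by
    rw [hR, idDelta_sub, idDelta_one, hAb.idDelta_mul]; abel
  have hRn : ‖R‖ ≤ 2 * ε := by
    refine (idDelta_isBlock _).norm_le hε0 fun i j => ?_
    rw [idDelta_apply]
    split_ifs
    · exact hε i j
    · simpa using hε0
  obtain ⟨hFu, hFn⟩ := inv_of_lower_bound (A := 1 + R) (c := 1 / 2) (by norm_num) fun x => by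
    have h1 : vnorm x ≤ vnorm ((1 + R) *ᵥ x) + vnorm (-(R *ᵥ x)) := by
      refine le_trans (le_of_eq ?_) (vnorm_add_le _ _)
      rw [Matrix.add_mulVec, Matrix.one_mulVec, add_neg_cancel_right]
    have h2 : vnorm (-(R *ᵥ x)) = vnorm (R *ᵥ x) := by simp [vnorm]
    have h3 := vnorm_mulVec_le R x
    have h4 : ‖R‖ * vnorm x ≤ 1 / 2 * vnorm x :=
      mul_le_mul_of_nonneg_right (by linarith) (vnorm_nonneg _)
    linarith
  set F := (1 + R)⁻¹ with hF
  have hF1 : (1 + R) * F = 1 := Matrix.mul_nonsing_inv _ hFu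
  have hF2 : F * (1 + R) = 1 := Matrix.nonsing_inv_mul _ hFu
  have hAn : ‖A‖ ≤ 2 * (1 + lam + η + σ * K) := by
    refine hAb.norm_le (by positivity) fun i j => ?_
    rw [hA, Matrix.sub_apply]
    have hd : ‖Matrix.diagonal (shiftDiag S Λ fun i => M i i) i j‖ ≤ lam + η + σ * K := by
      rw [Matrix.diagonal_apply]
      split_ifs
      · have h1 : ‖Λ i‖ ≤ lam + η := by
          rcases i with i | i
          · refine (norm_add_le _ _).trans (le_of_eq ?_)
            simp [abs_of_nonneg hlam, abs_of_pos hη]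
          · simp [hΛ, specPoint, abs_of_pos hη]; exact hlam
        have hNn : bigN n m p * (σ / bigN n m p * K) ≤ σ * K := by
          rcases eq_or_ne (bigN n m p) 0 with h0 | h0
          · rw [h0]; simp; positivity
          · exact le_of_eq (by field_simp)
        have h2 : ‖∑ k, (S i k : ℂ) * M k k‖ ≤ σ * K := by
          refine (norm_sum_le _ _).trans (le_trans (Finset.sum_le_sum fun k _ => ?_)
            (le_trans (le_of_eq (b := ∑ _ : BIdx n m p, σ / bigN n m p * K) rfl) ?_))
          · rw [norm_mul, Complex.norm_real, Real.norm_of_nonneg (varProfile_nonneg h U i k)]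
            exact mul_le_mul (hσ i k) (hK k) (norm_nonneg _) (div_nonneg hσ0 bigN_nonneg)
          · rw [Finset.sum_const, Finset.card_univ, nsmul_eq_mul, card_BIdx]; exact hNn
        exact (norm_add_le _ _).trans (add_le_add h1 h2)
      · rw [norm_zero]; positivity
    have := norm_cMat_entry_le i j
    refine (norm_sub_le _ _).trans ?_
    linarith
  -- Moves the error into the coefficient: `A - D = F A`, so `M'` is an exact inverse of the
  -- perturbed matrix, as stability requires. The factor 8 comes from `‖F‖ ≤ 2`, `‖R‖ ≤ 2ε` and the
  -- 2 in the bound on `‖A‖`.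
  set D := F * R * A with hD
  have hDn : ‖D‖ ≤ 8 * ε * (1 + lam + η + σ * K) := by
    have hF' : ‖F‖ ≤ 2 := by norm_num at hFn; exact hFn
    calc ‖D‖ ≤ ‖F‖ * ‖R‖ * ‖A‖ :=
          (norm_mul_le _ _).trans (mul_le_mul_of_nonneg_right (norm_mul_le _ _) (norm_nonneg _))
      _ ≤ 2 * (2 * ε) * (2 * (1 + lam + η + σ * K)) := by gcongr
      _ = _ := by ring
  have hAD : A - D = F * A := by
    rw [hD]
    calc A - F * R * A = F * (1 + R) * A - F * R * A := by rw [hF2, one_mul]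
      _ = F * A := by rw [mul_add, add_mul, mul_one]; abel
  have hMA : M' * (A - D) = 1 := by
    rw [hAD]
    have h1 : A * (M' * F) = 1 := by rw [← mul_assoc, hAM, hF1]
    rw [← mul_assoc]
    exact mul_eq_one_comm.1 h1
  have hdiag : ∀ i, M' i i = M i i := fun i => idDelta_diag M i
  have hMim : ∀ i, 0 ≤ (M' i i).im := by
    intro i
    rw [hdiag]
    have hi := integrable_gaussRes_entry (a := gRow) (b := gCol) (s := gCoef m h U)
      (cMat_isHermitian (n := n) (m := m) (p := p)) hη hΛη i i
    have h1 : (M i i).im = ∫ g, (linRes m h U lam η g i i).im ∂(stdG (GIdx n m p)) :=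
      (integral_im hi).symm
    rw [h1]
    exact integral_nonneg fun g => gaussRes_im_nonneg cMat_isHermitian hη hΛη g i
  have hGn : ‖G Λ‖ ≤ η⁻¹ := by
    have hw : ∀ i, η ≤ (shiftDiag S Λ (fun i => G Λ i i) i).im := by
      intro i
      rw [im_shiftDiag]
      have := sum_mul_im_nonneg (varProfile_nonneg h U) (fun i => (hG3 i).le) i
      linarith [hΛη i]
    have h1 := (inv_sub_diagonal cMat_isHermitian hη hw).2
    rwa [Matrix.inv_eq_right_inv hG1] at h1
  refine (IsBlock.norm_le (A := M' - G Λ) ?_ (by positivity) fun i j => ?_)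
  · intro i j hij
    rw [Matrix.sub_apply, hM', idDelta_isBlock M i j hij]
    have : idDelta (G Λ) = G Λ := by
      rw [hG.fixed_point Λ fun i => hη.trans_le (hΛη i)]
      exact (idDelta_isBlock _).idDelta_eq
    rw [← this, idDelta_isBlock _ i j hij, sub_zero]
  · have hst := dyson_stability (C := cMat n m p) (D := D) (M := M') (G := G Λ) cMat_isHermitian
      (varProfile_nonneg h U) hη hΛη (hDn.trans hsmall2)
      (by simp only [hdiag]; exact hMA) hG1 hMim (fun i => (hG3 i).le) i j
    refine hst.trans ?_
    -- Only one of the two imaginary parts costs `η⁻¹`: the one from the mean is bounded by `K`.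
    have h1 : (M' i i).im ≤ K := by
      rw [hdiag]; exact (le_abs_self _).trans ((Complex.abs_im_le_norm _).trans (hK i))
    have h2 : (G Λ j j).im ≤ η⁻¹ := (le_abs_self _).trans
      ((Complex.abs_im_le_norm _).trans ((entry_le_norm _ j j).trans hGn))
    have h3 : (M' i i).im * (G Λ j j).im ≤ K * η⁻¹ := mul_le_mul h1 h2 (hG3 j).le hK0
    gcongr

end MeanComparison

/-! ### Bounds on the variance profile and on `γ_max`. -/

section Profile

lemma integrable_abs_pow_gaussianReal (k : ℕ) :
    Integrable (fun x : ℝ => |x| ^ k) (gaussianReal 0 1) := by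
  have h := (memLp_id_gaussianReal (μ := 0) (v := 1) (k : NNReal)).integrable_norm_pow'
  simpa using h

/-- Gaussian means of a polynomial of `ξ d` are bounded for bounded `d`. -/
lemma exists_integral_eval_le (q : ℝ[X]) (γ : ℝ) :
    ∃ B : ℝ, 0 ≤ B ∧ ∀ d, 0 ≤ d → d ≤ γ → |∫ x, q.eval (x * d) ∂(gaussianReal 0 1)| ≤ B := by
  have hint : Integrable (fun x : ℝ => ∑ k ∈ Finset.range (q.natDegree + 1),
      |q.coeff k| * γ ^ k * |x| ^ k) (gaussianReal 0 1) :=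
    integrable_finsetSum _ fun k _ => (integrable_abs_pow_gaussianReal k).const_mul _
  refine ⟨|∫ x, ∑ k ∈ Finset.range (q.natDegree + 1), |q.coeff k| * γ ^ k * |x| ^ k
    ∂(gaussianReal 0 1)|, abs_nonneg _, fun d hd0 hd => ?_⟩
  refine le_trans ?_ (le_abs_self _)
  rw [← Real.norm_eq_abs]
  refine norm_integral_le_of_norm_le hint (ae_of_all _ fun x => ?_)
  rw [Polynomial.eval_eq_sum_range]
  refine (norm_sum_le _ _).trans (Finset.sum_le_sum fun k _ => ?_)
  rw [norm_mul, norm_pow, norm_mul, Real.norm_eq_abs, Real.norm_eq_abs, Real.norm_eq_abs,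
    abs_of_nonneg hd0, mul_pow, mul_assoc, mul_comm (|x| ^ k)]
  gcongr

lemma HasBoundedFactorization.abs_le {n p : ℕ} {γ : ℝ} (hγ : 0 ≤ γ)
    {U : Matrix (Fin n) (Fin p) ℝ} (hU : HasBoundedFactorization γ U) (i : Fin n) (j : Fin p) :
    |U i j| ≤ γ := by
  obtain ⟨r, A, B, rfl, hA, hB⟩ := hU
  rw [Matrix.mul_apply]
  calc |∑ k, Aᵀ i k * B k j| ≤ ∑ k, |A k i| * |B k j| := by
        refine (Finset.abs_sum_le_sum_abs _ _).trans (le_of_eq ?_)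
        simp [abs_mul]
    _ ≤ √(∑ k, |A k i| ^ 2) * √(∑ k, |B k j| ^ 2) := Real.sum_mul_le_sqrt_mul_sqrt _ _ _
    _ ≤ √γ * √γ := by
        simp only [sq_abs]
        exact mul_le_mul (hA i) (hB j) (Real.sqrt_nonneg _) (Real.sqrt_nonneg _)
    _ = γ := Real.mul_self_sqrt hγ

lemma dTwo_le {n p : ℕ} {γ : ℝ} (hγ : 0 ≤ γ) {U : Matrix (Fin n) (Fin p) ℝ}
    (hU : ∀ i j, |U i j| ≤ γ) (i : Fin n) : dTwo U i ≤ γ := by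
  refine Real.sqrt_le_iff.2 ⟨hγ, ?_⟩
  have h1 : ∑ j, U i j ^ 2 ≤ p * γ ^ 2 := by
    calc ∑ j, U i j ^ 2 ≤ ∑ _j : Fin p, γ ^ 2 := Finset.sum_le_sum fun j _ => by
          rw [← sq_abs]; exact pow_le_pow_left₀ (abs_nonneg _) (hU i j) 2
      _ = _ := by simp
  rcases Nat.eq_zero_or_pos p with rfl | hp
  · simp; positivity
  · have : (0 : ℝ) < p := by exact_mod_cast hp
    rw [div_le_iff₀ this]; linarith

lemma exists_dLin_dChaos_le (h : ℝ[X]) {γ : ℝ} (hγ : 0 ≤ γ) :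
    ∃ B : ℝ, 0 ≤ B ∧ ∀ (n p : ℕ) (U : Matrix (Fin n) (Fin p) ℝ), (∀ i j, |U i j| ≤ γ) →
      ∀ i, |dLin h U i| ≤ B ∧ |dChaos h U i| ≤ B := by
  choose B hB0 hB using fun l : ℕ => exists_integral_eval_le (Polynomial.derivative^[l] h) γ
  refine ⟨B 1 + ∑ l ∈ Finset.Icc 2 h.natDegree, 1 / (l.factorial : ℝ) * B l, ?_,
    fun n p U hU i => ?_⟩
  · exact add_nonneg (hB0 1) (Finset.sum_nonneg fun l _ => mul_nonneg (by positivity) (hB0 l))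
  · have h0 : 0 ≤ ∑ l ∈ Finset.Icc 2 h.natDegree, 1 / (l.factorial : ℝ) * B l :=
      Finset.sum_nonneg fun l _ => mul_nonneg (by positivity) (hB0 l)
    have hd := dTwo_le hγ hU i
    have hd0 : 0 ≤ dTwo U i := Real.sqrt_nonneg _
    constructor
    · have : |dLin h U i| ≤ B 1 := hB 1 _ hd0 hd
      linarith
    · have : |dChaos h U i| ≤ ∑ l ∈ Finset.Icc 2 h.natDegree, 1 / (l.factorial : ℝ) * B l := by
        refine (Finset.abs_sum_le_sum_abs _ _).trans (Finset.sum_le_sum fun l _ => ?_)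
        rw [abs_mul, abs_of_nonneg (by positivity : (0 : ℝ) ≤ 1 / (l.factorial : ℝ))]
        exact mul_le_mul_of_nonneg_left (hB l _ hd0 hd) (by positivity)
      have := hB0 1
      linarith

variable {n m p : ℕ}

lemma profileL_sq_le {h : ℝ[X]} {U : Matrix (Fin n) (Fin p) ℝ} {γ B : ℝ}
    (hU : ∀ i j, |U i j| ≤ γ) (hB : ∀ i, |dLin h U i| ≤ B ∧ |dChaos h U i| ≤ B)
    (i j : BIdx n m p) :
    profileL m h U i j ^ 2
      ≤ (bigN n m p / n + bigN n m p / p) * (B ^ 2 + B ^ 2 * γ ^ 2 + 1) := by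
  have hN : 0 ≤ bigN n m p := bigN_nonneg
  have h1 : 0 ≤ bigN n m p / n := by positivity
  have h2 : 0 ≤ bigN n m p / p := by positivity
  have hL : ∀ i, dLin h U i ^ 2 ≤ B ^ 2 := fun i => by
    rw [← sq_abs]; exact pow_le_pow_left₀ (abs_nonneg _) (hB i).1 2
  have hC : ∀ i, dChaos h U i ^ 2 ≤ B ^ 2 := fun i => by
    rw [← sq_abs]; exact pow_le_pow_left₀ (abs_nonneg _) (hB i).2 2
  have hU2 : ∀ i j, U i j ^ 2 ≤ γ ^ 2 := fun i j => by
    rw [← sq_abs]; exact pow_le_pow_left₀ (abs_nonneg _) (hU i j) 2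
  have hBg : 0 ≤ B ^ 2 * γ ^ 2 := by positivity
  have hB2 : 0 ≤ B ^ 2 := by positivity
  set a := bigN n m p / n with ha
  set b := bigN n m p / p with hb
  have key : ∀ t s : ℝ, 0 ≤ s → s ≤ a + b → t ≤ B ^ 2 + B ^ 2 * γ ^ 2 + 1 → 0 ≤ t →
      s * t ≤ (a + b) * (B ^ 2 + B ^ 2 * γ ^ 2 + 1) := fun t s _ h4 h5 h6 =>
    mul_le_mul h4 h5 h6 (by linarith)
  have kC : ∀ i, (√a * dChaos h U i) ^ 2 ≤ (a + b) * (B ^ 2 + B ^ 2 * γ ^ 2 + 1) := fun i => by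
    rw [mul_pow, Real.sq_sqrt h1]
    exact key _ _ h1 (by linarith) (by linarith [hC i]) (by positivity)
  have kL : ∀ i j, (√a * (dLin h U i * U i j)) ^ 2
      ≤ (a + b) * (B ^ 2 + B ^ 2 * γ ^ 2 + 1) := fun i j => by
    rw [mul_pow, Real.sq_sqrt h1, mul_pow]
    have := mul_le_mul (hL i) (hU2 i j) (by positivity) hB2
    exact key _ _ h1 (by linarith) (by linarith) (by positivity)
  have kW : √b ^ 2 ≤ (a + b) * (B ^ 2 + B ^ 2 * γ ^ 2 + 1) := by
    rw [Real.sq_sqrt h2]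
    have := key 1 b h2 (by linarith) (by linarith) zero_le_one
    linarith
  have k0 : (0 : ℝ) ^ 2 ≤ (a + b) * (B ^ 2 + B ^ 2 * γ ^ 2 + 1) := by
    rw [zero_pow two_ne_zero]; positivity
  rcases i with i | i | i | i <;> rcases j with j | j | j | j <;>
    first
    | exact k0
    | exact kC _
    | exact kL _ _
    | exact kW
    | (refine le_of_eq_of_le ?_ (kL j i); simp only [profileL, ← ha]; ring)

lemma profileL_sq_le_gammaMax_sq (h : ℝ[X]) (U : Matrix (Fin n) (Fin p) ℝ) (i j : BIdx n m p) :
    profileL m h U i j ^ 2 ≤ gammaMax m h U ^ 2 := by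
  have h1 : profileL m h U i j ^ 2
      ≤ ⨆ e : BIdx n m p × BIdx n m p, profileL m h U e.1 e.2 ^ 2 :=
    le_ciSup (f := fun e : BIdx n m p × BIdx n m p => profileL m h U e.1 e.2 ^ 2)
      (Set.finite_range _).bddAbove (i, j)
  rw [gammaMax, Real.sq_sqrt ((sq_nonneg _).trans h1)]
  exact h1

lemma gammaMax_sq_le {h : ℝ[X]} {U : Matrix (Fin n) (Fin p) ℝ} {B : ℝ} (hB0 : 0 ≤ B)
    (hB : ∀ i j, profileL m h U i j ^ 2 ≤ B) : gammaMax m h U ^ 2 ≤ B := by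
  have h1 : gammaMax m h U ≤ √B :=
    Real.sqrt_le_sqrt (Real.iSup_le (fun e => hB e.1 e.2) hB0)
  have h2 := pow_le_pow_left₀ (Real.sqrt_nonneg _) h1 2
  rwa [Real.sq_sqrt hB0] at h2

/-- The `𝒲` block contributes `c_p² = N/p ≥ 1` whatever the activation and the data profile. This
keeps `η_N` from being too small. -/
lemma one_le_gammaMax (h : ℝ[X]) (U : Matrix (Fin n) (Fin p) ℝ) (hm : 0 < m) (hp : 0 < p) :
    1 ≤ gammaMax m h U := by
  have h1 := profileL_sq_le_gammaMax_sq (m := m) h U (.inr (.inl ⟨0, hm⟩))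
    (.inr (.inr (.inr ⟨0, hp⟩)))
  have hp' : (0 : ℝ) < p := by exact_mod_cast hp
  have h2 : (1 : ℝ) ≤ bigN n m p / p := by
    rw [le_div_iff₀ hp', bigN]
    have : (0 : ℝ) ≤ n := Nat.cast_nonneg n
    have : (0 : ℝ) ≤ m := Nat.cast_nonneg m
    linarith
  have h3 : profileL m h U (.inr (.inl ⟨0, hm⟩)) (.inr (.inr (.inr ⟨0, hp⟩))) ^ 2
      = bigN n m p / p := Real.sq_sqrt (by positivity)
  rw [h3] at h1
  have h4 : 0 ≤ gammaMax m h U := Real.sqrt_nonneg _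
  nlinarith

lemma etaN_pow_five {h : ℝ[X]} {U : Matrix (Fin n) (Fin p) ℝ} {δ κ : ℝ} (hn : 0 < n)
    (hδ : δ < 1) (hκ : 0 ≤ κ) :
    (n : ℝ) * etaN m h U δ κ ^ 5
      = gammaMax m h U ^ 2 * (2 * √2 * gammaMax m h U ^ 3 + κ) / (1 - δ) := by
  have h0 : 0 ≤ gammaMax m h U := Real.sqrt_nonneg _
  have hn' : (0 : ℝ) < n := by exact_mod_cast hn
  have hδ' : 0 < 1 - δ := by linarith
  have h1 : 0 ≤ gammaMax m h U ^ 2 / ((1 - δ) * n) * (2 * √2 * gammaMax m h U ^ 3 + κ) := by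
    positivity
  rw [etaN, ← Real.rpow_natCast, ← Real.rpow_mul h1]
  norm_num
  field_simp

end Profile

/-! ### Uniform constants in the proportional regime. -/

section Asymptotics

variable {m p : ℕ → ℕ} {φm φp : ℝ}

lemma eventually_pos_of_tendsto_div {q : ℕ → ℕ} {φ : ℝ} (hφ : 0 < φ)
    (hq : Tendsto (fun n : ℕ => (n : ℝ) / (q n : ℝ)) atTop (𝓝 φ)) : ∀ᶠ n in atTop, 0 < q n := by
  filter_upwards [hq.eventually_const_lt hφ] with n hn
  rcases Nat.eq_zero_or_pos (q n) with h | h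
  · simp [h] at hn
  · exact h

lemma exists_bigN_le (hφm : 0 < φm) (hφp : 0 < φp)
    (hm : Tendsto (fun n : ℕ => (n : ℝ) / (m n : ℝ)) atTop (𝓝 φm))
    (hp : Tendsto (fun n : ℕ => (n : ℝ) / (p n : ℝ)) atTop (𝓝 φp)) :
    ∃ R : ℝ, 0 < R ∧ ∀ᶠ n in atTop,
      bigN n (m n) (p n) / n ≤ R ∧ bigN n (m n) (p n) / p n ≤ R := by
  have hm' : Tendsto (fun n : ℕ => (m n : ℝ) / n) atTop (𝓝 φm⁻¹) :=
    (hm.inv₀ hφm.ne').congr fun n => inv_div _ _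
  have hp' : Tendsto (fun n : ℕ => (p n : ℝ) / n) atTop (𝓝 φp⁻¹) :=
    (hp.inv₀ hφp.ne').congr fun n => inv_div _ _
  have h1 : Tendsto (fun n : ℕ => bigN n (m n) (p n) / n) atTop (𝓝 (1 + φm⁻¹ + 2 * φp⁻¹)) := by
    refine ((tendsto_const_nhds.add hm').add (hp'.const_mul 2)).congr' ?_
    filter_upwards [eventually_gt_atTop 0] with n hn
    have : (0 : ℝ) < n := by exact_mod_cast hn
    rw [bigN]; field_simp
  have h2 : Tendsto (fun n : ℕ => bigN n (m n) (p n) / p n) atTop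
      (𝓝 ((1 + φm⁻¹ + 2 * φp⁻¹) * φp)) := by
    refine (h1.mul hp).congr' ?_
    filter_upwards [eventually_gt_atTop 0] with n hn
    have : (0 : ℝ) < n := by exact_mod_cast hn
    field_simp
  refine ⟨1 + φm⁻¹ + 2 * φp⁻¹ + (1 + φm⁻¹ + 2 * φp⁻¹) * φp, by positivity, ?_⟩
  filter_upwards [h1.eventually_le_const (u := 1 + φm⁻¹ + 2 * φp⁻¹ + (1 + φm⁻¹ + 2 * φp⁻¹) * φp)
      (lt_add_of_pos_right _ (by positivity)),
    h2.eventually_le_const (u := 1 + φm⁻¹ + 2 * φp⁻¹ + (1 + φm⁻¹ + 2 * φp⁻¹) * φp)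
      (lt_add_of_pos_left _ (by positivity))] with n h3 h4
  exact ⟨h3, h4⟩

/-- Uniform bounds for the variance profile and for `η_N`. -/
theorem exists_asymptotic_bounds (hφm : 0 < φm) (hφp : 0 < φp)
    (hm : Tendsto (fun n : ℕ => (n : ℝ) / (m n : ℝ)) atTop (𝓝 φm))
    (hp : Tendsto (fun n : ℕ => (n : ℝ) / (p n : ℝ)) atTop (𝓝 φp))
    (h : ℝ[X]) (U : ∀ n : ℕ, Matrix (Fin n) (Fin (p n)) ℝ) {γ : ℝ} (hγ : 0 < γ)
    (hU : ∀ n, HasBoundedFactorization γ (U n)) {δ κ : ℝ} (hδ0 : 0 < δ) (hδ1 : δ < 1)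
    (hκ : 0 < κ) :
    ∃ σ c C R : ℝ, 0 < σ ∧ 0 < c ∧ 0 < C ∧ 0 < R ∧ ∀ᶠ n : ℕ in atTop, 0 < n ∧
      (∀ i j, varProfile (m n) h (U n) i j ≤ σ / bigN n (m n) (p n)) ∧
      0 < etaN (m n) h (U n) δ κ ∧ c ≤ n * etaN (m n) h (U n) δ κ ^ 5 ∧
      n * etaN (m n) h (U n) δ κ ^ 5 ≤ C ∧ bigN n (m n) (p n) ≤ R * n := by
  obtain ⟨R, hR0, hR⟩ := exists_bigN_le hφm hφp hm hp
  obtain ⟨B, hB0, hB⟩ := exists_dLin_dChaos_le h hγ.le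
  have hUb : ∀ n i j, |U n i j| ≤ γ := fun n => (hU n).abs_le hγ.le
  have hδ' : 0 < 1 - δ := by linarith
  set σ := (R + R) * (B ^ 2 + B ^ 2 * γ ^ 2 + 1) with hσ
  have hσ0 : 0 < σ := by positivity
  -- By `etaN_pow_five`, `n η_N⁵` is increasing in `γ_max`. It is at least `κ` because `γ_max ≥ 1`
  -- and `1 - δ < 1`; the upper constant uses `γ_max² ≤ σ`.
  refine ⟨σ, κ, σ * (2 * √2 * √σ ^ 3 + κ) / (1 - δ), R, hσ0, hκ, by positivity, hR0, ?_⟩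
  filter_upwards [hR, eventually_gt_atTop 0, eventually_pos_of_tendsto_div hφm hm,
    eventually_pos_of_tendsto_div hφp hp] with n hRn hn hmn hpn
  have hn' : (0 : ℝ) < n := by exact_mod_cast hn
  have hprof : ∀ i j, profileL (m n) h (U n) i j ^ 2 ≤ σ := fun i j =>
    (profileL_sq_le (hUb n) (hB n (p n) (U n) (hUb n)) i j).trans
      (mul_le_mul_of_nonneg_right (add_le_add hRn.1 hRn.2) (by positivity))
  have hg1 : 1 ≤ gammaMax (m n) h (U n) := one_le_gammaMax h (U n) hmn hpn
  have hg2 : gammaMax (m n) h (U n) ^ 2 ≤ σ := gammaMax_sq_le hσ0.le hprof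
  have hg3 : gammaMax (m n) h (U n) ≤ √σ := Real.le_sqrt_of_sq_le hg2
  have h5 := etaN_pow_five (m := m n) (h := h) (U := U n) hn hδ1 hκ.le
  set g := gammaMax (m n) h (U n) with hg
  have hlow : κ ≤ g ^ 2 * (2 * √2 * g ^ 3 + κ) / (1 - δ) := by
    rw [le_div_iff₀ hδ']
    have h6 : κ ≤ 2 * √2 * g ^ 3 + κ := le_add_of_nonneg_left (by positivity)
    have h7 : 1 * κ ≤ g ^ 2 * (2 * √2 * g ^ 3 + κ) :=
      mul_le_mul (one_le_pow₀ hg1) h6 hκ.le (by positivity)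
    nlinarith
  refine ⟨hn, fun i j => div_le_div_of_nonneg_right (hprof i j) bigN_nonneg, ?_, ?_, ?_, ?_⟩
  · refine Real.rpow_pos_of_pos ?_ _
    have : 0 < g := by linarith
    positivity
  · rw [h5]; exact hlow
  · rw [h5]
    gcongr
  · have := hRn.1
    rwa [div_le_iff₀ hn'] at this

lemma tendsto_zero_of_mul_pow_five_le {η : ℕ → ℝ} {C : ℝ}
    (h : ∀ᶠ n : ℕ in atTop, 0 < η n ∧ n * η n ^ 5 ≤ C) : Tendsto η atTop (𝓝 0) := by
  rw [Metric.tendsto_atTop']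
  intro ε hε
  have h1 : ∀ᶠ n : ℕ in atTop, C / n < ε ^ 5 :=
    (tendsto_const_div_atTop_nhds_zero_nat C).eventually_lt_const (by positivity)
  obtain ⟨N, hN⟩ := eventually_atTop.1 (h.and (h1.and (eventually_gt_atTop 0)))
  refine ⟨N, fun n hn => ?_⟩
  obtain ⟨⟨h2, h3⟩, h4, h5⟩ := hN n hn.le
  have hn' : (0 : ℝ) < n := by exact_mod_cast h5
  rw [Real.dist_eq, sub_zero, abs_of_pos h2]
  rw [div_lt_iff₀ hn'] at h4
  by_contra! hle
  have := pow_le_pow_left₀ hε.le hle 5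
  nlinarith

end Asymptotics

/-! ### Exceptional events and Borel–Cantelli. -/

section Concentration

open scoped Matrix.Norms.L2Operator

variable {n m p : ℕ}

/-- The exceptional set: the Gaussian part is large, or some entry of the resolvent is at distance
at least `t` from its mean. -/
def badSet (m : ℕ) (h : ℝ[X]) (U : Matrix (Fin n) (Fin p) ℝ) (lam η τ t : ℝ) :
    Set (GIdx n m p → ℝ) :=
  {g | τ ≤ ‖gaussMat gRow gCol (gCoef m h U) g‖} ∪
    ⋃ e : BIdx n m p × BIdx n m p, {g | t ≤ ‖linRes m h U lam η g e.1 e.2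
      - linMean m h U lam η e.1 e.2‖}

lemma measure_badSet_le (h : ℝ[X]) (U : Matrix (Fin n) (Fin p) ℝ) {lam η σ t : ℝ}
    (hη : 0 < η) (hσ0 : 0 < σ) (hN : 0 < bigN n m p)
    (hσ : ∀ i j, varProfile m h U i j ≤ σ / bigN n m p) (ht : 0 ≤ t) :
    stdG (GIdx n m p) (badSet m h U lam η (2 * (32 * σ + 7)) t)
      ≤ ENNReal.ofReal (2 * Real.exp (-bigN n m p) + bigN n m p ^ 2 *
        (4 * Real.exp (-(t ^ 2 * η ^ 4 / (48 * (σ / bigN n m p)))))) := by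
  have h1 : stdG (GIdx n m p) {g | 2 * (32 * σ + 7) ≤ ‖gaussMat gRow gCol (gCoef m h U) g‖}
      ≤ ENNReal.ofReal (2 * Real.exp (-bigN n m p)) := by
    rw [← card_BIdx]
    refine measure_norm_gaussMat_ge_le _ _ _ hσ0.le ?_
    rw [gaussVar_eq_varProfile, card_BIdx]; exact hσ
  rw [ENNReal.ofReal_add (by positivity) (by positivity)]
  refine (measure_union_le _ _).trans (add_le_add h1 ?_)
  refine (measure_iUnion_fintype_le _ _).trans ((Finset.sum_le_sum fun e _ =>
    measure_entry_sub_mean_ge_le (σ := σ / bigN n m p) cMat_isHermitian hη (le_im_specPoint lam η)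
      (by positivity) (by rw [gaussVar_eq_varProfile]; exact hσ) e.1 e.2 ht).trans ?_)
  rw [Finset.sum_const, Finset.card_univ, Fintype.card_prod, nsmul_eq_mul,
    ENNReal.ofReal_mul (by positivity : (0 : ℝ) ≤ bigN n m p ^ 2)]
  refine le_of_eq ?_
  congr 1
  rw [← card_BIdx, ← Nat.cast_pow, ENNReal.ofReal_natCast, sq]

lemma exp_neg_le_factorial_div {x : ℝ} (hx : 0 < x) (k : ℕ) :
    Real.exp (-x) ≤ k.factorial / x ^ k := by
  have h1 := Real.pow_div_factorial_le_exp x hx.le k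
  rw [Real.exp_neg, ← inv_div]
  exact inv_anti₀ (by positivity) h1

/-- The bound on the exceptional set at `t = η^{1/4}` is of order `n⁻²`. -/
lemma exceptional_bound_le {x N s σ c C R : ℝ} (hx : 0 < x) (hxN : x ≤ N) (hNR : N ≤ R * x)
    (hs : 0 < s) (hσ : 0 < σ) (hc : 0 < c) (hcx : c ≤ x * (s ^ 2) ^ 5)
    (hCx : x * (s ^ 2) ^ 5 ≤ C) (k : ℕ) (hk : k = 40) :
    2 * Real.exp (-N) + N ^ 2 * (4 * Real.exp (-(s * (s ^ 2) ^ 4 / (48 * (σ / N)))))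
      ≤ (4 + R ^ 2 * (4 * (k.factorial * (48 * σ / c) ^ k * C ^ 4))) / x ^ 2 := by
  have hN : 0 < N := hx.trans_le hxN
  have h1 : Real.exp (-N) ≤ 2 / x ^ 2 := by
    refine (exp_neg_le_factorial_div hN 2).trans ?_
    have : ((2 : ℕ).factorial : ℝ) = 2 := by norm_num
    rw [this]; gcongr
  -- With `s = √η`, the exponent is at least `z`, of order `1/s`. Power 40 of `1/z` is of order `s⁴⁰
  -- = (η⁵)⁴`, that is `x⁻⁴`; the factor `N²` from the union over entries leaves `x⁻²`.
  set z := c / (48 * σ * s) with hz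
  have hz0 : 0 < z := by positivity
  have h2 : z ≤ s * (s ^ 2) ^ 4 / (48 * (σ / N)) := by
    have h3 : s * (s ^ 2) ^ 4 / (48 * (σ / N)) = N * (s ^ 2) ^ 5 / (48 * σ * s) := by
      field_simp
    rw [h3, hz]
    refine div_le_div_of_nonneg_right (hcx.trans ?_) (by positivity)
    gcongr
  have h4 : Real.exp (-(s * (s ^ 2) ^ 4 / (48 * (σ / N))))
      ≤ k.factorial * (48 * σ / c) ^ k * C ^ 4 / x ^ 4 := by
    calc _ ≤ Real.exp (-z) := Real.exp_le_exp.2 (neg_le_neg h2)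
      _ ≤ k.factorial / z ^ k := exp_neg_le_factorial_div hz0 k
      _ = k.factorial * (48 * σ / c) ^ k * s ^ k := by
          rw [hz, div_pow, div_pow, mul_pow]; field_simp
      _ ≤ k.factorial * (48 * σ / c) ^ k * (C / x) ^ 4 := by
          refine mul_le_mul_of_nonneg_left ?_ (by positivity)
          have h5 : s ^ k = ((s ^ 2) ^ 5) ^ 4 := by rw [hk]; ring
          rw [h5]
          refine pow_le_pow_left₀ (by positivity) ?_ 4
          rw [le_div_iff₀ hx]; linarith
      _ = _ := by rw [div_pow]; ring
  have hR : N ^ 2 ≤ R ^ 2 * x ^ 2 := by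
    rw [← mul_pow]; exact pow_le_pow_left₀ hN.le hNR 2
  have hC : 0 < C := hc.trans_le (hcx.trans hCx)
  calc _ ≤ 2 * (2 / x ^ 2) + R ^ 2 * x ^ 2
        * (4 * (k.factorial * (48 * σ / c) ^ k * C ^ 4 / x ^ 4)) := by
        gcongr
    _ = _ := by field_simp; ring

variable {Ω : Type*}

/-- An inequality suffices for Borel–Cantelli, and it holds without measurability of `s`. -/
lemma AreIndepGaussian.measure_le [MeasurableSpace Ω] {P : Measure Ω} [IsProbabilityMeasure P]
    {W : Ω → Matrix (Fin m) (Fin p) ℝ} {X : Ω → Matrix (Fin n) (Fin p) ℝ}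
    {Z : Ω → Matrix (Fin m) (Fin n) ℝ}
    (hG : AreIndepGaussian P W X Z) (s : Set (GIdx n m p → ℝ)) :
    P {ω | (fun e => entries W X Z e ω) ∈ s} ≤ stdG (GIdx n m p) s := by
  have hm : ∀ e, AEMeasurable (entries W X Z e) P := fun e => (hG.law e).aemeasurable
  have h1 := (iIndepFun_iff_map_fun_eq_pi_map hm).1 hG.indep
  simp only [(hG.law _).map_eq] at h1
  have h2 := Measure.le_map_apply (aemeasurable_pi_lambda _ hm) s
  rw [h1] at h2
  exact h2

/-- Borel–Cantelli, for events whose probability is eventually at most `A / n²`. -/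
lemma ae_eventually_notMem_of_le [MeasurableSpace Ω] {P : Measure Ω} {s : ℕ → Set Ω} {A : ℝ}
    (hs : ∀ᶠ n : ℕ in atTop, P (s n) ≤ ENNReal.ofReal (A / n ^ 2)) :
    ∀ᵐ ω ∂P, ∀ᶠ n in atTop, ω ∉ s n := by
  obtain ⟨n₀, hn₀⟩ := eventually_atTop.1 hs
  have h1 : Summable fun n : ℕ => A / ((n + n₀ : ℕ) : ℝ) ^ 2 := by
    have h2 : Summable fun n : ℕ => A / (n : ℝ) ^ 2 := by
      simpa [div_eq_mul_inv] using
        (Real.summable_one_div_nat_pow.2 one_lt_two).mul_left A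
    exact (summable_nat_add_iff n₀).2 h2
  have h3 : ∑' n, P (s (n + n₀)) ≠ ⊤ :=
    ne_top_of_le_ne_top h1.tsum_ofReal_ne_top
      (ENNReal.tsum_le_tsum fun n => hn₀ _ (Nat.le_add_left _ _))
  filter_upwards [ae_eventually_notMem h3] with ω hω
  obtain ⟨k, hk⟩ := eventually_atTop.1 hω
  refine eventually_atTop.2 ⟨k + n₀, fun n hn => ?_⟩
  have := hk (n - n₀) (by omega)
  rwa [Nat.sub_add_cancel (by omega)] at this

lemma resolvent_linMat_eq (h : ℝ[X]) (U : Matrix (Fin n) (Fin p) ℝ)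
    (W : Ω → Matrix (Fin m) (Fin p) ℝ) (X : Ω → Matrix (Fin n) (Fin p) ℝ)
    (Z : Ω → Matrix (Fin m) (Fin n) ℝ) (lam η : ℝ) (ω : Ω) :
    resolvent (linMat h U (W ω) (X ω) (Z ω)) (specPoint n m p lam η)
      = linRes m h U lam η fun e => entries W X Z e ω := by
  rw [resolvent, map_linMat h U (fun e => entries W X Z e ω) (W ω) (X ω) (Z ω)
    (fun _ _ => rfl) (fun _ _ => rfl) (fun _ _ => rfl)]
  rfl

lemma norm_idDelta_le {A : Matrix (BIdx n m p) (BIdx n m p) ℂ} {B : ℝ} (hB0 : 0 ≤ B)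
    (hB : ∀ i j, ‖A i j‖ ≤ B) : ‖idDelta A‖ ≤ 2 * B := by
  refine (idDelta_isBlock A).norm_le hB0 fun i j => ?_
  rw [idDelta_apply]
  split_ifs
  · exact hB i j
  · simpa using hB0

lemma frobNorm_le {N : ℕ} {R : ℝ} (hN : 0 < N) (hR : bigN n m p ≤ R * N)
    (A : Matrix (BIdx n m p) (BIdx n m p) ℂ) : frobNorm N A ≤ √R * ‖A‖ := by
  have hN' : (0 : ℝ) < N := by exact_mod_cast hN
  have h1 : (A * Aᴴ).trace.re = ∑ i, ∑ j, ‖A i j‖ ^ 2 := by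
    rw [Matrix.trace, Complex.re_sum]
    refine Finset.sum_congr rfl fun i _ => ?_
    rw [Matrix.diag_apply, Matrix.mul_apply, Complex.re_sum]
    refine Finset.sum_congr rfl fun j _ => ?_
    rw [Matrix.conjTranspose_apply, RCLike.star_def, Complex.mul_conj, Complex.ofReal_re,
      Complex.normSq_eq_norm_sq]
  have h2 : ∑ i, ∑ j, ‖A i j‖ ^ 2 ≤ R * N * ‖A‖ ^ 2 :=
    (sum_sq_le_card_mul A).trans (by rw [card_BIdx]; gcongr)
  rw [frobNorm, h1]
  calc _ ≤ √(R * ‖A‖ ^ 2) := by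
        refine Real.sqrt_le_sqrt ?_
        rw [div_le_iff₀ hN']; linarith
    _ = _ := by
        have hR0 : 0 ≤ R := nonneg_of_mul_nonneg_left (bigN_nonneg.trans hR) hN'
        rw [Real.sqrt_mul hR0, Real.sqrt_sq (norm_nonneg _)]

end Concentration

/-! ### The deterministic error when `n η⁵` is of order one. -/

section Deterministic

open scoped Matrix.Norms.L2Operator

variable {n m p : ℕ}

/-- Distance between the mean resolvent and the square equivalent when `n η⁵` is of order one. -/
theorem norm_idDelta_linMean_sub_le_mul_sqrt {lam σ c : ℝ} (hlam : 0 < lam) (hσ0 : 0 < σ)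
    (hc : 0 < c) :
    ∃ A η₀ : ℝ, 0 < η₀ ∧ ∀ {n m p : ℕ} {h : ℝ[X]} {U : Matrix (Fin n) (Fin p) ℝ}
      {G : (BIdx n m p → ℂ) → Matrix (BIdx n m p) (BIdx n m p) ℂ} {η : ℝ},
      IsSquareEquivalent h U G → 0 < n → 0 < η → η ≤ η₀ →
      (∀ i j, varProfile m h U i j ≤ σ / bigN n m p) → c ≤ n * η ^ 5 →
      ‖idDelta (linMean m h U lam η) - G (specPoint n m p lam η)‖ ≤ A * √η := by
  -- The added 1 absorbs the contribution of the event where `‖H‖` is large.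
  set K := 2 * resBound lam (2 * (32 * σ + 7)) + 1 with hK
  have hK0 : 0 < K := by
    have := resBound_pos hlam (2 * (32 * σ + 7))
    positivity
  set D := (20 * √(σ ^ 3) + σ) / c with hD
  have hD0 : 0 < D := by positivity
  set L := 1 + lam + 1 + σ * K with hL
  have hL0 : 0 < L := by positivity
  -- The four thresholds ensure, in order: monotonicity of powers of `η`; that the exceptional
  -- contribution to the mean is at most 1; that the Dyson error is at most `1/4`; and that the
  -- perturbation is at most `η/2`.
  refine ⟨2 * (2 * (8 * D * L) * √K), min 1 (min (c / 2) (min (1 / (4 * D)) (1 / (16 * D * L)))),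
    by positivity, fun {n m p h U G η} hG hn hη hη0 hσ hcn => ?_⟩
  obtain ⟨h1, h23⟩ := le_min_iff.1 hη0
  obtain ⟨h2, h34⟩ := le_min_iff.1 h23
  obtain ⟨h3, h4⟩ := le_min_iff.1 h34
  have hn' : (0 : ℝ) < n := by exact_mod_cast hn
  set N := bigN n m p with hN
  have hnN : (n : ℝ) ≤ N := by
    have : (0 : ℝ) ≤ m := Nat.cast_nonneg m
    have : (0 : ℝ) ≤ p := Nat.cast_nonneg p
    rw [hN, bigN]; linarith
  have hN0 : 0 < N := hn'.trans_le hnN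
  have hNi : 1 / N ≤ η ^ 5 / c := by
    rw [div_le_div_iff₀ hN0 hc, one_mul, mul_comm]
    exact hcn.trans (by gcongr)
  have hKb : ∀ i, ‖linMean m h U lam η i i‖ ≤ K := by
    intro i
    refine (norm_linMean_entry_le h U hlam hη hσ0.le hσ i i).trans ?_
    rw [hK]
    gcongr
    have h5 : Real.exp (-N) ≤ η ^ 5 / c := by
      refine (exp_neg_le_factorial_div hN0 1).trans ?_
      simpa using hNi
    calc η⁻¹ * (2 * Real.exp (-N)) ≤ η⁻¹ * (2 * (η ^ 5 / c)) := by gcongr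
      _ = 2 * η ^ 4 / c := by field_simp
      _ ≤ 2 * η / c := by
          have : η ^ 4 ≤ η ^ 1 := pow_le_pow_of_le_one hη.le h1 (by norm_num)
          rw [pow_one] at this
          gcongr
      _ ≤ 1 := by rw [div_le_one hc]; linarith
  have hε : ∀ i j, ‖((cMat n m p - Matrix.diagonal (shiftDiag (varProfile m h U)
      (specPoint n m p lam η) fun i => linMean m h U lam η i i)) * linMean m h U lam η - 1) i j‖
      ≤ D * η ^ 2 := by
    intro i j
    have h5 := norm_meanRes_dyson_le (a := gRow) (b := gCol) (s := gCoef m h U)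
      (cMat_isHermitian (n := n) (m := m) (p := p)) hη (le_im_specPoint lam η)
      (σ := σ / N) (by positivity) (by rw [gaussVar_eq_varProfile]; exact hσ)
      (by rw [gaussVar_eq_varProfile]; exact varProfile_nonneg h U) i j
    rw [gaussVar_eq_varProfile] at h5
    refine h5.trans ?_
    -- With `N` terms and variances of order `1/N`, the root is of order `1/N`. Then `1/N ≤ η⁵/c`
    -- turns `N⁻¹ η⁻³` into `η²`.
    have h6 : √((Fintype.card (BIdx n m p) : ℝ) * (σ / N) ^ 3) = √(σ ^ 3) * (1 / N) := by
      have : (Fintype.card (BIdx n m p) : ℝ) * (σ / N) ^ 3 = σ ^ 3 * (1 / N) ^ 2 := by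
        rw [card_BIdx, ← hN]; field_simp
      rw [this, Real.sqrt_mul (by positivity), Real.sqrt_sq (by positivity)]
    have h7 : (η⁻¹) ^ 2 ≤ (η⁻¹) ^ 3 := pow_le_pow_right₀ ((one_le_inv₀ hη).2 h1) (by norm_num)
    rw [h6]
    calc 20 * (√(σ ^ 3) * (1 / N)) * η⁻¹ ^ 3 + σ / N * η⁻¹ ^ 2
        ≤ 20 * (√(σ ^ 3) * (1 / N)) * η⁻¹ ^ 3 + σ / N * η⁻¹ ^ 3 := by gcongr
      _ = (20 * √(σ ^ 3) + σ) * (1 / N) * η⁻¹ ^ 3 := by ring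
      _ ≤ (20 * √(σ ^ 3) + σ) * (η ^ 5 / c) * η⁻¹ ^ 3 := by gcongr
      _ = D * η ^ 2 := by rw [hD]; field_simp
  have hLη : 1 + lam + η + σ * K ≤ L := by rw [hL]; gcongr
  have hDη : D * η ^ 2 ≤ 1 / 4 := by
    calc D * η ^ 2 ≤ D * η := by
          have : η ^ 2 ≤ η ^ 1 := pow_le_pow_of_le_one hη.le h1 (by norm_num)
          rw [pow_one] at this
          gcongr
      _ ≤ D * (1 / (4 * D)) := by gcongr
      _ = 1 / 4 := by field_simp
  have hsm : 8 * (D * η ^ 2) * (1 + lam + η + σ * K) ≤ 8 * D * L * η ^ 2 := by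
    calc 8 * (D * η ^ 2) * (1 + lam + η + σ * K) ≤ 8 * (D * η ^ 2) * L := by gcongr
      _ = _ := by ring
  have hsm2 : 8 * D * L * η ^ 2 ≤ η / 2 := by
    calc 8 * D * L * η ^ 2 = 8 * D * L * η * η := by ring
      _ ≤ 8 * D * L * (1 / (16 * D * L)) * η := by gcongr
      _ = η / 2 := by field_simp; norm_num
  refine (norm_idDelta_linMean_sub_le hG hlam.le hη hσ0.le hσ hK0.le hKb (by positivity) hε hDη
    (hsm.trans hsm2)).trans ?_
  calc _ ≤ 2 * (2 * (8 * D * L * η ^ 2) / η * √(K * η⁻¹)) := by gcongr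
    _ = 2 * (2 * (8 * D * L) * √K) * (η * √(η⁻¹)) := by
        rw [Real.sqrt_mul hK0.le]; field_simp
    _ = _ := by
        congr 1
        rw [Real.sqrt_inv, ← div_eq_mul_inv, Real.div_sqrt]

end Deterministic

end RFSquare

end

/-! ### The main theorem. -/

open scoped Matrix.Norms.L2Operator in
theorem corollary3p4 {Ω : Type*} [MeasurableSpace Ω] (P : Measure Ω) [IsProbabilityMeasure P]
    -- dimensions, indexed by the sample size `n`
    (m p : ℕ → ℕ) (φm φp : ℝ) (hφm : 0 < φm) (hφp : 0 < φp)
    (hm : Tendsto (fun n : ℕ => (n : ℝ) / (m n : ℝ)) atTop (𝓝 φm))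
    (hp : Tendsto (fun n : ℕ => (n : ℝ) / (p n : ℝ)) atTop (𝓝 φp))
    -- odd polynomial activation function
    (h : Polynomial ℝ) (hodd : ∀ x : ℝ, h.eval (-x) = -h.eval x)
    -- profiles of the data matrices
    (U : ∀ n : ℕ, Matrix (Fin n) (Fin (p n)) ℝ) (γ : ℝ) (hγ : 0 < γ)
    (hU : ∀ n, RFSquare.HasBoundedFactorization γ (U n))
    -- the Gaussian matrices
    (W : ∀ n : ℕ, Ω → Matrix (Fin (m n)) (Fin (p n)) ℝ)
    (X : ∀ n : ℕ, Ω → Matrix (Fin n) (Fin (p n)) ℝ)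
    (Z : ∀ n : ℕ, Ω → Matrix (Fin (m n)) (Fin n) ℝ)
    (hG : ∀ n, RFSquare.AreIndepGaussian P (W n) (X n) (Z n))
    (lam δ κ : ℝ) (hlam : 0 < lam) (hδ0 : 0 < δ) (hδ1 : δ < 1) (hκ : 0 < κ) :
    -- the square equivalent exists and is unique
    (∀ n, ∃ G : (RFSquare.BIdx n (m n) (p n) → ℂ) →
          Matrix (RFSquare.BIdx n (m n) (p n)) (RFSquare.BIdx n (m n) (p n)) ℂ,
        RFSquare.IsSquareEquivalent h (U n) G ∧
        ∀ G', RFSquare.IsSquareEquivalent h (U n) G' →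
          Set.EqOn G' G (RFSquare.DPlus (RFSquare.BIdx n (m n) (p n)))) ∧
    -- and it approximates the resolvent
    ∀ Qsq : ∀ n : ℕ, (RFSquare.BIdx n (m n) (p n) → ℂ) →
          Matrix (RFSquare.BIdx n (m n) (p n)) (RFSquare.BIdx n (m n) (p n)) ℂ,
      (∀ n, RFSquare.IsSquareEquivalent h (U n) (Qsq n)) →
      (∀ᵐ ω ∂P, Tendsto (fun n : ℕ => RFSquare.opNorm
          (RFSquare.idDelta (RFSquare.resolvent
              (RFSquare.linMat h (U n) (W n ω) (X n ω) (Z n ω))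
              (RFSquare.specPoint n (m n) (p n) lam (RFSquare.etaN (m n) h (U n) δ κ)))
            - Qsq n (RFSquare.specPoint n (m n) (p n) lam
                (RFSquare.etaN (m n) h (U n) δ κ)))) atTop (𝓝 0)) ∧
      (∀ᵐ ω ∂P, Tendsto (fun n : ℕ => RFSquare.frobNorm n
          (Qsq n (RFSquare.specPoint n (m n) (p n) lam
                (RFSquare.etaN (m n) h (U n) δ κ))
            - RFSquare.idDelta (RFSquare.resolvent
                (RFSquare.linMat h (U n) (W n ω) (X n ω) (Z n ω))
                (RFSquare.specPoint n (m n) (p n) lam 0)))) atTop (𝓝 0)) := by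
  refine ⟨fun n => RFSquare.exists_squareEquivalent (m n) h (U n), fun Qsq hQ => ?_⟩
  obtain ⟨σ, c, C, R, hσ0, hc, hC0, hR0, hev⟩ :=
    RFSquare.exists_asymptotic_bounds hφm hφp hm hp h U hγ hU hδ0 hδ1 hκ
  obtain ⟨A, η₀, hη₀, hA⟩ := RFSquare.norm_idDelta_linMean_sub_le_mul_sqrt hlam hσ0 hc
  set η : ℕ → ℝ := fun n => RFSquare.etaN (m n) h (U n) δ κ with hηdef
  set τ : ℝ := 2 * (32 * σ + 7) with hτ
  have hη0 : Tendsto η atTop (𝓝 0) :=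
    RFSquare.tendsto_zero_of_mul_pow_five_le (hev.mono fun n hn => ⟨hn.2.2.1, hn.2.2.2.2.1⟩)
  have hs0 : Tendsto (fun n => √(η n)) atTop (𝓝 0) := by
    simpa [Function.comp_def] using (Real.continuous_sqrt.tendsto 0).comp hη0
  have ht0 : Tendsto (fun n => √√(η n)) atTop (𝓝 0) := by
    simpa [Function.comp_def] using (Real.continuous_sqrt.tendsto 0).comp hs0
  -- The deviation threshold is `t = η^{1/4}`: it tends to zero, yet `t² η⁴ N` is at least of order
  -- `η^{-1/2}`, so the tails stay summable.
  have hgood : ∀ᵐ ω ∂P, ∀ᶠ n in atTop, (fun e => RFSquare.entries (W n) (X n) (Z n) e ω)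
      ∉ RFSquare.badSet (m n) h (U n) lam (η n) τ (√√(η n)) := by
    refine RFSquare.ae_eventually_notMem_of_le
      (A := 4 + R ^ 2 * (4 * ((Nat.factorial 40) * (48 * σ / c) ^ 40 * C ^ 4)))
      (s := fun n => {ω | (fun e => RFSquare.entries (W n) (X n) (Z n) e ω)
        ∈ RFSquare.badSet (m n) h (U n) lam (η n) τ (√√(η n))}) ?_
    filter_upwards [hev] with n hn
    obtain ⟨hn0, hprof, hηn, hcn, hCn, hRn⟩ := hn
    have hn' : (0 : ℝ) < n := by exact_mod_cast hn0
    have hnN : (n : ℝ) ≤ RFSquare.bigN n (m n) (p n) := by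
      rw [RFSquare.bigN, add_assoc]
      exact le_add_of_nonneg_right (by positivity)
    refine ((hG n).measure_le _).trans ((RFSquare.measure_badSet_le h (U n) hηn hσ0
      (hn'.trans_le hnN) hprof (Real.sqrt_nonneg _)).trans (ENNReal.ofReal_le_ofReal ?_))
    have hs : √(η n) ^ 2 = η n := Real.sq_sqrt hηn.le
    have hb := RFSquare.exceptional_bound_le (s := √(η n)) (C := C) hn' hnN hRn (Real.sqrt_pos.2 hηn) hσ0 hc
      (by rw [hs]; exact hcn) (by rw [hs]; exact hCn) 40 rfl
    rw [hs] at hb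
    rw [Real.sq_sqrt (Real.sqrt_nonneg _)]
    exact hb
  -- The first bound adds the fluctuation `2η^{1/4}` of the projected resolvent to the deterministic
  -- error `A√η`. The second is the cost of moving from `η_N` down to the real axis.
  have hbound : ∀ᵐ ω ∂P, ∀ᶠ n in atTop,
      ‖RFSquare.idDelta (RFSquare.resolvent
          (RFSquare.linMat h (U n) (W n ω) (X n ω) (Z n ω))
          (RFSquare.specPoint n (m n) (p n) lam (η n)))
        - Qsq n (RFSquare.specPoint n (m n) (p n) lam (η n))‖
        ≤ 2 * √√(η n) + A * √(η n) ∧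
      ‖RFSquare.idDelta (RFSquare.resolvent
          (RFSquare.linMat h (U n) (W n ω) (X n ω) (Z n ω))
          (RFSquare.specPoint n (m n) (p n) lam (η n))
        - RFSquare.resolvent (RFSquare.linMat h (U n) (W n ω) (X n ω) (Z n ω))
          (RFSquare.specPoint n (m n) (p n) lam 0))‖
        ≤ 2 * (2 * RFSquare.resBound lam τ ^ 2 * η n) := by
    filter_upwards [hgood] with ω hω
    filter_upwards [hω, hev, hη0.eventually_le_const hη₀] with n hbad hn hηle
    obtain ⟨hn0, hprof, hηn, hcn, hCn, hRn⟩ := hn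
    simp only [RFSquare.resolvent_linMat_eq]
    set g : RFSquare.GIdx n (m n) (p n) → ℝ :=
      fun e => RFSquare.entries (W n) (X n) (Z n) e ω with hg
    simp only [RFSquare.badSet, Set.mem_union, Set.mem_iUnion, Set.mem_ofPred_eq, not_or,
      not_exists, not_le] at hbad
    refine ⟨?_, ?_⟩
    · have h1 := RFSquare.norm_idDelta_le
        (A := RFSquare.linRes (m n) h (U n) lam (η n) g - RFSquare.linMean (m n) h (U n) lam (η n))
        (Real.sqrt_nonneg (√(η n))) fun i j => (hbad.2 (i, j)).le
      have h2 := hA (hQ n) hn0 hηn hηle hprof hcn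
      rw [RFSquare.idDelta_sub] at h1
      refine (norm_sub_le_norm_sub_add_norm_sub _ _ _).trans (add_le_add h1 h2)
    · exact RFSquare.norm_idDelta_le (by positivity) fun i j =>
        (RFSquare.entry_le_norm _ i j).trans
          (RFSquare.gaussRes_specPoint_bounds h (U n) hlam hηn g hbad.1.le rfl).2
  have hlim : Tendsto (fun n => 2 * √√(η n) + A * √(η n)) atTop (𝓝 0) := by
    simpa using (ht0.const_mul 2).add (hs0.const_mul A)
  refine ⟨?_, ?_⟩
  · filter_upwards [hbound] with ω hω
    -- `opNorm` unfolds to the L2 operator norm used in `hbound`.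
    exact squeeze_zero' (Eventually.of_forall fun n => norm_nonneg _)
      (hω.mono fun n hn => hn.1) hlim
  · have hlim2 : Tendsto (fun n => √R * (2 * √√(η n) + A * √(η n)
        + 2 * (2 * RFSquare.resBound lam τ ^ 2 * η n))) atTop (𝓝 0) := by
      simpa using (hlim.add ((hη0.const_mul (2 * RFSquare.resBound lam τ ^ 2)).const_mul 2)).const_mul
        √R
    filter_upwards [hbound] with ω hω
    refine squeeze_zero' (Eventually.of_forall fun n => Real.sqrt_nonneg _) ?_ hlim2
    filter_upwards [hω, hev] with n hn hn'
    obtain ⟨hn0, -, -, -, -, hRn⟩ := hn'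
    -- Since `N ≤ R n`, the normalised Frobenius norm is at most `√R` times the operator norm, so
    -- the second limit follows by inserting the projected resolvent at `η_N`.
    refine (RFSquare.frobNorm_le hn0 hRn _).trans
      (mul_le_mul_of_nonneg_left ?_ (Real.sqrt_nonneg _))
    refine (norm_sub_le_norm_sub_add_norm_sub _ (RFSquare.idDelta (RFSquare.resolvent
        (RFSquare.linMat h (U n) (W n ω) (X n ω) (Z n ω))
        (RFSquare.specPoint n (m n) (p n) lam (η n)))) _).trans (add_le_add ?_ ?_)
    · rw [norm_sub_rev]; exact hn.1
    · rw [← RFSquare.idDelta_sub]; exact hn.2
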